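/- Let $G$ be a simply connected nilpotent real Lie group with Lie algebra $\mathfrak g$, let $\Gamma\subset G$ be a cocompact lattice, and let $f$ be a Lie group automorphism of $G$ with $f(\Gamma)=\Gamma$ whose derivative $f_*:\mathfrak g\to\mathfrak g$ at the identity has no complex eigenvalue of absolute value one (so that $f$ induces an algebraic Anosov diffeomorphism of $\Gamma\backslash G$). Let $$\mathfrak g^s=\{v\in\mathfrak g : f_*^n(v)\to 0 \text{ as } n\to+\infty\},\qquad \mathfrak g^u=\{v\in\mathfrak g : f_*^n(v)\to 0 \text{ as } n\to-\infty\},$$ which are Lie subalgebras of $\mathfrak g$, and let $G^s$ and $G^u$ be the corresponding connected subgroups of $G$, i.e. the subgroups generated by $\exp(\mathfrak g^s)$ and $\exp(\mathfrak g^u)$. Let $C_0=G$, $C_{j+1}=[G,C_j]$ be the descending central series of $G$, put $\Gamma_j=\Gamma\cap C_j$, and let $\Delta_j=C_j/C_{j+1}\Gamma_j$. Then $P=G^s$ and $P=G^u$ are $\Gamma$-acceptable. That is, each of them is a closed connected subgroup of $G$, and for every $j\ge 0$ the image of $P\cap C_j$ in $\Delta_j$ is dense. -/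

import Mathlib

open scoped Manifold ContDiff Topology
open Filter

namespace Nilmanifold

/-- Automorphisms of a real Lie group `G` modelled on `E`: group automorphisms that are smooth
together with their inverse. -/
structure LieAut (E : Type*) [NormedAddCommGroup E] [NormedSpace ℝ E]
    (G : Type*) [TopologicalSpace G] [ChartedSpace E G] [Group G] extends G ≃* G where
  contMDiff_toFun : ContMDiff 𝓘(ℝ, E) 𝓘(ℝ, E) ∞ toFun
  contMDiff_invFun : ContMDiff 𝓘(ℝ, E) 𝓘(ℝ, E) ∞ invFun

/-- The subspace of all `v` with `Tⁿ v → 0` as `n` tends to `±∞` in `ℤ` (along `l`). -/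
def vanishingSubspace {V : Type*} [AddCommGroup V] [TopologicalSpace V] [IsTopologicalAddGroup V]
    [Module ℝ V] [ContinuousSMul ℝ V] (T : V ≃L[ℝ] V) (l : Filter ℤ) : Submodule ℝ V where
  carrier := {v | Tendsto (fun n : ℤ => (T ^ n) v) l (𝓝 0)}
  zero_mem' := by simp [tendsto_const_nhds]
  add_mem' := fun {v w} hv hw => by
    have h := Tendsto.add (show Tendsto (fun n : ℤ => (T ^ n) v) l (𝓝 0) from hv)
      (show Tendsto (fun n : ℤ => (T ^ n) w) l (𝓝 0) from hw)
    simpa using h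
  smul_mem' := fun c v hv => by
    have h := Tendsto.const_smul (show Tendsto (fun n : ℤ => (T ^ n) v) l (𝓝 0) from hv) c
    simpa using h

section

variable {E : Type*} [NormedAddCommGroup E] [NormedSpace ℝ E]
variable {G : Type*} [TopologicalSpace G] [ChartedSpace E G] [Group G]

/-- The diffeomorphism underlying a Lie group automorphism. -/
def LieAut.toDiffeomorph (f : LieAut E G) : Diffeomorph 𝓘(ℝ, E) 𝓘(ℝ, E) G G ∞ where
  toEquiv := f.toMulEquiv.toEquiv
  contMDiff_toFun := f.contMDiff_toFun
  contMDiff_invFun := f.contMDiff_invFun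

/-- The automorphism `f_*` of the Lie algebra `T_1 G`, i.e. the derivative of `f` at `1`. Its
target `T_{f 1} G` is `T_1 G` since `f 1 = 1`; in Mathlib both are type synonyms of `E`
(identified with `E` through the preferred chart at `f 1 = 1`). -/
noncomputable def LieAut.lieMap [LieGroup 𝓘(ℝ, E) ∞ G] (f : LieAut E G) :
    GroupLieAlgebra 𝓘(ℝ, E) G ≃L[ℝ] GroupLieAlgebra 𝓘(ℝ, E) G :=
  f.toDiffeomorph.mfderivToContinuousLinearEquiv (by simp) 1

/-- The stable subspace `𝔤ˢ`: all `v` with `f_*ⁿ v → 0` as `n → ∞`. -/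
noncomputable def stableSubspace [LieGroup 𝓘(ℝ, E) ∞ G] (f : LieAut E G) :
    Submodule ℝ (GroupLieAlgebra 𝓘(ℝ, E) G) :=
  vanishingSubspace f.lieMap atTop

/-- The unstable subspace `𝔤ᵘ`: all `v` with `f_*ⁿ v → 0` as `n → -∞`. -/
noncomputable def unstableSubspace [LieGroup 𝓘(ℝ, E) ∞ G] (f : LieAut E G) :
    Submodule ℝ (GroupLieAlgebra 𝓘(ℝ, E) G) :=
  vanishingSubspace f.lieMap atBot

/-- `γ` is a smooth one-parameter subgroup of `G` with velocity `v ∈ T_1 G` at time `0`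
(note that `γ 0 = 1`), so that `γ t = exp (t v)`. -/
structure IsOneParameterSubgroup (γ : ℝ → G) (v : GroupLieAlgebra 𝓘(ℝ, E) G) : Prop where
  contMDiff : ContMDiff 𝓘(ℝ, ℝ) 𝓘(ℝ, E) ∞ γ
  map_add : ∀ s t, γ (s + t) = γ s * γ t
  velocity : (mfderiv 𝓘(ℝ, ℝ) 𝓘(ℝ, E) γ 0 : ℝ →L[ℝ] E) 1 = v

/-- The subgroup of `G` generated by `exp V`, where `exp v = γ 1` for the one-parameter subgroup
`γ` with velocity `v`. If `V` is a Lie subalgebra, this is the connected subgroup of `G`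
corresponding to `V`. -/
def integralSubgroup (V : Submodule ℝ (GroupLieAlgebra 𝓘(ℝ, E) G)) : Subgroup G :=
  Subgroup.closure {g | ∃ v ∈ V, ∃ γ : ℝ → G, IsOneParameterSubgroup γ v ∧ γ 1 = g}

/-- The stable subgroup `Gˢ`, the connected subgroup of `G` corresponding to `𝔤ˢ`. -/
noncomputable def stableSubgroup [LieGroup 𝓘(ℝ, E) ∞ G] (f : LieAut E G) : Subgroup G :=
  integralSubgroup (stableSubspace f)

/-- The unstable subgroup `Gᵘ`, the connected subgroup of `G` corresponding to `𝔤ᵘ`. -/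
noncomputable def unstableSubgroup [LieGroup 𝓘(ℝ, E) ∞ G] (f : LieAut E G) : Subgroup G :=
  integralSubgroup (unstableSubspace f)

/-- The automorphism `f` of `G` induces an algebraic Anosov diffeomorphism of `Γ \ G`:
`f(Γ) = Γ`, and no complex eigenvalue of `f_*` has absolute value one. -/
structure IsAlgebraicAnosov [LieGroup 𝓘(ℝ, E) ∞ G] (Γ : Subgroup G) (f : LieAut E G) :
    Prop where
  map_eq : Γ.map f.toMulEquiv.toMonoidHom = Γ
  not_hasEigenvalue : ∀ z : ℂ, ‖z‖ = 1 →
    ¬ Module.End.HasEigenvalue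
      (LinearMap.baseChange ℂ
        (f.lieMap.toLinearEquiv.toLinearMap : Module.End ℝ (GroupLieAlgebra 𝓘(ℝ, E) G))) z

end

section

variable {G : Type*} [TopologicalSpace G] [Group G]

/-- `Γ` is a cocompact lattice in `G`: it is discrete, and `Γ \ G` is compact. -/
structure IsCocompactLattice (Γ : Subgroup G) : Prop where
  discrete : DiscreteTopology Γ
  cocompact : CompactSpace (Quotient (QuotientGroup.rightRel Γ))

/-- The term `C_j` of the descending central series: `C_0 = G`, `C_{j+1} = [G, C_j]`. -/
abbrev centralSeries (G : Type*) [Group G] (j : ℕ) : Subgroup G :=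
  (⊤ : Subgroup G).lowerCentralSeries j

/-- `Δ_j = C_j / C_{j+1} Γ_j` with `Γ_j = Γ ∩ C_j`, with the quotient topology. -/
abbrev Delta (Γ : Subgroup G) (j : ℕ) : Type _ :=
  centralSeries G j ⧸
    (centralSeries G (j + 1) ⊔ Γ ⊓ centralSeries G j).subgroupOf (centralSeries G j)

/-- `P` is `Γ`-acceptable: it is closed and connected, and the image of `P ∩ C_j` in `Δ_j` is
dense for every `j` (for `j` beyond the nilpotency class, `Δ_j` is a point). -/
structure IsAcceptable (Γ P : Subgroup G) : Prop where
  isClosed : IsClosed (P : Set G)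
  isConnected : IsConnected (P : Set G)
  dense : ∀ j : ℕ,
    Dense ((fun x : centralSeries G j => (QuotientGroup.mk x : Delta Γ j)) ''
      {x | (x : G) ∈ P})

end

end Nilmanifold

/-! Let S and U be the sets of x in G with fⁿ x → 1 as n → +∞, respectively n → -∞. Near 1 the
logarithm turns f into f_*, and every contracted element eventually gets there, so S = exp 𝔤ˢ and U
= exp 𝔤ᵘ (`exists_exp_eq_of_mem_contractedSubgroup`). Hence Gˢ = S and Gᵘ = U, and Gᵘ is the group
Gˢ of f⁻¹, so it suffices to treat S.

The geometric input is that (a, b) ↦ exp a · exp b is a homeomorphism from 𝔤ˢ × 𝔤ᵘ onto G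
(`isHomeomorph_exp_mul_exp`). Hyperbolicity makes 𝔤ˢ and 𝔤ᵘ complementary. Nilpotency makes Ad
unipotent, and then 𝔤ˢ meets Ad(g) 𝔤ᵘ trivially for every g (`disjoint_map_Ad`). So all double
cosets S g U are open, and connectedness leaves only one. With the topologies of 𝔤ˢ and 𝔤ᵘ on S and
U, the map (s, u) ↦ s u⁻¹ is the quotient of S × U by a discrete subgroup, thus a covering of a
simply connected space by a connected one, thus a homeomorphism. Since S corresponds to 𝔤ˢ × 0, it
is closed and connected.

For density let x be in C_j. Modulo C_{j+1}, fⁿ x equals exp v with v tangent to C_j. The vectors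
whose exponential lies in Γ_j modulo C_{j+1} span this tangent space
(`centralTangent_le_span_latticeTangent`), so v = l + s + u with l such a vector, s in 𝔤ˢ, and u in
𝔤ᵘ bounded independently of n. Applying f⁻ⁿ, x agrees modulo C_{j+1} with exp(f_*⁻ⁿ u) times an
element of S ∩ C_j times an element of Γ_j, and f_*⁻ⁿ u → 0.

Neither the Lie bracket nor the Baker–Campbell–Hausdorff formula enters. The derivative of
multiplication at 1 gives exp(v + w) as the limit of (exp(v/n) exp(w/n))ⁿ, and modulo a suitable
term of the central series these powers do not depend on n. This also yields, by descending
induction on j, that C_j is closed and compatible with the product decomposition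
(`isClosed_centralSeries_and_split`). -/

namespace Nilmanifold
open Set Metric
open scoped NNReal commutatorElement

/-! ### Local group laws and their left invariant frames -/

section LocalGroupLaw

variable {E : Type*} [NormedAddCommGroup E] [NormedSpace ℝ E]

/-- A smooth local group law on `E` with neutral element `0`. -/
structure IsLocalGroupLaw (m : E × E → E) : Prop where
  exists_contDiffOn : ∃ O : Set (E × E), IsOpen O ∧ (0, 0) ∈ O ∧ ContDiffOn ℝ ∞ m O
  right_zero : ∀ᶠ x in 𝓝 (0 : E), m (x, 0) = x
  left_zero : ∀ᶠ y in 𝓝 (0 : E), m (0, y) = y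
  assoc : ∀ᶠ p : E × E × E in 𝓝 0, m (m (p.1, p.2.1), p.2.2) = m (p.1, m (p.2.1, p.2.2))

/-- The left invariant frame of a local group law: `F x` is the derivative at `0` of left
translation by `x`. -/
structure LocalFrame (m : E × E → E) where
  F : E → E →L[ℝ] E
  K : ℝ≥0
  a : ℝ
  b : ℝ
  b_pos : 0 < b
  b_le : b ≤ a
  contDiffOn : ContDiffOn ℝ ∞ F (ball 0 a)
  lipschitz : LipschitzOnWith K F (ball 0 a)
  norm_le : ∀ x ∈ ball (0 : E) a, ‖F x‖ ≤ 2
  map_zero : F 0 = ContinuousLinearMap.id ℝ E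
  right_zero : ∀ x ∈ ball (0 : E) a, m (x, 0) = x
  hasFDerivAt : ∀ x ∈ ball (0 : E) a, HasFDerivAt (fun z => m (x, z)) (F x) 0
  mem_ball : ∀ x ∈ ball (0 : E) b, ∀ y ∈ ball (0 : E) b, m (x, y) ∈ ball (0 : E) a
  exists_hasFDerivAt : ∀ x ∈ ball (0 : E) b, ∀ y ∈ ball (0 : E) b,
    ∃ D : E →L[ℝ] E, HasFDerivAt (fun z => m (x, z)) D y ∧ D.comp (F y) = F (m (x, y))

/-- Differentiating associativity m(m(x, y), z) = m(x, m(y, z)) in z at 0 gives the left invariance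
of the frame. The remaining conditions hold near 0, and the radii are shrunk accordingly. -/
theorem IsLocalGroupLaw.nonempty_localFrame {m : E × E → E} (hm : IsLocalGroupLaw m) :
    Nonempty (LocalFrame m) := by
  obtain ⟨O, hO, h0, hsm⟩ := hm.exists_contDiffOn
  have hm0 : m (0, 0) = 0 := hm.right_zero.self_of_nhds
  have hdiff : ∀ p ∈ O, HasFDerivAt m (fderiv ℝ m p) p := fun p hp =>
    ((hsm.contDiffAt (hO.mem_nhds hp)).differentiableAt (by simp)).hasFDerivAt
  let F : E → E →L[ℝ] E := fun x =>
    (fderiv ℝ m (x, 0)).comp (ContinuousLinearMap.inr ℝ E E)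
  have hpart : ∀ x y, (x, y) ∈ O → HasFDerivAt (fun z => m (x, z))
      ((fderiv ℝ m (x, y)).comp (ContinuousLinearMap.inr ℝ E E)) y := fun x y h =>
    (hdiff _ h).comp y (hasFDerivAt_prodMk_right x y)
  let O₁ : Set E := {x | (x, (0 : E)) ∈ O}
  have hO₁ : IsOpen O₁ := hO.preimage (by fun_prop)
  have hF : ContDiffOn ℝ ∞ F O₁ := by
    have h1 : ContDiffOn ℝ ∞ (fderiv ℝ m) O := hsm.fderiv_of_isOpen hO (by simp)
    have h2 : ContDiffOn ℝ ∞ (fun x : E => fderiv ℝ m (x, 0)) O₁ :=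
      h1.comp (by fun_prop) (fun x hx => hx)
    exact h2.clm_comp contDiffOn_const
  have hF0 : F 0 = ContinuousLinearMap.id ℝ E := by
    have h1 : HasFDerivAt (fun z => m (0, z)) (F 0) 0 := hpart 0 0 h0
    have h2 : HasFDerivAt (fun z : E => m (0, z)) (ContinuousLinearMap.id ℝ E) 0 :=
      (hasFDerivAt_id (𝕜 := ℝ) (0 : E)).congr_of_eventuallyEq hm.left_zero
    exact h1.unique h2
  have hF00 : ContDiffAt ℝ ∞ F 0 := hF.contDiffAt (hO₁.mem_nhds h0)
  obtain ⟨K, s, hs, hl⟩ := (hF00.of_le (m := 1) (by simp)).exists_lipschitzOnWith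
  have hn : ∀ᶠ x in 𝓝 (0 : E), ‖F x‖ ≤ 2 := by
    have : Tendsto (fun x => ‖F x‖) (𝓝 0) (𝓝 ‖F 0‖) := hF00.continuousAt.norm
    refine this.eventually (Iic_mem_nhds ?_)
    rw [hF0]
    exact ContinuousLinearMap.norm_id_le.trans_lt (by norm_num)
  obtain ⟨a, ha, hball⟩ := Metric.eventually_nhds_iff_ball.mp
    ((hO₁.eventually_mem h0).and ((eventually_mem_set.mpr hs).and (hn.and hm.right_zero)))
  have hmc : ContinuousAt m (0, 0) := (hdiff _ h0).continuousAt
  have hcomp : ∀ᶠ p : E × E in 𝓝 0, p ∈ O ∧ m p ∈ ball (0 : E) a ∧ ‖p.2‖ < a ∧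
      ∀ᶠ z in 𝓝 (0 : E), m (m p, z) = m (p.1, m (p.2, z)) := by
    have h1 : ∀ᶠ p : E × E in 𝓝 0, p ∈ O := hO.mem_nhds h0
    have h2 : ∀ᶠ p : E × E in 𝓝 0, m p ∈ ball (0 : E) a :=
      hmc (ball_mem_nhds _ ha |> fun h => by simpa [hm0] using h)
    have h3 : ∀ᶠ p : E × E in 𝓝 0, ‖p.2‖ < a := by
      have : Tendsto (fun p : E × E => ‖p.2‖) (𝓝 0) (𝓝 ‖(0 : E × E).2‖) :=
        (by fun_prop : Continuous fun p : E × E => ‖p.2‖).tendsto 0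
      exact this.eventually (gt_mem_nhds (by simpa using ha))
    have h4 : ∀ᶠ p : E × E in 𝓝 0, ∀ᶠ z in 𝓝 (0 : E), m (m p, z) = m (p.1, m (p.2, z)) := by
      have h5 : Tendsto (fun q : (E × E) × E => (q.1.1, q.1.2, q.2)) (𝓝 0) (𝓝 0) :=
        (by fun_prop : Continuous fun q : (E × E) × E => (q.1.1, q.1.2, q.2)).tendsto' _ _ rfl
      have h6 := h5.eventually hm.assoc
      rw [show (0 : (E × E) × E) = ((0 : E × E), (0 : E)) from rfl, nhds_prod_eq] at h6
      exact h6.curry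
    filter_upwards [h1, h2, h3, h4] with p a b c d using ⟨a, b, c, d⟩
  obtain ⟨b, hb, hbb⟩ := Metric.eventually_nhds_iff_ball.mp hcomp
  have hprod : ∀ x ∈ ball (0 : E) (min a b), ∀ y ∈ ball (0 : E) (min a b),
      (x, y) ∈ ball (0 : E × E) b := fun x hx y hy => by
    simp only [mem_ball, dist_zero_right, lt_min_iff, Prod.norm_mk, max_lt_iff] at *
    exact ⟨hx.2, hy.2⟩
  refine ⟨⟨F, K, a, min a b, lt_min ha hb, min_le_left _ _, hF.mono fun x hx => (hball x hx).1,
    hl.mono fun x hx => (hball x hx).2.1, fun x hx => (hball x hx).2.2.1, hF0,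
    fun x hx => (hball x hx).2.2.2, fun x hx => hpart x 0 (hball x hx).1,
    fun x hx y hy => (hbb _ (hprod x hx y hy)).2.1, fun x hx y hy => ?_⟩⟩
  obtain ⟨h1, h2, h3, h4⟩ := hbb _ (hprod x hx y hy)
  refine ⟨_, hpart x y h1, ?_⟩
  have hy' : y ∈ ball (0 : E) a := by simpa using h3
  have e1 : HasFDerivAt (fun z => m (m (x, y), z)) (F (m (x, y))) 0 := hpart _ 0 (hball _ h2).1
  have e2 : HasFDerivAt (fun z => m (y, z)) (F y) 0 := hpart _ 0 (hball _ hy').1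
  have e3 : HasFDerivAt (fun z => m (x, z))
      ((fderiv ℝ m (x, y)).comp (ContinuousLinearMap.inr ℝ E E)) (m (y, 0)) := by
    rw [(hball _ hy').2.2.2]; exact hpart x y h1
  have e4 := e3.comp (0 : E) e2
  exact e4.unique (e1.congr_of_eventuallyEq (h4.mono fun z hz => hz.symm))

end LocalGroupLaw

/-! ### Integral curves of left invariant fields and the local exponential map -/

namespace LocalFrame

variable {E : Type*} [NormedAddCommGroup E] [NormedSpace ℝ E] {m : E × E → E}
  (φ : LocalFrame m)

theorem lipschitzOnWith_apply (u : E) :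
    LipschitzOnWith (φ.K * ‖u‖₊) (fun x => φ.F x u) (ball 0 φ.a) := by
  refine LipschitzOnWith.of_dist_le_mul fun x hx y hy => ?_
  rw [dist_eq_norm, ← sub_apply]
  refine (ContinuousLinearMap.le_opNorm _ _).trans ?_
  have h := φ.lipschitz.dist_le_mul x hx y hy
  rw [dist_eq_norm] at h
  calc _ ≤ (φ.K * dist x y) * ‖u‖ := by gcongr
    _ = _ := by push_cast; ring

theorem eqOn_of_hasDerivAt {u : E} {f g : ℝ → E} {c d t₀ : ℝ} (ht : t₀ ∈ Ioo c d)
    (hf : ∀ t ∈ Ioo c d, HasDerivAt f (φ.F (f t) u) t ∧ f t ∈ ball 0 φ.a)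
    (hg : ∀ t ∈ Ioo c d, HasDerivAt g (φ.F (g t) u) t ∧ g t ∈ ball 0 φ.a)
    (h : f t₀ = g t₀) : EqOn f g (Ioo c d) :=
  ODE_solution_unique_of_mem_Ioo (v := fun _ x => φ.F x u) (s := fun _ => ball 0 φ.a)
    (fun _ _ => φ.lipschitzOnWith_apply u) ht hf hg h

theorem closedBall_subset : closedBall (0 : E) (φ.b / 2) ⊆ ball 0 φ.b :=
  closedBall_subset_ball (by linarith [φ.b_pos])

theorem ball_b_subset : ball (0 : E) φ.b ⊆ ball 0 φ.a := ball_subset_ball φ.b_le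

/-- The exponential map of a local group law. -/
structure IsLocalExp (m : E × E → E) (e : E → E) (ρ : ℝ) : Prop where
  pos : 0 < ρ
  map_zero : e 0 = 0
  hasStrictFDerivAt : HasStrictFDerivAt e (ContinuousLinearMap.id ℝ E) 0
  map_add_smul : ∀ u ∈ ball (0 : E) ρ, ∀ s t : ℝ, |s| ≤ 1 → |t| ≤ 1 → |s + t| ≤ 1 →
    e ((s + t) • u) = m (e (s • u), e (t • u))
  contDiffAt : ∀ u ∈ ball (0 : E) ρ, ContDiffAt ℝ ∞ (fun t : ℝ => e (t • u)) 0
  eventually_eq : ∀ (v : E) (y : ℝ → E), y 0 = 0 → HasDerivAt y v 0 →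
    (∀ᶠ t in 𝓝 0, ∀ᶠ s in 𝓝 0, y (t + s) = m (y t, y s)) → ∀ᶠ t in 𝓝 (0 : ℝ), y t = e (t • v)

/-- `x` is the integral curve through `0` of the left invariant field with value `v` at `0`, on the
time interval `[-2, 2]`. -/
structure IsCurve (v : E) (x : ℝ → E) : Prop where
  zero : x 0 = 0
  deriv : ∀ t ∈ Icc (-2 : ℝ) 2, HasDerivWithinAt x (φ.F (x t) v) (Icc (-2 : ℝ) 2) t
  mem : ∀ t ∈ Icc (-2 : ℝ) 2, x t ∈ ball (0 : E) φ.b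

variable {φ}

theorem IsCurve.hasDerivAt {v : E} {x : ℝ → E} (h : φ.IsCurve v x) {t : ℝ}
    (ht : t ∈ Ioo (-2 : ℝ) 2) : HasDerivAt x (φ.F (x t) v) t :=
  (h.deriv t (Ioo_subset_Icc_self ht)).hasDerivAt (Icc_mem_nhds ht.1 ht.2)

theorem IsCurve.mem_a {v : E} {x : ℝ → E} (h : φ.IsCurve v x) {t : ℝ}
    (ht : t ∈ Icc (-2 : ℝ) 2) : x t ∈ ball 0 φ.a := φ.ball_b_subset (h.mem t ht)

theorem IsCurve.norm_le {v : E} {x : ℝ → E} (h : φ.IsCurve v x) {t : ℝ}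
    (ht : t ∈ Icc (0 : ℝ) 1) : ‖x t‖ ≤ 2 * ‖v‖ := by
  have hsub : Icc (0 : ℝ) 1 ⊆ Icc (-2) 2 := Icc_subset_Icc (by norm_num) (by norm_num)
  have := (convex_Icc (0 : ℝ) 1).norm_image_sub_le_of_norm_hasDerivWithin_le
    (f := x) (f' := fun t => φ.F (x t) v) (C := 2 * ‖v‖)
    (fun s hs => (h.deriv s (hsub hs)).mono hsub)
    (fun s hs => (ContinuousLinearMap.le_opNorm _ _).trans
      (by gcongr; exact φ.norm_le _ (h.mem_a (hsub hs))))
    (left_mem_Icc.mpr zero_le_one) ht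
  rw [h.zero, sub_zero, sub_zero, Real.norm_of_nonneg ht.1] at this
  refine this.trans (mul_le_of_le_one_right (by positivity) ht.2)

theorem IsCurve.comp_mul {v : E} {x : ℝ → E} (h : φ.IsCurve v x) {c : ℝ} (hc : |c| ≤ 1) :
    φ.IsCurve (c • v) (fun t => x (c * t)) where
  zero := by simp [h.zero]
  deriv t ht := by
    have hm : MapsTo (fun t : ℝ => c * t) (Icc (-2) 2) (Icc (-2) 2) := fun s hs => by
      have hs' := abs_le.mpr hs
      refine abs_le.mp (?_ : |c * s| ≤ 2)
      rw [abs_mul]; nlinarith [abs_nonneg c, abs_nonneg s]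
    have h1 := (h.deriv (c * t) (hm ht)).scomp (h := fun t => c * t) t
      ((hasDerivWithinAt_id t (Icc (-2 : ℝ) 2)).const_mul c) hm
    simpa [Function.comp_def] using h1
  mem t ht := by
    have ht' := abs_le.mpr ht
    refine h.mem _ (abs_le.mp (?_ : |c * t| ≤ 2))
    rw [abs_mul]; nlinarith [abs_nonneg c, abs_nonneg t]

theorem IsCurve.eq {v : E} {x y : ℝ → E} (hx : φ.IsCurve v x) (hy : φ.IsCurve v y) {t : ℝ}
    (ht : t ∈ Ioo (-2 : ℝ) 2) : x t = y t :=
  φ.eqOn_of_hasDerivAt (u := v) (t₀ := 0) (by norm_num)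
    (fun _ hs => ⟨hx.hasDerivAt hs, hx.mem_a (Ioo_subset_Icc_self hs)⟩)
    (fun _ hs => ⟨hy.hasDerivAt hs, hy.mem_a (Ioo_subset_Icc_self hs)⟩)
    (hx.zero.trans hy.zero.symm) ht

/-- By left invariance of the frame, t ↦ m(x s, x t) solves the same equation as t ↦ x (s + t), with
the same value at 0. The time interval [-2, 2] leaves room to have all three of s, t, s + t in its
interior. -/
theorem IsCurve.add {v : E} {x : ℝ → E} (h : φ.IsCurve v x) {s t : ℝ} (hs : |s| ≤ 1)
    (ht : |t| ≤ 1) (hst : |s + t| ≤ 1) : x (s + t) = m (x s, x t) := by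
  rw [abs_le] at hs ht hst
  have hxs : x s ∈ ball 0 φ.b := h.mem s ⟨by linarith, by linarith⟩
  refine φ.eqOn_of_hasDerivAt (u := v) (t₀ := 0) (c := max (-2) (-2 - s)) (d := min 2 (2 - s))
    (f := fun t => x (s + t)) (g := fun t => m (x s, x t)) ?_ (fun r hr => ?_) (fun r hr => ?_) ?_ ?_
  · simp only [mem_Ioo, max_lt_iff, lt_min_iff]; refine ⟨⟨?_, ?_⟩, ?_, ?_⟩ <;> linarith
  · simp only [mem_Ioo, max_lt_iff, lt_min_iff] at hr
    have hr' : s + r ∈ Ioo (-2 : ℝ) 2 := ⟨by linarith, by linarith⟩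
    exact ⟨(h.hasDerivAt hr').comp_const_add s r, h.mem_a (Ioo_subset_Icc_self hr')⟩
  · simp only [mem_Ioo, max_lt_iff, lt_min_iff] at hr
    have hr' : r ∈ Ioo (-2 : ℝ) 2 := ⟨hr.1.1, hr.2.1⟩
    have hxr := h.mem r (Ioo_subset_Icc_self hr')
    obtain ⟨D, hD, hDF⟩ := φ.exists_hasFDerivAt _ hxs _ hxr
    refine ⟨?_, φ.mem_ball _ hxs _ hxr⟩
    rw [← hDF]
    exact hD.comp_hasDerivAt r (h.hasDerivAt hr')
  · simp only [add_zero, h.zero]; exact (φ.right_zero _ (φ.ball_b_subset hxs)).symm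
  · simp only [mem_Ioo, max_lt_iff, lt_min_iff]; refine ⟨⟨?_, ?_⟩, ?_, ?_⟩ <;> linarith

theorem IsCurve.contDiffAt [CompleteSpace E] {v : E} {x : ℝ → E} (h : φ.IsCurve v x) :
    ContDiffAt ℝ ∞ x 0 := by
  have hF : ContDiffOn ℝ ((⊤ : ℕ∞) : ℕ∞ω) (Function.uncurry fun (_ : ℝ) y => φ.F y v)
      (Icc (-2 : ℝ) 2 ×ˢ ball (0 : E) φ.a) := by
    have h1 : ContDiffOn ℝ ∞ (fun p : ℝ × E => φ.F p.2) (Icc (-2 : ℝ) 2 ×ˢ ball (0 : E) φ.a) :=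
      φ.contDiffOn.comp contDiff_snd.contDiffOn fun p hp => hp.2
    exact h1.clm_apply contDiffOn_const
  exact (ODE.contDiffOn_enat_Icc_of_hasDerivWithinAt hF h.deriv
    (fun t ht => h.mem_a ht)).contDiffAt (Icc_mem_nhds (by norm_num) (by norm_num))

/-- The factor ‖v‖ + ‖w‖ tends to 0, so this is strict differentiability at 0 of v ↦ x 1, with
derivative the identity. -/
theorem IsCurve.norm_sub_sub_le {v w : E} {x y : ℝ → E} (hx : φ.IsCurve v x)
    (hy : φ.IsCurve w y) (hv : φ.K * ‖v‖ ≤ 1 / 4) (hw : φ.K * ‖w‖ ≤ 1 / 4) :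
    ‖x 1 - y 1 - (v - w)‖ ≤ 2 * φ.K * (‖v‖ + ‖w‖) * ‖v - w‖ := by
  have hsub : Icc (0 : ℝ) 1 ⊆ Icc (-2) 2 := Icc_subset_Icc (by norm_num) (by norm_num)
  have hc : ContinuousOn (fun t => ‖x t - y t‖) (Icc (0 : ℝ) 1) :=
    ((HasDerivWithinAt.continuousOn fun t ht => (hx.deriv t (hsub ht)).mono hsub).sub
      (HasDerivWithinAt.continuousOn fun t ht => (hy.deriv t (hsub ht)).mono hsub)).norm
  obtain ⟨t₁, ht₁, hmax⟩ := isCompact_Icc.exists_isMaxOn (nonempty_Icc.mpr zero_le_one) hc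
  set M := ‖x t₁ - y t₁‖ with hM
  have key : ∀ t ∈ Icc (0 : ℝ) 1, ‖x t - y t - t • (v - w)‖ ≤
      φ.K * M * ‖v‖ + 2 * φ.K * ‖w‖ * ‖v - w‖ := by
    intro t ht
    have := (convex_Icc (0 : ℝ) 1).norm_image_sub_le_of_norm_hasDerivWithin_le
      (f := fun t => x t - y t - t • (v - w))
      (f' := fun t => φ.F (x t) v - φ.F (y t) w - (v - w))
      (C := φ.K * M * ‖v‖ + 2 * φ.K * ‖w‖ * ‖v - w‖)
      (fun s hs => by
        have h1 := ((hx.deriv s (hsub hs)).sub (hy.deriv s (hsub hs))).mono hsub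
        have h2 := (hasDerivWithinAt_id s (Icc (0 : ℝ) 1)).smul_const (v - w)
        rw [one_smul] at h2
        exact h1.sub h2)
      (fun s hs => by
        have e : φ.F (x s) v - φ.F (y s) w - (v - w) =
            (φ.F (x s) - φ.F (y s)) v + (φ.F (y s) - φ.F 0) (v - w) := by
          rw [φ.map_zero]; simp; abel
        rw [e]
        have ha0 : (0 : E) ∈ ball (0 : E) φ.a := mem_ball_self (φ.b_pos.trans_le φ.b_le)
        have h1 : ‖φ.F (x s) - φ.F (y s)‖ ≤ φ.K * M := by
          have := φ.lipschitz.dist_le_mul _ (hx.mem_a (hsub hs)) _ (hy.mem_a (hsub hs))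
          rw [dist_eq_norm, dist_eq_norm] at this
          exact this.trans (by gcongr; exact hmax hs)
        have h2 : ‖φ.F (y s) - φ.F 0‖ ≤ φ.K * (2 * ‖w‖) := by
          have := φ.lipschitz.dist_le_mul _ (hy.mem_a (hsub hs)) _ ha0
          rw [dist_eq_norm, dist_zero_right] at this
          exact this.trans (by gcongr; exact hy.norm_le hs)
        refine (norm_add_le _ _).trans (add_le_add ?_ ?_)
        · exact (ContinuousLinearMap.le_opNorm _ _).trans (by gcongr)
        · refine (ContinuousLinearMap.le_opNorm _ _).trans ?_
          calc _ ≤ φ.K * (2 * ‖w‖) * ‖v - w‖ := by gcongr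
            _ = _ := by ring)
      (left_mem_Icc.mpr zero_le_one) ht
    simp only [hx.zero, hy.zero, zero_smul, sub_zero, Real.norm_of_nonneg ht.1] at this
    refine this.trans (mul_le_of_le_one_right (by positivity) ht.2)
  -- `key` at the maximiser t₁ bounds M in terms of itself: M ≤ M/4 + ‖v - w‖/2 + ‖v - w‖.
  have hM2 : M ≤ 2 * ‖v - w‖ := by
    have h1 := key t₁ ht₁
    have h2 : M ≤ ‖x t₁ - y t₁ - t₁ • (v - w)‖ + ‖t₁ • (v - w)‖ := by
      simpa [hM] using norm_add_le (x t₁ - y t₁ - t₁ • (v - w)) (t₁ • (v - w))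
    have h3 : ‖t₁ • (v - w)‖ ≤ ‖v - w‖ := by
      rw [norm_smul, Real.norm_of_nonneg ht₁.1]
      exact mul_le_of_le_one_left (norm_nonneg _) ht₁.2
    have h4 : φ.K * M * ‖v‖ ≤ M * (1 / 4) := by
      calc _ = M * (φ.K * ‖v‖) := by ring
        _ ≤ _ := by gcongr
    have h5 : 2 * φ.K * ‖w‖ * ‖v - w‖ ≤ 1 / 2 * ‖v - w‖ := by
      calc _ = 2 * (φ.K * ‖w‖) * ‖v - w‖ := by ring
        _ ≤ 2 * (1 / 4) * ‖v - w‖ := by gcongr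
        _ = _ := by ring
    linarith
  have := key 1 (right_mem_Icc.mpr zero_le_one)
  rw [one_smul] at this
  refine this.trans ?_
  calc φ.K * M * ‖v‖ + 2 * φ.K * ‖w‖ * ‖v - w‖
      ≤ φ.K * (2 * ‖v - w‖) * ‖v‖ + 2 * φ.K * ‖w‖ * ‖v - w‖ := by gcongr
    _ = _ := by ring

variable (φ)

/-- The field has norm at most 2‖v‖ ≤ b/4, so within time 2 a curve moves at most b/2 and stays in
the ball of radius b. -/
theorem exists_isCurve [CompleteSpace E] {v : E} (hv : ‖v‖ ≤ φ.b / 8) :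
    ∃ x : ℝ → E, φ.IsCurve v x := by
  have hb := φ.b_pos
  have hsub := φ.closedBall_subset.trans φ.ball_b_subset
  obtain ⟨r, hr⟩ : ∃ r : ℝ≥0, (r : ℝ) = φ.b / 2 := ⟨⟨φ.b / 2, by positivity⟩, rfl⟩
  rw [← hr] at hsub
  have hPL : IsPicardLindelof (fun _ x => φ.F x v) (tmin := -2) (tmax := 2)
      (⟨0, by norm_num⟩ : Icc (-2 : ℝ) 2) (0 : E) r 0
      (2 * ‖v‖₊) (φ.K * ‖v‖₊) := by
    refine IsPicardLindelof.of_time_independent (fun x hx => ?_)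
      ((φ.lipschitzOnWith_apply v).mono hsub) ?_
    · exact (ContinuousLinearMap.le_opNorm _ _).trans
        (by push_cast; gcongr; exact φ.norm_le _ (hsub hx))
    · simp [hr]; linarith
  obtain ⟨α, hα⟩ := ODE.FunSpace.exists_isFixedPt_next hPL (x := (0 : E)) (by simp)
  have hmem : ∀ t, α.compProj t ∈ closedBall (0 : E) (φ.b / 2) := fun t => hr ▸
    α.compProj_mem_closedBall hPL.mul_max_le
  have h0 : (0 : ℝ) ∈ Icc (-2 : ℝ) 2 := by norm_num
  refine ⟨α.compProj, ⟨?_, fun t ht => ?_, fun t ht => φ.closedBall_subset (hmem t)⟩⟩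
  · have : α.compProj ((⟨0, h0⟩ : Icc (-2 : ℝ) 2) : ℝ) = 0 := by
      rw [ODE.FunSpace.compProj_val, ← hα, ODE.FunSpace.next_apply₀]
    exact this
  · refine (ODE.hasDerivWithinAt_picard_Icc (t₀ := 0) h0 hPL.continuousOn_uncurry
      α.continuous_compProj.continuousOn (fun _ _ => hr.symm ▸ hmem _) (0 : E) ht).congr_of_mem (fun s hs => ?_) ht
    nth_rw 1 [← hα]
    rw [ODE.FunSpace.compProj_of_mem hs, ODE.FunSpace.next_apply]

theorem exists_isLocalExp [CompleteSpace E] (φ : LocalFrame m) : ∃ e ρ, IsLocalExp m e ρ := by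
  have hb := φ.b_pos
  choose! x hx using fun (v : E) (hv : ‖v‖ ≤ φ.b / 8) => φ.exists_isCurve hv
  have hxs : ∀ v : E, ‖v‖ ≤ φ.b / 8 → ∀ c : ℝ, |c| ≤ 1 → x (c • v) 1 = x v c := by
    intro v hv c hc
    have h1 : ‖c • v‖ ≤ φ.b / 8 := by
      rw [norm_smul]
      exact (mul_le_of_le_one_left (norm_nonneg _) hc).trans hv
    have := (hx _ h1).eq ((hx _ hv).comp_mul hc) (t := 1) (by norm_num)
    simpa using this
  have h0 : ‖(0 : E)‖ ≤ φ.b / 8 := by rw [norm_zero]; positivity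
  refine ⟨fun v => x v 1, φ.b / 8, by positivity, ?_, ?_, ?_, ?_, ?_⟩
  · have := hxs 0 h0 0 (by simp)
    rw [smul_zero, (hx 0 h0).zero] at this
    exact this
  · rw [hasStrictFDerivAt_iff_isLittleO, Asymptotics.isLittleO_iff]
    intro c hc
    have h1 : ∀ᶠ v : E in 𝓝 0, ‖v‖ ≤ φ.b / 8 ∧ φ.K * ‖v‖ ≤ 1 / 4 ∧ 4 * φ.K * ‖v‖ ≤ c := by
      have a1 : Tendsto (fun v : E => ‖v‖) (𝓝 0) (𝓝 0) := tendsto_norm_zero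
      have a2 : Tendsto (fun v : E => φ.K * ‖v‖) (𝓝 0) (𝓝 0) := by simpa using a1.const_mul (φ.K : ℝ)
      have a3 : Tendsto (fun v : E => 4 * φ.K * ‖v‖) (𝓝 0) (𝓝 0) := by
        simpa using a1.const_mul (4 * φ.K : ℝ)
      filter_upwards [a1.eventually (Iic_mem_nhds (by positivity : 0 < φ.b / 8)),
        a2.eventually (Iic_mem_nhds (by norm_num : (0 : ℝ) < 1 / 4)),
        a3.eventually (Iic_mem_nhds hc)] with v h1 h2 h3 using ⟨h1, h2, h3⟩
    rw [nhds_prod_eq]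
    filter_upwards [h1.prod_mk h1] with p ⟨hp, hq⟩
    simp only [ContinuousLinearMap.coe_id', id_eq]
    refine ((hx _ hp.1).norm_sub_sub_le (hx _ hq.1) hp.2.1 hq.2.1).trans ?_
    gcongr
    nlinarith [hp.2.2, hq.2.2]
  · intro u hu s t hs ht hst
    have hu' : ‖u‖ ≤ φ.b / 8 := (mem_ball_zero_iff.mp hu).le
    simp only [hxs u hu' _ hs, hxs u hu' _ ht, hxs u hu' _ hst]
    exact (hx u hu').add hs ht hst
  · intro u hu
    have hu' : ‖u‖ ≤ φ.b / 8 := (mem_ball_zero_iff.mp hu).le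
    refine (hx u hu').contDiffAt.congr_of_eventuallyEq ?_
    filter_upwards [Icc_mem_nhds (by norm_num : (-1 : ℝ) < 0) (by norm_num : (0 : ℝ) < 1)] with t ht
    exact hxs u hu' t (abs_le.mpr ht)
  · intro v y hy0 hyd hy
    -- The vector v may be large, so the integral curve of c • v is used, run at speed c⁻¹.
    obtain ⟨c, hc, hcv⟩ : ∃ c : ℝ, 0 < c ∧ ‖c • v‖ ≤ φ.b / 8 := by
      refine ⟨φ.b / 8 / (‖v‖ + 1), by positivity, ?_⟩
      rw [norm_smul, Real.norm_of_nonneg (by positivity), div_mul_eq_mul_div]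
      exact div_le_of_le_mul₀ (by positivity) (by positivity) (by nlinarith [norm_nonneg v])
    have hz := hx _ hcv
    have hlim : Tendsto (fun t : ℝ => c⁻¹ * t) (𝓝 0) (𝓝 0) := by
      simpa using (continuous_const_mul c⁻¹).tendsto (0 : ℝ)
    have hball : ball (0 : E) φ.a ∈ 𝓝 (0 : E) := ball_mem_nhds _ (hb.trans_le φ.b_le)
    -- Differentiating y (t + s) = m (y t, y s) in s at 0 shows that a local homomorphism is an
    -- integral curve.
    have e1 : ∀ᶠ t in 𝓝 (0 : ℝ), HasDerivAt y (φ.F (y t) v) t ∧ y t ∈ ball 0 φ.a := by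
      have hyc : Tendsto y (𝓝 0) (𝓝 0) := by simpa [hy0] using hyd.continuousAt.tendsto
      filter_upwards [hy, hyc hball] with t ht hta
      refine ⟨?_, hta⟩
      have h1 : HasDerivAt (fun s => m (y t, y s)) (φ.F (y t) v) 0 := by
        have := φ.hasFDerivAt _ hta
        rw [← hy0] at this
        exact this.comp_hasDerivAt (0 : ℝ) hyd
      have h2 := h1.congr_of_eventuallyEq ht
      have h3 : HasDerivAt (fun s => y (t + (s - t))) (φ.F (y t) v) t :=
        HasDerivAt.comp_sub_const (f := fun s => y (t + s)) t t (by simpa using h2)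
      simpa using h3
    have e2 : ∀ᶠ t in 𝓝 (0 : ℝ), HasDerivAt (fun t => x (c • v) (c⁻¹ * t))
        (φ.F (x (c • v) (c⁻¹ * t)) v) t ∧ x (c • v) (c⁻¹ * t) ∈ ball 0 φ.a := by
      filter_upwards [hlim (Ioo_mem_nhds (by norm_num : (-2 : ℝ) < 0) (by norm_num : (0 : ℝ) < 2))]
        with t ht
      refine ⟨?_, hz.mem_a (Ioo_subset_Icc_self ht)⟩
      have h1 := (hz.hasDerivAt ht).scomp t ((hasDerivAt_id t).const_mul c⁻¹)
      simpa [smul_smul, hc.ne', Function.comp_def] using h1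
    have e3 := ODE_solution_unique_of_eventually (v := fun _ x => φ.F x v)
      (s := fun _ => ball 0 φ.a) (t₀ := 0)
      (Eventually.of_forall fun _ => φ.lipschitzOnWith_apply v) e1 e2
      (by simp [hy0, hz.zero])
    filter_upwards [e3, hlim (Icc_mem_nhds (by norm_num : (-1 : ℝ) < 0)
      (by norm_num : (0 : ℝ) < 1))] with t ht ht'
    rw [ht, ← hxs _ hcv _ (abs_le.mpr ht'), smul_smul]
    congr 2
    field_simp

end LocalFrame

/-! ### Extending a local exponential map to the whole Lie algebra -/

/-- An exponential map of a topological group `G` with Lie algebra `E`: it is continuous, additive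
on lines, a homeomorphism near `0`, and multiplication in logarithmic coordinates is strictly
differentiable at `0`. -/
structure ExpMap (E : Type*) [NormedAddCommGroup E] [NormedSpace ℝ E]
    (G : Type*) [TopologicalSpace G] [Group G] where
  exp : E → G
  continuous_exp : Continuous exp
  map_add_smul : ∀ (s t : ℝ) (v : E), exp ((s + t) • v) = exp (s • v) * exp (t • v)
  chart : OpenPartialHomeomorph E G
  zero_mem : (0 : E) ∈ chart.source
  chart_apply : ∀ v ∈ chart.source, chart v = exp v
  hasStrictFDerivAt_mul :
    HasStrictFDerivAt (fun p : E × E => chart.symm (exp p.1 * exp p.2))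
      (ContinuousLinearMap.fst ℝ E E + ContinuousLinearMap.snd ℝ E E) (0, 0)

section Extension

variable {E : Type*} [NormedAddCommGroup E] [NormedSpace ℝ E]
  {G : Type*}

theorem map_nsmul_of_local [Group G] {e : E → G} {ρ : ℝ}
    (he : ∀ u ∈ ball (0 : E) ρ, ∀ s t : ℝ, |s| ≤ 1 → |t| ≤ 1 → |s + t| ≤ 1 →
      e ((s + t) • u) = e (s • u) * e (t • u))
    {u : E} (hu : u ∈ ball (0 : E) ρ) {k : ℕ} (hk : 0 < k) :
    e u = e ((k : ℝ)⁻¹ • u) ^ k := by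
  have hk' : (0 : ℝ) < k := by exact_mod_cast hk
  have he0 : e 0 = 1 := by
    have := he u hu 0 0 (by simp) (by simp) (by simp)
    simpa using this
  have key : ∀ j : ℕ, j ≤ k → e (((j : ℝ) * (k : ℝ)⁻¹) • u) = e ((k : ℝ)⁻¹ • u) ^ j := by
    intro j
    induction j with
    | zero => intro _; simp [he0]
    | succ j ih =>
      intro hj
      have hj' : (j : ℝ) + 1 ≤ k := by exact_mod_cast hj
      have h1 : |(j : ℝ) * (k : ℝ)⁻¹| ≤ 1 := by
        rw [abs_of_nonneg (by positivity), ← div_eq_mul_inv, div_le_one hk']; linarith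
      have h2 : |(k : ℝ)⁻¹| ≤ 1 := by
        rw [abs_of_nonneg (by positivity)]; exact inv_le_one_of_one_le₀ (by exact_mod_cast hk)
      have h3 : |(j : ℝ) * (k : ℝ)⁻¹ + (k : ℝ)⁻¹| ≤ 1 := by
        rw [abs_of_nonneg (by positivity)]
        calc _ = ((j : ℝ) + 1) / k := by ring
          _ ≤ 1 := by rw [div_le_one hk']; exact hj'
      rw [pow_succ, ← ih (by omega), ← he u hu _ _ h1 h2 h3]
      congr 2; push_cast; ring
  have := key k le_rfl
  rwa [mul_inv_cancel₀ hk'.ne', one_smul] at this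

/-- A local exponential map extends to a global one. -/
theorem exists_extension_of_local [TopologicalSpace G] [Group G] [IsTopologicalGroup G] {e : E → G} {ρ : ℝ} (hρ : 0 < ρ)
    (he : ∀ u ∈ ball (0 : E) ρ, ∀ s t : ℝ, |s| ≤ 1 → |t| ≤ 1 → |s + t| ≤ 1 →
      e ((s + t) • u) = e (s • u) * e (t • u)) (hc : ContinuousOn e (ball 0 ρ)) :
    ∃ E' : E → G, Continuous E' ∧ (∀ v ∈ ball (0 : E) ρ, E' v = e v) ∧
      ∀ (s t : ℝ) (v : E), E' ((s + t) • v) = E' (s • v) * E' (t • v) := by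
  have hex : ∀ v : E, ∃ n : ℕ, 0 < n ∧ (n : ℝ)⁻¹ • v ∈ ball (0 : E) ρ := by
    intro v
    obtain ⟨n, hn⟩ := exists_nat_gt (‖v‖ / ρ)
    refine ⟨n + 1, by omega, ?_⟩
    rw [mem_ball_zero_iff, norm_smul, norm_inv, Real.norm_natCast, inv_mul_lt_iff₀ (by positivity)]
    rw [div_lt_iff₀ hρ] at hn
    push_cast; nlinarith
  choose N hN hNb using hex
  let E' : E → G := fun v => e ((N v : ℝ)⁻¹ • v) ^ N v
  -- The value e(v/n)ⁿ does not depend on n: two choices n and N are compared through v/(nN). In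
  -- particular one n serves a whole neighbourhood of v, which gives continuity.
  have hE' : ∀ (v : E) (n : ℕ), 0 < n → (n : ℝ)⁻¹ • v ∈ ball (0 : E) ρ →
      E' v = e ((n : ℝ)⁻¹ • v) ^ n := by
    intro v n hn hv
    simp only [E']
    rw [map_nsmul_of_local he (hNb v) hn, map_nsmul_of_local he hv (hN v), ← pow_mul, ← pow_mul,
      mul_comm n, smul_smul, smul_smul, mul_comm (n : ℝ)⁻¹]
  refine ⟨E', ?_, fun v hv => ?_, fun s t v => ?_⟩
  · rw [continuous_iff_continuousAt]
    intro v
    have h1 : ContinuousAt (fun w => e ((N v : ℝ)⁻¹ • w) ^ N v) v := by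
      refine ContinuousAt.pow ?_ _
      exact ContinuousAt.comp (g := e) (hc.continuousAt (isOpen_ball.mem_nhds (hNb v)))
        (by fun_prop)
    refine h1.congr ?_
    have h2 : ∀ᶠ w in 𝓝 v, (N v : ℝ)⁻¹ • w ∈ ball (0 : E) ρ :=
      ((by fun_prop : Continuous fun w : E => (N v : ℝ)⁻¹ • w).continuousAt).eventually_mem
        (isOpen_ball.mem_nhds (hNb v))
    filter_upwards [h2] with w hw
    exact (hE' w _ (hN v) hw).symm
  · rw [hE' v 1 one_pos (by simpa using hv)]; simp
  -- Measuring along M • v puts s, t and s + t into [-M, M], so a single root n handles all three.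
  · set M : ℝ := |s| + |t| + 1 with hM
    have hM0 : 0 < M := by positivity
    set n := N (M • v)
    have hn : 0 < n := hN _
    set u := (n : ℝ)⁻¹ • M • v with hu
    have hub : u ∈ ball (0 : E) ρ := hNb _
    have hr : ∀ r : ℝ, |r| ≤ M → E' (r • v) = e ((r / M) • u) ^ n := by
      intro r hr
      have e1 : (r / M) • u = (n : ℝ)⁻¹ • r • v := by
        rw [hu, smul_smul, smul_smul, smul_smul]; congr 1; field_simp
      rw [e1]
      refine hE' _ n hn ?_
      rw [← e1, mem_ball_zero_iff, norm_smul, Real.norm_eq_abs, abs_div, abs_of_pos hM0]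
      exact (mul_le_of_le_one_left (norm_nonneg _) ((div_le_one hM0).mpr hr)).trans_lt
        (mem_ball_zero_iff.mp hub)
    have hs : |s| ≤ M := by rw [hM]; linarith [abs_nonneg t]
    have ht : |t| ≤ M := by rw [hM]; linarith [abs_nonneg s]
    have hst : |s + t| ≤ M := by rw [hM]; linarith [abs_add_le s t]
    have hle : ∀ r : ℝ, |r| ≤ M → |r / M| ≤ 1 := fun r hr => by
      rw [abs_div, abs_of_pos hM0]; exact (div_le_one hM0).mpr hr
    have hst' : |s / M + t / M| ≤ 1 := by rw [← add_div]; exact hle _ hst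
    rw [hr _ hs, hr _ ht, hr _ hst, add_div, he u hub _ _ (hle _ hs) (hle _ ht) hst']
    have hcomm : Commute (e ((s / M) • u)) (e ((t / M) • u)) := by
      rw [commute_iff_eq, ← he u hub _ _ (hle _ hs) (hle _ ht) hst',
        ← he u hub _ _ (hle _ ht) (hle _ hs) (by rwa [add_comm]), add_comm]
    exact hcomm.mul_pow n

end Extension

/-! ### The exponential map of a Lie group -/

section LieGroup

variable {E : Type*} [NormedAddCommGroup E]
  (G : Type*) [TopologicalSpace G] [ChartedSpace E G] [Group G]

/-- The preferred chart at `1`, translated such that `1` is mapped to `0`. -/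
noncomputable def oneChart : OpenPartialHomeomorph G E :=
  (chartAt E (1 : G)).transHomeomorph (Homeomorph.subRight (chartAt E (1 : G) 1))

theorem oneChart_one : oneChart (E := E) G 1 = 0 := sub_self _

theorem one_mem_source_oneChart : (1 : G) ∈ (oneChart (E := E) G).source :=
  mem_chart_source E (1 : G)

theorem zero_mem_target_oneChart : (0 : E) ∈ (oneChart (E := E) G).target := by
  rw [← oneChart_one (E := E) G]
  exact (oneChart G).map_source (one_mem_source_oneChart G)

theorem oneChart_symm_zero : (oneChart (E := E) G).symm 0 = 1 := by
  rw [← oneChart_one (E := E) G]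
  exact (oneChart G).left_inv (one_mem_source_oneChart G)

variable [NormedSpace ℝ E] [LieGroup 𝓘(ℝ, E) ∞ G]

theorem contMDiffOn_oneChart :
    ContMDiffOn 𝓘(ℝ, E) 𝓘(ℝ, E) ∞ (oneChart (E := E) G) (oneChart (E := E) G).source := by
  have h1 : ContMDiffOn 𝓘(ℝ, E) 𝓘(ℝ, E) ∞ (chartAt E (1 : G)) (chartAt E (1 : G)).source :=
    contMDiffOn_chart
  have h2 : ContMDiff 𝓘(ℝ, E) 𝓘(ℝ, E) ∞ (fun x : E => x - chartAt E (1 : G) 1) :=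
    (contDiff_id.sub contDiff_const).contMDiff
  exact h2.comp_contMDiffOn h1

theorem contMDiffOn_oneChart_symm :
    ContMDiffOn 𝓘(ℝ, E) 𝓘(ℝ, E) ∞ (oneChart (E := E) G).symm (oneChart (E := E) G).target := by
  have h1 : ContMDiffOn 𝓘(ℝ, E) 𝓘(ℝ, E) ∞ (chartAt E (1 : G)).symm (chartAt E (1 : G)).target :=
    contMDiffOn_chart_symm
  have h2 : ContMDiff 𝓘(ℝ, E) 𝓘(ℝ, E) ∞ (fun x : E => x + chartAt E (1 : G) 1) :=
    (contDiff_id.add contDiff_const).contMDiff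
  exact h1.comp h2.contMDiffOn fun x hx => hx

/-- Multiplication of `G` in the chart at `1`. -/
noncomputable def chartMul (p : E × E) : E :=
  oneChart (E := E) G ((oneChart (E := E) G).symm p.1 * (oneChart (E := E) G).symm p.2)

theorem isLocalGroupLaw_chartMul : IsLocalGroupLaw (chartMul (E := E) G) := by
  set ψ := oneChart (E := E) G with hψ
  have hT : ψ.target ∈ 𝓝 (0 : E) := ψ.open_target.mem_nhds (zero_mem_target_oneChart G)
  have hG : IsTopologicalGroup G := topologicalGroup_of_lieGroup 𝓘(ℝ, E) ∞
  have hmulc : ContMDiffOn 𝓘(ℝ, E × E) 𝓘(ℝ, E) ∞ (fun p : E × E => ψ.symm p.1 * ψ.symm p.2)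
      (ψ.target ×ˢ ψ.target) := by
    have h1 : ContMDiffOn 𝓘(ℝ, E × E) 𝓘(ℝ, E) ∞ (fun p : E × E => ψ.symm p.1)
        (ψ.target ×ˢ ψ.target) :=
      (contMDiffOn_oneChart_symm G).comp contDiff_fst.contMDiff.contMDiffOn fun p hp => hp.1
    have h2 : ContMDiffOn 𝓘(ℝ, E × E) 𝓘(ℝ, E) ∞ (fun p : E × E => ψ.symm p.2)
        (ψ.target ×ˢ ψ.target) :=
      (contMDiffOn_oneChart_symm G).comp contDiff_snd.contMDiff.contMDiffOn fun p hp => hp.2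
    exact h1.mul h2
  have hO : IsOpen ((ψ.target ×ˢ ψ.target) ∩
      (fun p : E × E => ψ.symm p.1 * ψ.symm p.2) ⁻¹' ψ.source) :=
    hmulc.continuousOn.isOpen_inter_preimage (ψ.open_target.prod ψ.open_target) ψ.open_source
  have h00 : ((0 : E), (0 : E)) ∈ (ψ.target ×ˢ ψ.target) ∩
      (fun p : E × E => ψ.symm p.1 * ψ.symm p.2) ⁻¹' ψ.source := by
    refine ⟨⟨zero_mem_target_oneChart G, zero_mem_target_oneChart G⟩, ?_⟩
    simp only [mem_preimage, hψ, oneChart_symm_zero, mul_one]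
    exact one_mem_source_oneChart G
  have hsymm : ∀ p ∈ (ψ.target ×ˢ ψ.target) ∩
      (fun p : E × E => ψ.symm p.1 * ψ.symm p.2) ⁻¹' ψ.source,
      ψ.symm (chartMul G p) = ψ.symm p.1 * ψ.symm p.2 := fun p hp => ψ.left_inv hp.2
  have hcd : ContDiffOn ℝ ∞ (chartMul (E := E) G) ((ψ.target ×ˢ ψ.target) ∩
      (fun p : E × E => ψ.symm p.1 * ψ.symm p.2) ⁻¹' ψ.source) := by
    rw [← contMDiffOn_iff_contDiffOn]
    exact (contMDiffOn_oneChart G).comp (hmulc.mono inter_subset_left) fun p hp => hp.2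
  refine ⟨⟨_, hO, h00, hcd⟩, ?_, ?_, ?_⟩
  · filter_upwards [hT] with x hx
    simp only [chartMul, oneChart_symm_zero, mul_one]
    exact ψ.right_inv hx
  · filter_upwards [hT] with x hx
    simp only [chartMul, oneChart_symm_zero, one_mul]
    exact ψ.right_inv hx
  · have hc0 : ContinuousAt (chartMul (E := E) G) (0, 0) :=
      hcd.continuousOn.continuousAt (hO.mem_nhds h00)
    have hm0 : chartMul (E := E) G (0, 0) = 0 := by
      simp [chartMul, oneChart_symm_zero, oneChart_one]
    have t1 : Tendsto (fun p : E × E × E => (p.1, p.2.1)) (𝓝 0) (𝓝 (0, 0)) :=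
      (by fun_prop : Continuous fun p : E × E × E => (p.1, p.2.1)).tendsto' _ _ rfl
    have t2 : Tendsto (fun p : E × E × E => (p.2.1, p.2.2)) (𝓝 0) (𝓝 (0, 0)) :=
      (by fun_prop : Continuous fun p : E × E × E => (p.2.1, p.2.2)).tendsto' _ _ rfl
    have t3 : Tendsto (fun p : E × E × E => (chartMul G (p.1, p.2.1), p.2.2)) (𝓝 0) (𝓝 (0, 0)) := by
      have h := hc0.tendsto
      rw [hm0] at h
      exact (h.comp t1).prodMk_nhds
        ((by fun_prop : Continuous fun p : E × E × E => p.2.2).tendsto' _ _ rfl)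
    have t4 : Tendsto (fun p : E × E × E => (p.1, chartMul G (p.2.1, p.2.2))) (𝓝 0) (𝓝 (0, 0)) := by
      have h := hc0.tendsto
      rw [hm0] at h
      exact ((by fun_prop : Continuous fun p : E × E × E => p.1).tendsto' _ _ rfl).prodMk_nhds
        (h.comp t2)
    filter_upwards [t1 (hO.mem_nhds h00), t2 (hO.mem_nhds h00), t3 (hO.mem_nhds h00),
      t4 (hO.mem_nhds h00)] with p h1 h2 h3 h4
    have a1 := hsymm _ h1
    have a2 := hsymm _ h2
    show ψ (ψ.symm (chartMul G (p.1, p.2.1)) * ψ.symm p.2.2) =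
      ψ (ψ.symm p.1 * ψ.symm (chartMul G (p.2.1, p.2.2)))
    rw [a1, a2, mul_assoc]

end LieGroup

section LieGroup

variable {E : Type*} [NormedAddCommGroup E] [NormedSpace ℝ E]
  {G : Type*} [TopologicalSpace G] [ChartedSpace E G] [Group G] [LieGroup 𝓘(ℝ, E) ∞ G]

theorem hasDerivAt_oneChart_comp {E : Type*} [NormedAddCommGroup E] [NormedSpace ℝ E]
    {G : Type*} [TopologicalSpace G] [ChartedSpace E G] [Group G] {γ : ℝ → G} (hγ : MDifferentiableAt 𝓘(ℝ, ℝ) 𝓘(ℝ, E) γ 0)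
    (h0 : γ 0 = 1) : HasDerivAt (fun t => oneChart (E := E) G (γ t))
      ((mfderiv 𝓘(ℝ, ℝ) 𝓘(ℝ, E) γ 0 : ℝ →L[ℝ] E) 1) 0 := by
  have h := hγ.hasMFDerivAt.2
  simp only [writtenInExtChartAt, mfld_simps] at h
  rw [h0] at h
  let D : ℝ →L[ℝ] E := mfderiv 𝓘(ℝ, ℝ) 𝓘(ℝ, E) γ 0
  have h2 : HasFDerivWithinAt (fun t => chartAt E (1 : G) (γ t)) D univ 0 := h
  exact ((h2.hasFDerivAt univ_mem).hasDerivAt).sub_const _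

/-- Both partial derivatives at the origin are the identity because 0 is a two-sided unit. -/
theorem hasStrictFDerivAt_chartMul :
    HasStrictFDerivAt (chartMul (E := E) G)
      (ContinuousLinearMap.fst ℝ E E + ContinuousLinearMap.snd ℝ E E) (0, 0) := by
  have hm := isLocalGroupLaw_chartMul (E := E) G
  obtain ⟨O, hO, h0, hc⟩ := hm.exists_contDiffOn
  have h1 := ((hc.contDiffAt (hO.mem_nhds h0)).hasStrictFDerivAt (by simp))
  have a1 : HasFDerivAt (fun x : E => chartMul G (x, 0)) _ 0 :=
    HasFDerivAt.comp (f := fun x : E => (x, (0 : E))) (0 : E) h1.hasFDerivAt (hasFDerivAt_prodMk_left (𝕜 := ℝ) (0 : E) (0 : E))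
  have a2 : HasFDerivAt (fun x : E => chartMul G (x, 0)) (ContinuousLinearMap.id ℝ E) 0 :=
    (hasFDerivAt_id (𝕜 := ℝ) (0 : E)).congr_of_eventuallyEq hm.right_zero
  have b1 : HasFDerivAt (fun x : E => chartMul G (0, x)) _ 0 :=
    h1.hasFDerivAt.comp (0 : E) (hasFDerivAt_prodMk_right (𝕜 := ℝ) (0 : E) (0 : E))
  have b2 : HasFDerivAt (fun x : E => chartMul G (0, x)) (ContinuousLinearMap.id ℝ E) 0 :=
    (hasFDerivAt_id (𝕜 := ℝ) (0 : E)).congr_of_eventuallyEq hm.left_zero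
  have heq : fderiv ℝ (chartMul (E := E) G) (0, 0) =
      ContinuousLinearMap.fst ℝ E E + ContinuousLinearMap.snd ℝ E E := by
    ext x
    · simpa using congr($(a1.unique a2) x)
    · simpa using congr($(b1.unique b2) x)
  rwa [heq] at h1

theorem eq_of_eventuallyEq_of_map_add {G : Type*} [Group G] {γ δ : ℝ → G}
    (hγ : ∀ s t, γ (s + t) = γ s * γ t) (hδ : ∀ s t, δ (s + t) = δ s * δ t)
    (h : ∀ᶠ t in 𝓝 (0 : ℝ), γ t = δ t) (t : ℝ) : γ t = δ t := by
  have hpow : ∀ {γ : ℝ → G}, (∀ s t, γ (s + t) = γ s * γ t) → ∀ (n : ℕ) (t : ℝ),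
      γ (n * t) = γ t ^ n := by
    intro γ hγ n t
    have h0 : γ 0 = 1 := by simpa using hγ 0 0
    induction n with
    | zero => simp [h0]
    | succ n ih => rw [pow_succ, ← ih, ← hγ]; congr 1; push_cast; ring
  have hlim : Tendsto (fun n : ℕ => t / (n : ℝ)) atTop (𝓝 0) :=
    tendsto_const_div_atTop_nhds_zero_nat t
  obtain ⟨n, hn, hn0⟩ := ((hlim.eventually h).and (eventually_gt_atTop 0)).exists
  have hn' : (n : ℝ) ≠ 0 := by exact_mod_cast hn0.ne'
  have e : t = n * (t / n) := by field_simp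
  rw [e, hpow hγ, hpow hδ, hn]

theorem IsOneParameterSubgroup.map_zero {E : Type*} [NormedAddCommGroup E] [NormedSpace ℝ E]
    {G : Type*} [TopologicalSpace G] [ChartedSpace E G] [Group G] {γ : ℝ → G} {v : GroupLieAlgebra 𝓘(ℝ, E) G}
    (h : IsOneParameterSubgroup γ v) : γ 0 = 1 := by
  simpa using h.map_add 0 0

/-- The second clause, uniqueness of one-parameter subgroups, makes `exp` commute with automorphisms
and hence yields both `Ad` and the relation between f and f_*. -/
theorem exists_expMap [CompleteSpace E] : ∃ X : ExpMap E G,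
    (∀ v : E, IsOneParameterSubgroup (E := E) (fun t : ℝ => X.exp (t • v)) v) ∧
    ∀ (γ : ℝ → G) (v : E), IsOneParameterSubgroup (E := E) γ v → ∀ t, γ t = X.exp (t • v) := by
  have hG : IsTopologicalGroup G := topologicalGroup_of_lieGroup 𝓘(ℝ, E) ∞
  obtain ⟨φ⟩ := (isLocalGroupLaw_chartMul (E := E) G).nonempty_localFrame
  obtain ⟨e, ρ, he⟩ := φ.exists_isLocalExp
  set ψ := oneChart (E := E) G with hψ
  have hstrict : HasStrictFDerivAt e ((ContinuousLinearEquiv.refl ℝ E : E ≃L[ℝ] E) : E →L[ℝ] E) 0 :=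
    he.hasStrictFDerivAt
  set eh := hstrict.toOpenPartialHomeomorph e with heh
  have hehc : (eh : E → E) = e := hstrict.toOpenPartialHomeomorph_coe
  have heh0 : (0 : E) ∈ eh.source := hstrict.mem_toOpenPartialHomeomorph_source
  have het : Tendsto e (𝓝 0) (𝓝 0) := by
    simpa [he.map_zero] using hstrict.continuousAt.tendsto
  have hψ0 : ψ.target ∈ 𝓝 (0 : E) := ψ.open_target.mem_nhds (zero_mem_target_oneChart G)
  have hsc : ContinuousAt ψ.symm (0 : E) :=
    ψ.continuousAt_symm (zero_mem_target_oneChart G)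
  have hs0 : ψ.symm (0 : E) = 1 := oneChart_symm_zero G
  have hgood : ∀ᶠ p : E × E in 𝓝 0, ψ.symm (e p.1) * ψ.symm (e p.2) ∈ ψ.source := by
    have h1 : Tendsto (fun u => ψ.symm (e u)) (𝓝 0) (𝓝 1) := by
      have := hsc.tendsto.comp het
      rwa [hs0] at this
    have h2 : Tendsto (fun p : E × E => ψ.symm (e p.1) * ψ.symm (e p.2)) (𝓝 0) (𝓝 (1 * 1)) :=
      (h1.comp (continuous_fst.tendsto' (0 : E × E) (0 : E) rfl)).mul
        (h1.comp (continuous_snd.tendsto' (0 : E × E) (0 : E) rfl))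
    rw [mul_one] at h2
    exact h2 (ψ.open_source.mem_nhds (one_mem_source_oneChart G))
  obtain ⟨r₁, hr₁, hb₁⟩ := Metric.eventually_nhds_iff_ball.mp
    ((eh.open_source.mem_nhds heh0 |> fun h => (eventually_mem_set.mpr h)).and (het hψ0))
  obtain ⟨r₂, hr₂, hb₂⟩ := Metric.eventually_nhds_iff_ball.mp hgood
  set r := min ρ (min r₁ r₂) with hr
  have hr0 : 0 < r := lt_min he.pos (lt_min hr₁ hr₂)
  have hballρ : ball (0 : E) r ⊆ ball 0 ρ := ball_subset_ball (min_le_left _ _)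
  have hball₁ : ∀ u ∈ ball (0 : E) r, u ∈ eh.source ∧ e u ∈ ψ.target := fun u hu =>
    hb₁ u (ball_subset_ball ((min_le_right _ _).trans (min_le_left _ _)) hu)
  have hball₂ : ∀ u ∈ ball (0 : E) r, ∀ w ∈ ball (0 : E) r,
      ψ.symm (e u) * ψ.symm (e w) ∈ ψ.source := fun u hu w hw => by
    refine hb₂ (u, w) ?_
    have hle : r ≤ r₂ := (min_le_right _ _).trans (min_le_right _ _)
    simp only [mem_ball_zero_iff, Prod.norm_mk, max_lt_iff] at *
    exact ⟨hu.trans_le hle, hw.trans_le hle⟩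
  have hloc : ∀ u ∈ ball (0 : E) r, ∀ s t : ℝ, |s| ≤ 1 → |t| ≤ 1 → |s + t| ≤ 1 →
      ψ.symm (e ((s + t) • u)) = ψ.symm (e (s • u)) * ψ.symm (e (t • u)) := by
    intro u hu s t hs ht hst
    have hm : ∀ c : ℝ, |c| ≤ 1 → c • u ∈ ball (0 : E) r := fun c hc => by
      rw [mem_ball_zero_iff, norm_smul]
      exact (mul_le_of_le_one_left (norm_nonneg _) hc).trans_lt (mem_ball_zero_iff.mp hu)
    rw [he.map_add_smul u (hballρ hu) s t hs ht hst]
    exact ψ.left_inv (hball₂ _ (hm s hs) _ (hm t ht))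
  have hcont : ContinuousOn (fun u => ψ.symm (e u)) (ball 0 r) := by
    refine ψ.continuousOn_symm.comp ?_ fun u hu => (hball₁ u hu).2
    rw [← hehc]
    exact eh.continuousOn.mono fun u hu => (hball₁ u hu).1
  obtain ⟨X, hXc, hXe, hXadd⟩ := exists_extension_of_local hr0 hloc hcont
  have hX0 : X 0 = 1 := by
    have := hXadd 0 0 0
    simpa using this
  let ch : OpenPartialHomeomorph E G := (eh.trans ψ.symm).restrOpen (ball 0 r) isOpen_ball
  have hch : ∀ u, ch u = ψ.symm (e u) := fun u => by rw [← hehc]; rfl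
  have hsrc : ∀ u, u ∈ ch.source → u ∈ ball (0 : E) r := fun u hu => hu.2
  have h0src : (0 : E) ∈ ch.source := by
    refine ⟨?_, mem_ball_self hr0⟩
    rw [OpenPartialHomeomorph.trans_source]
    refine ⟨heh0, ?_⟩
    rw [mem_preimage, hehc]
    exact (hball₁ 0 (mem_ball_self hr0)).2
  have hmulD : HasStrictFDerivAt (fun p : E × E => ch.symm (X p.1 * X p.2))
      (ContinuousLinearMap.fst ℝ E E + ContinuousLinearMap.snd ℝ E E) (0, 0) := by
    have h1 : HasStrictFDerivAt (fun p : E × E => (e p.1, e p.2))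
        (ContinuousLinearMap.id ℝ (E × E)) (0, 0) := by
      have a1 : HasStrictFDerivAt (fun p : E × E => e p.1)
          ((ContinuousLinearMap.id ℝ E).comp (ContinuousLinearMap.fst ℝ E E)) ((0 : E), (0 : E)) :=
        HasStrictFDerivAt.comp (g := e) (f := Prod.fst) ((0 : E), (0 : E)) he.hasStrictFDerivAt
          hasStrictFDerivAt_fst
      have a2 : HasStrictFDerivAt (fun p : E × E => e p.2)
          ((ContinuousLinearMap.id ℝ E).comp (ContinuousLinearMap.snd ℝ E E)) ((0 : E), (0 : E)) :=
        HasStrictFDerivAt.comp (g := e) (f := Prod.snd) ((0 : E), (0 : E)) he.hasStrictFDerivAt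
          hasStrictFDerivAt_snd
      exact a1.prodMk a2
    have h2 : HasStrictFDerivAt eh.symm (ContinuousLinearMap.id ℝ E) 0 := by
      have := hstrict.to_localInverse
      rw [he.map_zero] at this
      exact this
    have h3 : HasStrictFDerivAt (fun p : E × E => chartMul G (e p.1, e p.2))
        ((ContinuousLinearMap.fst ℝ E E + ContinuousLinearMap.snd ℝ E E).comp
          (ContinuousLinearMap.id ℝ (E × E))) (0, 0) := by
      refine HasStrictFDerivAt.comp (g := chartMul G) ((0 : E), (0 : E)) ?_ h1
      simpa only [he.map_zero] using hasStrictFDerivAt_chartMul (E := E) (G := G)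
    have h4 : HasStrictFDerivAt (fun p : E × E => eh.symm (chartMul G (e p.1, e p.2)))
        ((ContinuousLinearMap.id ℝ E).comp ((ContinuousLinearMap.fst ℝ E E +
          ContinuousLinearMap.snd ℝ E E).comp (ContinuousLinearMap.id ℝ (E × E)))) (0, 0) := by
      refine HasStrictFDerivAt.comp (g := eh.symm) ((0 : E), (0 : E)) ?_ h3
      have : chartMul G (e 0, e 0) = (0 : E) := by
        rw [he.map_zero]; simp [chartMul, oneChart_symm_zero, oneChart_one]
      simpa only [this] using h2
    rw [ContinuousLinearMap.comp_id, ContinuousLinearMap.id_comp] at h4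
    refine h4.congr_of_eventuallyEq ?_
    have hb : ∀ᶠ p : E × E in 𝓝 (0, 0), p ∈ ball (0 : E) r ×ˢ ball (0 : E) r :=
      prod_mem_nhds (ball_mem_nhds _ hr0) (ball_mem_nhds _ hr0)
    filter_upwards [hb] with p hp
    rw [hXe _ hp.1, hXe _ hp.2]
    rfl
  let XX : ExpMap E G :=
    { exp := X
      continuous_exp := hXc
      map_add_smul := hXadd
      chart := ch
      zero_mem := h0src
      chart_apply := fun v hv => by rw [hch, hXe v (hsrc v hv)]
      hasStrictFDerivAt_mul := hmulD }
  have hnear : ∀ v : E, ∀ᶠ t in 𝓝 (0 : ℝ), t • v ∈ ball (0 : E) r := fun v =>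
    ((by fun_prop : Continuous fun t : ℝ => t • v).tendsto' 0 0 (zero_smul _ _))
      (ball_mem_nhds _ hr0)
  refine ⟨XX, fun v => ?_, fun γ v hγ => ?_⟩
  · have hcd : ContDiffAt ℝ ∞ (fun t : ℝ => e (t • v)) 0 := by
      obtain ⟨c, hcb, hc⟩ : ∃ c : ℝ, c • v ∈ ball (0 : E) r ∧ 0 < c :=
        (((hnear v).filter_mono nhdsWithin_le_nhds).and
          (self_mem_nhdsWithin : Ioi (0 : ℝ) ∈ 𝓝[>] 0)).exists
      have h1 := he.contDiffAt _ (hballρ hcb)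
      have h2 : ContDiffAt ℝ ∞ (fun t : ℝ => e ((c⁻¹ * t) • c • v)) 0 := by
        refine ContDiffAt.comp (g := fun t : ℝ => e (t • c • v)) (f := fun t => c⁻¹ * t) 0 ?_
          (contDiff_const.mul contDiff_id).contDiffAt
        rw [mul_zero]; exact h1
      convert h2 using 3 with t
      rw [smul_smul]; congr 1; field_simp
    have hev : ∀ᶠ t in 𝓝 (0 : ℝ), X (t • v) = ψ.symm (e (t • v)) :=
      (hnear v).mono fun t ht => hXe _ ht
    have hsm0 : ContMDiffAt 𝓘(ℝ, ℝ) 𝓘(ℝ, E) ∞ (fun t : ℝ => X (t • v)) 0 := by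
      refine ContMDiffAt.congr_of_eventuallyEq ?_ hev
      refine ContMDiffAt.comp (I' := 𝓘(ℝ, E)) (0 : ℝ) (g := ψ.symm) (f := fun t : ℝ => e (t • v))
        ?_ hcd.contMDiffAt
      simp only [zero_smul, he.map_zero]
      exact (contMDiffOn_oneChart_symm G).contMDiffAt hψ0
    -- Smoothness at 0 is carried to t by left translation by X (t • v).
    have hsm : ContMDiff 𝓘(ℝ, ℝ) 𝓘(ℝ, E) ∞ (fun t : ℝ => X (t • v)) := by
      intro t
      have h1 : ContMDiffAt 𝓘(ℝ, ℝ) 𝓘(ℝ, E) ∞ (fun s : ℝ => X (t • v) * X ((s - t) • v)) t := by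
        refine ContMDiffAt.mul contMDiffAt_const ?_
        refine ContMDiffAt.comp (I' := 𝓘(ℝ, ℝ)) t (g := fun t : ℝ => X (t • v))
          (f := fun s => s - t) ?_ (contDiff_id.sub contDiff_const).contMDiff.contMDiffAt
        rw [sub_self]; exact hsm0
      convert h1 using 1
      funext s
      rw [← hXadd]; congr 2; ring
    refine ⟨hsm, fun s t => hXadd s t v, ?_⟩
    have h1 := hasDerivAt_oneChart_comp (γ := fun t : ℝ => X (t • v))
      (hsm0.mdifferentiableAt (by simp)) (by simpa using hX0)
    have h2 : HasDerivAt (fun t : ℝ => e (t • v)) v 0 := by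
      have a1 : HasFDerivAt e (ContinuousLinearMap.id ℝ E) ((0 : ℝ) • v) := by
        rw [zero_smul]; exact he.hasStrictFDerivAt.hasFDerivAt
      have a2 := a1.comp_hasDerivAt (0 : ℝ) ((hasDerivAt_id (0 : ℝ)).smul_const v)
      simpa [Function.comp_def] using a2
    refine h1.unique (h2.congr_of_eventuallyEq ?_)
    filter_upwards [hev, hnear v] with t ht htb
    show ψ (X (t • v)) = _
    rw [ht, ψ.right_inv (hball₁ _ htb).2]
  · have hγ0 := hγ.map_zero
    have hγc : Tendsto γ (𝓝 0) (𝓝 1) := by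
      rw [← hγ0]; exact hγ.contMDiff.continuous.continuousAt
    have hγs : ∀ᶠ t in 𝓝 (0 : ℝ), γ t ∈ ψ.source :=
      hγc (ψ.open_source.mem_nhds (one_mem_source_oneChart G))
    have h1 := he.eventually_eq v (fun t => ψ (γ t))
      (by simp only [hγ0]; exact oneChart_one G)
      (by
        have h := hasDerivAt_oneChart_comp (E := E)
          (hγ.contMDiff.mdifferentiable (by simp) (0 : ℝ)) hγ0
        rw [hγ.velocity] at h
        exact h)
      (by
        filter_upwards [hγs] with t ht
        filter_upwards [hγs] with s hs
        show ψ (γ (t + s)) = ψ (ψ.symm (ψ (γ t)) * ψ.symm (ψ (γ s)))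
        rw [ψ.left_inv ht, ψ.left_inv hs, hγ.map_add])
    refine eq_of_eventuallyEq_of_map_add hγ.map_add (fun s t => hXadd s t v) ?_
    filter_upwards [h1, hγs, hnear v] with t ht hts htb
    show γ t = X (t • v)
    rw [hXe _ htb, ← ht, ψ.left_inv hts]

theorem hasMFDerivAt_comp_of_eq {E : Type*} [NormedAddCommGroup E] [NormedSpace ℝ E]
    {G : Type*} [TopologicalSpace G] [ChartedSpace E G] {f : G → G} {γ : ℝ → G} {g : G} {D : E →L[ℝ] E} {w : ℝ →L[ℝ] E}
    (hg : γ 0 = g) (hf : HasMFDerivAt 𝓘(ℝ, E) 𝓘(ℝ, E) f g D)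
    (hγ : HasMFDerivAt 𝓘(ℝ, ℝ) 𝓘(ℝ, E) γ 0 w) :
    HasMFDerivAt 𝓘(ℝ, ℝ) 𝓘(ℝ, E) (f ∘ γ) 0 (D.comp w) := by
  subst hg
  exact hf.comp 0 hγ

theorem IsOneParameterSubgroup.comp_lieAut {γ : ℝ → G} {v : E}
    (h : IsOneParameterSubgroup (E := E) γ v) (f : LieAut E G) :
    IsOneParameterSubgroup (E := E) (fun t => f.toMulEquiv (γ t)) (f.lieMap v) where
  contMDiff := f.contMDiff_toFun.comp h.contMDiff
  map_add s t := by simp only [h.map_add, map_mul]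
  velocity := by
    let D : E →L[ℝ] E := mfderiv 𝓘(ℝ, E) 𝓘(ℝ, E) f.toFun (1 : G)
    have hD : HasMFDerivAt 𝓘(ℝ, E) 𝓘(ℝ, E) f.toFun (1 : G) D :=
      (f.contMDiff_toFun.mdifferentiable (by simp) (1 : G)).hasMFDerivAt
    let w : ℝ →L[ℝ] E := mfderiv 𝓘(ℝ, ℝ) 𝓘(ℝ, E) γ 0
    have hw : HasMFDerivAt 𝓘(ℝ, ℝ) 𝓘(ℝ, E) γ 0 w :=
      (h.contMDiff.mdifferentiable (by simp) (0 : ℝ)).hasMFDerivAt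
    have h2 := (hasMFDerivAt_comp_of_eq h.map_zero hD hw).mfderiv
    have h3 : w 1 = v := h.velocity
    have h4 : (mfderiv 𝓘(ℝ, ℝ) 𝓘(ℝ, E) (f.toFun ∘ γ) 0 : ℝ →L[ℝ] E) 1 = D v := by
      rw [← h3]; exact congr($h2 1)
    exact h4

/-- Conjugation by `g` as an automorphism of the Lie group `G`. -/
def LieAut.conj (g : G) : LieAut E G where
  toMulEquiv := MulAut.conj g
  contMDiff_toFun := by
    show ContMDiff 𝓘(ℝ, E) 𝓘(ℝ, E) ∞ (fun x => g * x * g⁻¹)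
    exact (contMDiff_const.mul contMDiff_id).mul contMDiff_const
  contMDiff_invFun := by
    show ContMDiff 𝓘(ℝ, E) 𝓘(ℝ, E) ∞ (fun x => g⁻¹ * x * g)
    exact (contMDiff_const.mul contMDiff_id).mul contMDiff_const

end LieGroup

/-! ### First-order calculus with an exponential map -/

namespace ExpMap

variable {E : Type*} [NormedAddCommGroup E] [NormedSpace ℝ E]
  {G : Type*} [TopologicalSpace G] [Group G] (X : ExpMap E G)

theorem exp_zero : X.exp 0 = 1 := by
  simpa using X.map_add_smul 0 0 0

theorem exp_neg (v : E) : X.exp (-v) = (X.exp v)⁻¹ := by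
  refine eq_inv_of_mul_eq_one_left ?_
  have := X.map_add_smul (-1) 1 v
  rwa [neg_add_cancel, zero_smul, X.exp_zero, one_smul, neg_one_smul, eq_comm] at this

theorem exp_nsmul (n : ℕ) (v : E) : X.exp ((n : ℝ) • v) = X.exp v ^ n := by
  induction n with
  | zero => simp [X.exp_zero]
  | succ n ih =>
    rw [pow_succ, ← ih]
    have := X.map_add_smul n 1 v
    rw [one_smul] at this
    rw [← this]; push_cast; rfl

theorem exp_inv_nat_smul_pow {n : ℕ} (hn : n ≠ 0) (v : E) :
    X.exp ((n : ℝ)⁻¹ • v) ^ n = X.exp v := by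
  rw [← X.exp_nsmul, smul_inv_smul₀ (by exact_mod_cast hn)]

theorem injOn_exp : InjOn X.exp X.chart.source := fun v hv w hw h => by
  rw [← X.chart_apply v hv, ← X.chart_apply w hw] at h
  exact X.chart.injOn hv hw h

theorem source_mem_nhds : X.chart.source ∈ 𝓝 (0 : E) := X.chart.open_source.mem_nhds X.zero_mem

theorem chart_zero : X.chart 0 = 1 := by rw [X.chart_apply 0 X.zero_mem, X.exp_zero]

theorem one_mem_target : (1 : G) ∈ X.chart.target := by
  rw [← X.chart_zero]; exact X.chart.map_source X.zero_mem

theorem symm_one : X.chart.symm 1 = 0 := by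
  rw [← X.chart_zero]; exact X.chart.left_inv X.zero_mem

theorem target_mem_nhds : X.chart.target ∈ 𝓝 (1 : G) :=
  X.chart.open_target.mem_nhds X.one_mem_target

theorem exp_symm {g : G} (hg : g ∈ X.chart.target) : X.exp (X.chart.symm g) = g := by
  rw [← X.chart_apply _ (X.chart.map_target hg), X.chart.right_inv hg]

theorem tendsto_symm : Tendsto X.chart.symm (𝓝 1) (𝓝 0) := by
  have := (X.chart.continuousAt_symm X.one_mem_target).tendsto
  rwa [X.symm_one] at this

theorem tendsto_exp : Tendsto X.exp (𝓝 0) (𝓝 1) := by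
  have := X.continuous_exp.tendsto 0
  rwa [X.exp_zero] at this

theorem map_exp_nhds_zero : map X.exp (𝓝 0) = 𝓝 1 := by
  have h := X.chart.map_nhds_eq X.zero_mem
  rw [X.chart_zero] at h
  rw [← h]
  refine map_congr ?_
  filter_upwards [X.source_mem_nhds] with v hv using (X.chart_apply v hv).symm

theorem tendsto_inv_nat_smul {u : ℕ → E} {v : E} (hu : Tendsto u atTop (𝓝 v)) :
    Tendsto (fun n : ℕ => (n : ℝ)⁻¹ • u n) atTop (𝓝 0) := by
  simpa using (tendsto_inv_atTop_nhds_zero_nat (𝕜 := ℝ)).smul hu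

theorem eq_of_exp_smul_eq {v w : E} (h : ∀ t : ℝ, X.exp (t • v) = X.exp (t • w)) : v = w := by
  have hv : ∀ v : E, Tendsto (fun t : ℝ => t • v) (𝓝[>] 0) (𝓝 0) := fun v =>
    ((by fun_prop : Continuous fun t : ℝ => t • v).tendsto' 0 0 (zero_smul _ _)).mono_left
      nhdsWithin_le_nhds
  obtain ⟨t, ⟨h1, h2⟩, ht⟩ := ((((hv v).eventually_mem X.source_mem_nhds).and
    ((hv w).eventually_mem X.source_mem_nhds)).and
    (self_mem_nhdsWithin : Ioi (0 : ℝ) ∈ 𝓝[>] 0)).exists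
  exact smul_right_injective E (ne_of_gt ht) (X.injOn_exp h1 h2 (h t))

/-- The sequence `x` in `G` satisfies `x n = exp (v / n + o(1 / n))`. -/
def IsTangent (x : ℕ → G) (v : E) : Prop :=
  ∃ u : ℕ → E, Tendsto u atTop (𝓝 v) ∧ ∀ᶠ n : ℕ in atTop, x n = X.exp ((n : ℝ)⁻¹ • u n)

variable {X}

theorem isTangent_exp (v : E) : X.IsTangent (fun n : ℕ => X.exp ((n : ℝ)⁻¹ • v)) v :=
  ⟨fun _ => v, tendsto_const_nhds, Eventually.of_forall fun _ => rfl⟩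

/-- In logarithmic coordinates multiplication has derivative (v, w) ↦ v + w at the origin. Together
with `IsTangent.tendsto_pow` this replaces the bracket calculus. -/
theorem IsTangent.mul {x y : ℕ → G} {v w : E} (hx : X.IsTangent x v) (hy : X.IsTangent y w)
    [ContinuousMul G] : X.IsTangent (fun n => x n * y n) (v + w) := by
  obtain ⟨a, ha, hxa⟩ := hx
  obtain ⟨b, hb, hyb⟩ := hy
  have ha0 := tendsto_inv_nat_smul ha
  have hb0 := tendsto_inv_nat_smul hb
  let μ : E × E → E := fun p => X.chart.symm (X.exp p.1 * X.exp p.2)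
  have hμ0 : μ (0, 0) = 0 := by simp [μ, X.exp_zero, X.symm_one]
  refine ⟨fun n => (n : ℝ) • μ ((n : ℝ)⁻¹ • a n, (n : ℝ)⁻¹ • b n), ?_, ?_⟩
  · have h1 := X.hasStrictFDerivAt_mul.hasFDerivAt.hasFDerivWithinAt (s := univ)
    have h2 := h1.lim (f := μ) (c := fun n : ℕ => (n : ℝ))
      (d := fun n : ℕ => ((n : ℝ)⁻¹ • a n, (n : ℝ)⁻¹ • b n)) (v := (v, w)) (l := atTop)
      (ha0.prodMk_nhds hb0)
      (Eventually.of_forall fun _ => mem_univ _)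
      (by
        have : Tendsto (fun n => (a n, b n)) atTop (𝓝 (v, w)) := ha.prodMk_nhds hb
        refine this.congr' ?_
        filter_upwards [eventually_ne_atTop 0] with n hn
        have hn' : (n : ℝ) ≠ 0 := by exact_mod_cast hn
        simp [smul_smul, hn'])
    simpa [hμ0, ← Prod.mk_zero_zero] using h2
  · have h1 : Tendsto (fun n : ℕ => X.exp ((n : ℝ)⁻¹ • a n) * X.exp ((n : ℝ)⁻¹ • b n)) atTop
        (𝓝 1) := by
      simpa using (X.tendsto_exp.comp ha0).mul (X.tendsto_exp.comp hb0)
    filter_upwards [hxa, hyb, h1 X.target_mem_nhds, eventually_ne_atTop 0] with n h2 h3 h4 h5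
    have hn' : (n : ℝ) ≠ 0 := by exact_mod_cast h5
    rw [inv_smul_smul₀ hn', h2, h3]
    exact (X.exp_symm h4).symm

theorem IsTangent.map {x : ℕ → G} {v : E} (hx : X.IsTangent x v) {ψ : G → G} {A : E → E}
    (hA : Continuous A) (hAs : ∀ (c : ℝ) v, A (c • v) = c • A v)
    (h : ∀ v, ψ (X.exp v) = X.exp (A v)) : X.IsTangent (fun n => ψ (x n)) (A v) := by
  obtain ⟨a, ha, hxa⟩ := hx
  refine ⟨fun n => A (a n), (hA.tendsto v).comp ha, hxa.mono fun n hn => ?_⟩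
  show ψ (x n) = _
  rw [hn, h, hAs]

theorem IsTangent.inv {x : ℕ → G} {v : E} (hx : X.IsTangent x v) :
    X.IsTangent (fun n => (x n)⁻¹) (-v) :=
  hx.map (ψ := fun g => g⁻¹) continuous_neg (fun c v => (smul_neg c v).symm)
    (fun v => (X.exp_neg v).symm)

theorem IsTangent.tendsto_pow {x : ℕ → G} {v : E} (hx : X.IsTangent x v) :
    Tendsto (fun n => x n ^ n) atTop (𝓝 (X.exp v)) := by
  obtain ⟨a, ha, hxa⟩ := hx
  refine ((X.continuous_exp.tendsto v).comp ha).congr' ?_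
  filter_upwards [hxa, eventually_ne_atTop 0] with n hn hn0
  rw [hn, X.exp_inv_nat_smul_pow hn0]; rfl

theorem IsTangent.eq_zero {v : E} (h : X.IsTangent (fun _ => 1) v) : v = 0 := by
  obtain ⟨a, ha, hxa⟩ := h
  refine tendsto_nhds_unique ha (tendsto_const_nhds.congr' ?_)
  filter_upwards [hxa, tendsto_inv_nat_smul ha X.source_mem_nhds, eventually_ne_atTop 0] with n h1 h2 h3
  have h4 := X.injOn_exp X.zero_mem h2 (by rw [X.exp_zero, h1])
  have hn' : (n : ℝ)⁻¹ ≠ 0 := inv_ne_zero (by exact_mod_cast h3)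
  exact (smul_eq_zero.mp h4.symm).resolve_left hn' |>.symm

variable (X)

/-- A variant of the Trotter product formula, modulo a closed set. -/
theorem exp_add_mem_of_pow_mem [ContinuousMul G] {N : Set G} (hN : IsClosed N) {v w : E}
    (h : ∀ n : ℕ, n ≠ 0 → (X.exp ((n : ℝ)⁻¹ • v) * X.exp ((n : ℝ)⁻¹ • w)) ^ n ∈ N) :
    X.exp (v + w) ∈ N :=
  hN.mem_of_tendsto ((isTangent_exp v).mul (isTangent_exp w)).tendsto_pow
    ((eventually_ne_atTop 0).mono h)

section Product

variable (A B : Submodule ℝ E)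

theorem hasStrictFDerivAt_symm_exp_mul_exp :
    HasStrictFDerivAt (fun p : A × B => X.chart.symm (X.exp p.1 * X.exp p.2))
      (A.subtypeL.coprod B.subtypeL) (0, 0) := by
  have h1 : HasStrictFDerivAt (fun p : A × B => ((p.1 : E), (p.2 : E)))
      (A.subtypeL.prodMap B.subtypeL) (0, 0) :=
    (A.subtypeL.prodMap B.subtypeL).hasStrictFDerivAt
  have h2 := HasStrictFDerivAt.comp (g := fun p : E × E => X.chart.symm (X.exp p.1 * X.exp p.2))
    ((0 : A), (0 : B)) X.hasStrictFDerivAt_mul h1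
  have heq : A.subtypeL.coprod B.subtypeL = (ContinuousLinearMap.fst ℝ E E +
      ContinuousLinearMap.snd ℝ E E).comp (A.subtypeL.prodMap B.subtypeL) := by
    ext <;> simp
  rw [heq]
  exact h2

theorem exists_injOn_exp_mul_exp [FiniteDimensional ℝ E] (h : IsCompl A B) :
    ∃ N ∈ 𝓝 ((0, 0) : A × B), InjOn (fun p : A × B => X.exp p.1 * X.exp p.2) N := by
  let L : (A × B) ≃L[ℝ] E := (A.prodEquivOfIsCompl B h).toContinuousLinearEquiv
  have hL : (L : A × B →L[ℝ] E) = A.subtypeL.coprod B.subtypeL := by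
    ext x <;> simp [L]
  have h1 := X.hasStrictFDerivAt_symm_exp_mul_exp A B
  rw [← hL] at h1
  refine ⟨(h1.toOpenPartialHomeomorph _).source,
    (h1.toOpenPartialHomeomorph _).open_source.mem_nhds h1.mem_toOpenPartialHomeomorph_source, ?_⟩
  intro p hp q hq hpq
  have h2 := (h1.toOpenPartialHomeomorph _).injOn hp hq
  rw [h1.toOpenPartialHomeomorph_coe] at h2
  exact h2 (congrArg X.chart.symm hpq)

variable [ContinuousMul G]

theorem eventually_exp_mul_exp_mem_target :
    ∀ᶠ p : A × B in 𝓝 (0, 0), X.exp p.1 * X.exp p.2 ∈ X.chart.target := by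
  have : Tendsto (fun p : A × B => X.exp p.1 * X.exp p.2) (𝓝 (0, 0)) (𝓝 1) := by
    have hc : Continuous (fun p : A × B => X.exp p.1 * X.exp p.2) := by
      have := X.continuous_exp; fun_prop
    exact hc.tendsto' _ _ (by simp [X.exp_zero])
  exact this X.target_mem_nhds

/-- The derivative at the origin, (a, b) ↦ a + b, is onto, so the map is open there. -/
theorem nhds_one_le_map_exp_mul_exp [FiniteDimensional ℝ E] (h : A ⊔ B = ⊤) :
    𝓝 (1 : G) ≤ map (fun p : A × B => X.exp p.1 * X.exp p.2) (𝓝 (0, 0)) := by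
  have hsurj : (A.subtypeL.coprod B.subtypeL).range = ⊤ := by
    rw [eq_top_iff, ← h]
    intro x hx
    obtain ⟨a, ha, b, hb, rfl⟩ := Submodule.mem_sup.mp hx
    exact ⟨(⟨a, ha⟩, ⟨b, hb⟩), rfl⟩
  have h1 := (X.hasStrictFDerivAt_symm_exp_mul_exp A B).map_nhds_eq_of_surj hsurj
  simp only [ZeroMemClass.coe_zero, X.exp_zero, mul_one, X.symm_one] at h1
  have h2 : map (fun p : A × B => X.exp p.1 * X.exp p.2) (𝓝 (0, 0)) =
      map X.exp (map (fun p : A × B => X.chart.symm (X.exp p.1 * X.exp p.2)) (𝓝 (0, 0))) := by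
    rw [map_map]
    refine map_congr ?_
    filter_upwards [X.eventually_exp_mul_exp_mem_target A B] with p hp using (X.exp_symm hp).symm
  rw [h2, h1, X.map_exp_nhds_zero]

end Product

end ExpMap

/-! ### Unipotence of the adjoint action -/

/-- An exponential map together with the adjoint representation. -/
structure LieExpMap (E : Type*) [NormedAddCommGroup E] [NormedSpace ℝ E]
    (G : Type*) [TopologicalSpace G] [Group G] extends ExpMap E G where
  Ad : G → E ≃L[ℝ] E
  exp_Ad : ∀ g v, exp (Ad g v) = g * exp v * g⁻¹

namespace LieExpMap

variable {E : Type*} [NormedAddCommGroup E] [NormedSpace ℝ E]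
  {G : Type*} [TopologicalSpace G] [Group G] (X : LieExpMap E G)

/-- The ascending series of subspaces on whose successive quotients `G` acts trivially. -/
def unipotentSeries : ℕ → Submodule ℝ E
  | 0 => ⊥
  | k + 1 => ⨅ g, (unipotentSeries k).comap ((X.Ad g : E →ₗ[ℝ] E) - LinearMap.id)

theorem mem_unipotentSeries_succ {k : ℕ} {v : E} :
    v ∈ X.unipotentSeries (k + 1) ↔ ∀ g, X.Ad g v - v ∈ X.unipotentSeries k := by
  simp [unipotentSeries]

theorem exp_smul_Ad (g : G) (t : ℝ) (v : E) :
    X.exp (t • X.Ad g v) = g * X.exp (t • v) * g⁻¹ := by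
  rw [← map_smul, X.exp_Ad]

/-- If x n lies in C_j and is tangent to v, then g (x n) g⁻¹ (x n)⁻¹ lies in C_{j+1} and is tangent
to Ad g v - v. Sequences replace Lie algebras of the C_j, which are not yet known to be closed. -/
theorem mem_unipotentSeries_of_isTangent [ContinuousMul G] {c : ℕ} (hc : centralSeries G c = ⊥) :
    ∀ (k j : ℕ), j + k = c → ∀ {x : ℕ → G} {v : E}, X.IsTangent x v →
      (∀ n, x n ∈ centralSeries G j) → v ∈ X.unipotentSeries k := by
  intro k
  induction k with
  | zero =>
    intro j hj x v hx hxj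
    rw [add_zero] at hj
    subst hj
    have : x = fun _ => 1 := funext fun n => by
      have := hxj n; rw [hc] at this; exact Subgroup.mem_bot.mp this
    subst this
    exact hx.eq_zero
  | succ k ih =>
    intro j hj x v hx hxj
    rw [mem_unipotentSeries_succ]
    intro g
    refine ih (j + 1) (by omega) (x := fun n => g * x n * g⁻¹ * (x n)⁻¹) ?_ fun n => ?_
    · rw [sub_eq_add_neg]
      exact (hx.map (ψ := fun y => g * y * g⁻¹) (A := X.Ad g) (X.Ad g).continuous
        (fun c v => map_smul _ c v) (fun v => (X.exp_Ad g v).symm)).mul hx.inv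
    · have h1 := Subgroup.commutator_mem_commutator (hxj n) (Subgroup.mem_top g)
      have h2 := inv_mem h1
      rw [commutatorElement_inv] at h2
      exact h2

theorem exists_unipotentSeries_eq_top [ContinuousMul G] [Group.IsNilpotent G] :
    ∃ k, X.unipotentSeries k = ⊤ := by
  obtain ⟨c, hc⟩ := Subgroup.nilpotent_iff_lowerCentralSeries.mp ‹Group.IsNilpotent G›
  exact ⟨c, eq_top_iff.mpr fun v _ => X.mem_unipotentSeries_of_isTangent hc c 0 (zero_add c)
    (ExpMap.isTangent_exp v) fun _ => Subgroup.mem_top _⟩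

theorem map_Ad_eq {φ : G ≃* G} {T : E ≃L[ℝ] E} (hφ : ∀ v, φ (X.exp v) = X.exp (T v))
    (g : G) (v : E) : X.Ad (φ g) (T v) = T (X.Ad g v) := by
  refine X.eq_of_exp_smul_eq fun t => ?_
  rw [X.exp_smul_Ad, ← map_smul, ← map_smul, ← hφ, ← hφ, X.exp_smul_Ad]
  simp

theorem map_mem_unipotentSeries {φ : G ≃* G} {T : E ≃L[ℝ] E}
    (hφ : ∀ v, φ (X.exp v) = X.exp (T v)) (k : ℕ) :
    ∀ {v : E}, v ∈ X.unipotentSeries k → T v ∈ X.unipotentSeries k := by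
  induction k with
  | zero => intro v hv; rw [(Submodule.mem_bot ℝ).mp hv, map_zero]; exact Submodule.zero_mem _
  | succ k ih =>
    intro v hv
    rw [mem_unipotentSeries_succ] at *
    intro g
    obtain ⟨h, rfl⟩ := φ.surjective g
    rw [X.map_Ad_eq hφ, ← map_sub]
    exact ih (hv h)

/-- If every unipotent step respects the decomposition into `S` and `U`, then `S` and every
conjugate of `U` intersect trivially. -/
theorem disjoint_map_Ad [ContinuousMul G] [Group.IsNilpotent G] {S U : Submodule ℝ E}
    (hSU : Disjoint S U)
    (h : ∀ k, X.unipotentSeries k ≤ (X.unipotentSeries k ⊓ S) ⊔ (X.unipotentSeries k ⊓ U)) (g : G) :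
    Disjoint S (U.map (X.Ad g : E →ₗ[ℝ] E)) := by
  obtain ⟨N, hN⟩ := X.exists_unipotentSeries_eq_top
  have key : ∀ k, ∀ v ∈ U, X.Ad g v ∈ S → v ∈ X.unipotentSeries k → v = 0 := by
    intro k
    induction k with
    | zero => intro v _ _ hv; exact hv
    | succ k ih =>
      intro v hvU hvS hv
      -- Write Ad g v - v = s + u inside the k-th step. Then Ad g v - s = v + u lies in both S and
      -- U, so v = -u already lies in the k-th step.
      have h1 := h k (X.mem_unipotentSeries_succ.mp hv g)
      obtain ⟨s, hs, u, hu, hsu⟩ := Submodule.mem_sup.mp h1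
      have h2 : X.Ad g v - s = v + u := by rw [← sub_eq_zero]; rw [← sub_eq_zero] at hsu; rw [← neg_eq_zero, ← hsu]; abel
      have h3 : v + u = 0 := Submodule.disjoint_def.mp hSU _
        (h2 ▸ S.sub_mem hvS hs.2) (U.add_mem hvU hu.2)
      refine ih v hvU hvS ?_
      rw [eq_neg_of_add_eq_zero_left h3]
      exact Submodule.neg_mem _ hu.1
  rw [Submodule.disjoint_def]
  rintro _ hx ⟨v, hv, rfl⟩
  have := key N v hv hx (hN ▸ Submodule.mem_top)
  rw [this, map_zero]

end LieExpMap

/-! ### Linear algebra of hyperbolic operators -/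

section Hyperbolic

open scoped TensorProduct
open Module

theorem pow_apply_eq_sum_of_pow_sub_apply_eq_zero {M : Type*} [AddCommGroup M] [Module ℂ M]
    (f : End ℂ M) (μ : ℂ) {k : ℕ} {x : M} (hx : ((f - algebraMap ℂ (End ℂ M) μ) ^ k) x = 0) (n : ℕ) :
    (f ^ n) x = ∑ i ∈ Finset.range k, ((n.choose i : ℂ) * μ ^ (n - i)) •
      ((f - algebraMap ℂ (End ℂ M) μ) ^ i) x := by
  set N := f - algebraMap ℂ (End ℂ M) μ with hN
  have hc : Commute N (algebraMap ℂ (End ℂ M) μ) := Algebra.commutes' μ N |>.symm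
  have hf : f = N + algebraMap ℂ (End ℂ M) μ := by simp [hN]
  have hz : ∀ i, k ≤ i → (N ^ i) x = 0 := fun i hi => by
    rw [← Nat.sub_add_cancel hi, pow_add, Module.End.mul_apply, hx, map_zero]
  have hterm : ∀ i, (N ^ i * (algebraMap ℂ (End ℂ M) μ) ^ (n - i) * (n.choose i : End ℂ M)) x =
      ((n.choose i : ℂ) * μ ^ (n - i)) • (N ^ i) x := fun i => by
    rw [← map_pow, ← map_natCast (algebraMap ℂ (End ℂ M)), mul_assoc, ← map_mul, Module.End.mul_apply,
      Module.algebraMap_end_apply, map_smul, mul_comm]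
  have h1 : (f ^ n) x = ∑ i ∈ Finset.range (n + 1),
      ((n.choose i : ℂ) * μ ^ (n - i)) • (N ^ i) x := by
    conv_lhs => rw [hf]
    rw [hc.add_pow, LinearMap.sum_apply]
    exact Finset.sum_congr rfl fun i _ => hterm i
  rw [h1]
  rcases le_total (n + 1) k with h | h
  · refine Finset.sum_subset (Finset.range_mono h) fun i _ hi => ?_
    rw [Finset.mem_range, not_lt] at hi
    rw [Nat.choose_eq_zero_of_lt (by omega)]; simp
  · refine (Finset.sum_subset (Finset.range_mono h) fun i _ hi => ?_).symm
    rw [Finset.mem_range, not_lt] at hi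
    rw [hz i hi, smul_zero]

theorem tendsto_choose_mul_pow {μ : ℂ} (hμ : ‖μ‖ < 1) (i : ℕ) :
    Tendsto (fun n : ℕ => (n.choose i : ℂ) * μ ^ (n - i)) atTop (𝓝 0) := by
  rw [← tendsto_add_atTop_iff_nat i]
  simpa using (summable_choose_mul_geometric_of_norm_lt_one (R := ℂ) i hμ).tendsto_atTop_zero

/-- On a generalized eigenvector fⁿ is a sum of fixed vectors with coefficients binomial times
geometric. Testing against a real-linear ℓ into V avoids a topology on the complexification M. -/
theorem tendsto_of_mem_maxGenEigenspace {M V : Type*} [AddCommGroup M] [Module ℂ M]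
    [NormedAddCommGroup V] [NormedSpace ℝ V] (f : End ℂ M) {μ : ℂ} (hμ : ‖μ‖ < 1) {x : M}
    (hx : x ∈ f.maxGenEigenspace μ) (ℓ : M →ₗ[ℝ] V) :
    Tendsto (fun n : ℕ => ℓ ((f ^ n) x)) atTop (𝓝 0) := by
  obtain ⟨k, hk⟩ := (Module.End.mem_maxGenEigenspace f μ x).mp hx
  have hk' : ((f - algebraMap ℂ (End ℂ M) μ) ^ k) x = 0 := by
    rw [Algebra.algebraMap_eq_smul_one]; exact hk
  simp_rw [pow_apply_eq_sum_of_pow_sub_apply_eq_zero f μ hk', map_sum]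
  rw [show (0 : V) = ∑ i ∈ Finset.range k, 0 by simp]
  refine tendsto_finsetSum _ fun i _ => ?_
  have hℓ : ∀ (c : ℂ) (y : M), ℓ (c • y) = c.re • ℓ y + c.im • ℓ (Complex.I • y) := fun c y => by
    rw [← map_smul, ← map_smul, ← map_add]
    congr 1
    conv_lhs => rw [← Complex.re_add_im c, add_smul, mul_smul]
    rw [Complex.coe_smul, Complex.coe_smul]
  refine Tendsto.congr (fun n => (hℓ _ _).symm) ?_
  have h := tendsto_choose_mul_pow hμ i
  have h1 := ((Complex.continuous_re.tendsto 0).comp h).smul_const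
    (ℓ (((f - algebraMap ℂ (End ℂ M) μ) ^ i) x))
  have h2 := ((Complex.continuous_im.tendsto 0).comp h).smul_const
    (ℓ (Complex.I • ((f - algebraMap ℂ (End ℂ M) μ) ^ i) x))
  simpa using h1.add h2

theorem mem_maxGenEigenspace_inv {M : Type*} [AddCommGroup M] [Module ℂ M] {f g : End ℂ M}
    (hgf : g * f = 1) (hfg : f * g = 1) {μ : ℂ} (hμ : μ ≠ 0) {x : M}
    (hx : x ∈ f.maxGenEigenspace μ) : x ∈ g.maxGenEigenspace μ⁻¹ := by
  obtain ⟨k, hk⟩ := (Module.End.mem_maxGenEigenspace f μ x).mp hx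
  refine (Module.End.mem_maxGenEigenspace g μ⁻¹ x).mpr ⟨k, ?_⟩
  have h1 : g - μ⁻¹ • (1 : End ℂ M) = (-(μ⁻¹ • g)) * (f - μ • 1) := by
    rw [neg_mul, mul_sub, smul_mul_assoc, hgf, smul_mul_smul_comm, inv_mul_cancel₀ hμ, one_smul, mul_one]
    abel
  have hcomm : Commute (-(μ⁻¹ • g)) (f - μ • 1) := by
    refine Commute.neg_left (Commute.smul_left (Commute.sub_right ?_ ?_) _)
    · rw [commute_iff_eq, hgf, hfg]
    · exact (Commute.one_right g).smul_right μ
  rw [h1, hcomm.mul_pow, Module.End.mul_apply, hk, map_zero]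

variable {V : Type*} [NormedAddCommGroup V] [NormedSpace ℝ V]

theorem continuousLinearEquiv_mul_apply (A B : V ≃L[ℝ] V) (v : V) : (A * B) v = A (B v) := rfl

theorem continuousLinearEquiv_one_apply (v : V) : (1 : V ≃L[ℝ] V) v = v := rfl

/-- A real operator without complex eigenvalues on the unit circle splits the space into a
contracted and an expanded part. -/
theorem exists_add_tendsto_of_not_hasEigenvalue [FiniteDimensional ℝ V] {A B : End ℝ V} (hBA : B * A = 1) (hAB : A * B = 1)
    (hA : ∀ z : ℂ, ‖z‖ = 1 → ¬ Module.End.HasEigenvalue (LinearMap.baseChange ℂ A) z) (v : V) :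
    ∃ s u : V, v = s + u ∧ Tendsto (fun n : ℕ => (A ^ n) s) atTop (𝓝 0) ∧
      Tendsto (fun n : ℕ => (B ^ n) u) atTop (𝓝 0) := by
  set A' := LinearMap.baseChange ℂ A
  set B' := LinearMap.baseChange ℂ B
  have hBA' : B' * A' = 1 := by
    rw [← LinearMap.baseChange_mul, hBA, LinearMap.baseChange_one]
  have hAB' : A' * B' = 1 := by
    rw [← LinearMap.baseChange_mul, hAB, LinearMap.baseChange_one]
  -- The real part commutes with base-changed operators and sends 1 ⊗ v back to v, so the complex
  -- decomposition descends to V.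
  let ℓ : ℂ ⊗[ℝ] V →ₗ[ℝ] V :=
    (TensorProduct.lid ℝ V).toLinearMap ∘ₗ LinearMap.rTensor V Complex.reLm
  have hℓ : ∀ (C : End ℝ V) (x : ℂ ⊗[ℝ] V), ℓ (LinearMap.baseChange ℂ C x) = C (ℓ x) := by
    intro C x
    induction x with
    | zero => simp
    | tmul z w => simp [ℓ]
    | add x y hx hy => simp only [map_add, hx, hy]
  have hℓn : ∀ (C : End ℝ V) (n : ℕ) (x : ℂ ⊗[ℝ] V),
      ℓ ((LinearMap.baseChange ℂ C ^ n) x) = (C ^ n) (ℓ x) := by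
    intro C n x
    rw [← LinearMap.baseChange_pow, hℓ]
  have key : ∀ x : ℂ ⊗[ℝ] V, ∃ s u : ℂ ⊗[ℝ] V, x = s + u ∧
      Tendsto (fun n : ℕ => ℓ ((A' ^ n) s)) atTop (𝓝 0) ∧
      Tendsto (fun n : ℕ => ℓ ((B' ^ n) u)) atTop (𝓝 0) := by
    intro x
    have hx : x ∈ ⨆ μ : ℂ, Module.End.maxGenEigenspace A' μ := by
      rw [Module.End.iSup_maxGenEigenspace_eq_top]; trivial
    induction hx using Submodule.iSup_induction' with
    | mem μ x hx =>
      rcases lt_trichotomy ‖μ‖ 1 with h | h | h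
      · exact ⟨x, 0, (add_zero x).symm, tendsto_of_mem_maxGenEigenspace A' h hx ℓ, by simp⟩
      · have : x = 0 := by
          by_contra hx0
          refine hA μ h ?_
          obtain ⟨k, hk⟩ := (Module.End.mem_maxGenEigenspace A' μ x).mp hx
          refine Module.End.hasEigenvalue_of_hasGenEigenvalue (k := k) ?_
          rw [Module.End.HasGenEigenvalue, Module.End.HasUnifEigenvalue, Submodule.ne_bot_iff]
          exact ⟨x, Module.End.mem_genEigenspace_nat.mpr hk, hx0⟩
        exact ⟨0, 0, by simp [this], by simp, by simp⟩
      · have hμ : μ ≠ 0 := by rintro rfl; simp at h; linarith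
        refine ⟨0, x, (zero_add x).symm, by simp, tendsto_of_mem_maxGenEigenspace B' (μ := μ⁻¹) ?_
          (mem_maxGenEigenspace_inv hBA' hAB' hμ hx) ℓ⟩
        rw [norm_inv]; exact inv_lt_one_of_one_lt₀ h
    | zero => exact ⟨0, 0, by simp, by simp, by simp⟩
    | add x y _ _ hx hy =>
      obtain ⟨s, u, rfl, hs, hu⟩ := hx
      obtain ⟨s', u', rfl, hs', hu'⟩ := hy
      refine ⟨s + s', u + u', by abel, ?_, ?_⟩
      · simpa using hs.add hs'
      · simpa using hu.add hu'
  obtain ⟨s, u, hsu, hs, hu⟩ := key (1 ⊗ₜ v)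
  refine ⟨ℓ s, ℓ u, ?_, ?_, ?_⟩
  · rw [← map_add, ← hsu]; simp [ℓ]
  · simpa only [← hℓn] using hs
  · simpa only [← hℓn] using hu

/-- The subspace of vectors contracted by the positive powers of `T`. -/
def contractedSubspace (T : V ≃L[ℝ] V) : Submodule ℝ V where
  carrier := {v | Tendsto (fun n : ℕ => (T ^ n) v) atTop (𝓝 0)}
  zero_mem' := by simp
  add_mem' {v w} hv hw := by
    simpa using Tendsto.add (show Tendsto (fun n : ℕ => (T ^ n) v) atTop (𝓝 0) from hv)
      (show Tendsto (fun n : ℕ => (T ^ n) w) atTop (𝓝 0) from hw)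
  smul_mem' c v hv := by
    simpa using Tendsto.const_smul (show Tendsto (fun n : ℕ => (T ^ n) v) atTop (𝓝 0) from hv) c

theorem mem_contractedSubspace {T : V ≃L[ℝ] V} {v : V} :
    v ∈ contractedSubspace T ↔ Tendsto (fun n : ℕ => (T ^ n) v) atTop (𝓝 0) := Iff.rfl

theorem map_mem_contractedSubspace {T : V ≃L[ℝ] V} {v : V} (hv : v ∈ contractedSubspace T) :
    T v ∈ contractedSubspace T := by
  have := (tendsto_add_atTop_iff_nat 1).mpr (mem_contractedSubspace.mp hv)
  rw [mem_contractedSubspace]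
  simpa only [pow_succ, continuousLinearEquiv_mul_apply] using this

theorem inv_map_mem_contractedSubspace {T : V ≃L[ℝ] V} {v : V} (hv : v ∈ contractedSubspace T) :
    T⁻¹ v ∈ contractedSubspace T := by
  rw [mem_contractedSubspace] at *
  rw [← tendsto_add_atTop_iff_nat 1]
  refine hv.congr fun n => ?_
  rw [← continuousLinearEquiv_mul_apply, pow_succ, mul_inv_cancel_right]

variable [FiniteDimensional ℝ V]

theorem exists_norm_pow_le (T : V ≃L[ℝ] V) :
    ∃ C : ℝ, 0 < C ∧ ∀ v ∈ contractedSubspace T, ∀ n : ℕ, ‖(T ^ n) v‖ ≤ C * ‖v‖ := by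
  obtain ⟨C, hC⟩ := banach_steinhaus
    (g := fun n : ℕ => ((T ^ n : V ≃L[ℝ] V) : V →L[ℝ] V).comp (contractedSubspace T).subtypeL)
    (fun v => by
      obtain ⟨C, hC⟩ := (mem_contractedSubspace.mp v.2).norm.bddAbove_range
      exact ⟨C, fun n => hC ⟨n, rfl⟩⟩)
  refine ⟨max C 1, by positivity, fun v hv n => ?_⟩
  refine (ContinuousLinearMap.le_of_opNorm_le _ (hC n) ⟨v, hv⟩).trans ?_
  exact mul_le_mul_of_nonneg_right (le_max_left _ _) (norm_nonneg _)

/-- Contraction is uniform on bounded sets, as seen on a basis. The density argument needs it for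
vectors varying with n. -/
theorem tendsto_pow_apply_of_bounded (T : V ≃L[ℝ] V) {u : ℕ → V} {R : ℝ}
    (hu : ∀ n, u n ∈ contractedSubspace T) (hR : ∀ n, ‖u n‖ ≤ R) :
    Tendsto (fun n => (T ^ n) (u n)) atTop (𝓝 0) := by
  let b := Module.finBasis ℝ (contractedSubspace T)
  let c : ∀ _ : Fin (finrank ℝ (contractedSubspace T)), contractedSubspace T →L[ℝ] ℝ :=
    fun i => (b.coord i).toContinuousLinearMap
  have h1 : ∀ n, (T ^ n) (u n) = ∑ i, c i ⟨u n, hu n⟩ • (T ^ n) (b i : V) := fun n => by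
    conv_lhs => rw [show u n = ((⟨u n, hu n⟩ : contractedSubspace T) : V) from rfl,
      ← b.sum_repr ⟨u n, hu n⟩]
    simp only [c, LinearMap.coe_toContinuousLinearMap', Module.Basis.coord_apply,
      AddSubmonoidClass.coe_finsetSum, SetLike.val_smul, map_sum, map_smul]
  simp_rw [h1]
  rw [show (0 : V) = ∑ i : Fin (finrank ℝ (contractedSubspace T)), 0 by simp]
  refine tendsto_finsetSum _ fun i _ => ?_
  refine squeeze_zero_norm (a := fun n => (‖c i‖ * R) * ‖(T ^ n) (b i : V)‖) (fun n => ?_) ?_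
  · rw [norm_smul]
    gcongr
    refine (ContinuousLinearMap.le_opNorm _ _).trans ?_
    gcongr
    exact hR n
  · simpa using (mem_contractedSubspace.mp (b i).2).norm.const_mul (‖c i‖ * R)

/-- For v in both, v = T⁻ⁿ(Tⁿ v), and T⁻ⁿ is uniformly bounded on the space contracted by T⁻¹ while
Tⁿ v → 0. -/
theorem disjoint_contractedSubspace_inv (T : V ≃L[ℝ] V) :
    Disjoint (contractedSubspace T) (contractedSubspace T⁻¹) := by
  obtain ⟨C, hC, hb⟩ := exists_norm_pow_le T⁻¹
  rw [Submodule.disjoint_def]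
  intro v hs hu
  have hun : ∀ n : ℕ, (T ^ n) v ∈ contractedSubspace T⁻¹ := fun n => by
    induction n with
    | zero => exact hu
    | succ n ih =>
      have := inv_map_mem_contractedSubspace ih
      rwa [inv_inv, ← continuousLinearEquiv_mul_apply, ← pow_succ'] at this
  have h1 : ∀ n : ℕ, ‖v‖ ≤ C * ‖(T ^ n) v‖ := fun n => by
    have := hb _ (hun n) n
    rwa [← continuousLinearEquiv_mul_apply, inv_pow, inv_mul_cancel, continuousLinearEquiv_one_apply] at this
  have h2 : Tendsto (fun n : ℕ => C * ‖(T ^ n) v‖) atTop (𝓝 0) := by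
    simpa using (mem_contractedSubspace.mp hs).norm.const_mul C
  exact norm_le_zero_iff.mp (ge_of_tendsto' h2 h1)

/-- `T` has no complex eigenvalue of absolute value one. -/
def IsHyperbolic (T : V ≃L[ℝ] V) : Prop :=
  ∀ z : ℂ, ‖z‖ = 1 → ¬ Module.End.HasEigenvalue
    (LinearMap.baseChange ℂ (T.toLinearEquiv.toLinearMap : End ℝ V)) z

/-- T restricts to an automorphism of W by finite dimension, and eigenvalues of the restriction are
eigenvalues of T. It is applied to the steps of the unipotent series and to the tangent spaces of
the C_j. -/
theorem IsHyperbolic.le_sup {T : V ≃L[ℝ] V} (hT : IsHyperbolic T) {W : Submodule ℝ V}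
    (hW : ∀ v ∈ W, T v ∈ W) :
    W ≤ (W ⊓ contractedSubspace T) ⊔ (W ⊓ contractedSubspace T⁻¹) := by
  let A : End ℝ W := T.toLinearEquiv.toLinearMap.restrict hW
  have hAinj : Function.Injective A := fun x y h =>
    Subtype.ext (T.injective (congrArg Subtype.val h))
  let e : W ≃ₗ[ℝ] W := LinearEquiv.ofInjectiveEndo A hAinj
  let B : End ℝ W := e.symm.toLinearMap
  have hBA : B * A = 1 := LinearMap.ext fun x => e.symm_apply_apply x
  have hAB : A * B = 1 := LinearMap.ext fun x => e.apply_symm_apply x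
  have hAn : ∀ (n : ℕ) (x : W), (((A ^ n) x : W) : V) = (T ^ n) x := fun n x => by
    induction n with
    | zero => rfl
    | succ n ih =>
      rw [pow_succ', pow_succ', Module.End.mul_apply, continuousLinearEquiv_mul_apply, ← ih]; rfl
  have hB1 : ∀ x : W, ((B x : W) : V) = T⁻¹ x := fun x => by
    refine T.injective ?_
    rw [← continuousLinearEquiv_mul_apply, mul_inv_cancel, continuousLinearEquiv_one_apply]
    exact congrArg Subtype.val (e.apply_symm_apply x)
  have hBn : ∀ (n : ℕ) (x : W), (((B ^ n) x : W) : V) = (T⁻¹ ^ n) x := fun n x => by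
    induction n with
    | zero => rfl
    | succ n ih =>
      rw [pow_succ', pow_succ', Module.End.mul_apply, continuousLinearEquiv_mul_apply, ← ih, hB1]
  have hA : ∀ z : ℂ, ‖z‖ = 1 → ¬ Module.End.HasEigenvalue (LinearMap.baseChange ℂ A) z := by
    intro z hz hev
    obtain ⟨x, hx⟩ := hev.exists_hasEigenvector
    refine hT z hz (Module.End.hasEigenvalue_of_hasEigenvector (x := LinearMap.baseChange ℂ W.subtype x)
      (Module.End.hasEigenvector_iff.mpr ⟨?_, ?_⟩))
    · rw [Module.End.mem_eigenspace_iff, ← LinearMap.comp_apply, ← LinearMap.baseChange_comp]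
      have : T.toLinearEquiv.toLinearMap ∘ₗ W.subtype = W.subtype ∘ₗ A := rfl
      rw [this, LinearMap.baseChange_comp, LinearMap.comp_apply, hx.apply_eq_smul, map_smul]
    · intro h0
      have hinj : Function.Injective (LinearMap.lTensor ℂ W.subtype) :=
        Module.Flat.lTensor_preserves_injective_linearMap _ W.injective_subtype
      exact hx.2 (hinj (by rw [map_zero]; exact h0))
  intro v hv
  obtain ⟨s, u, hsu, hs, hu⟩ := exists_add_tendsto_of_not_hasEigenvalue hBA hAB hA ⟨v, hv⟩
  refine Submodule.mem_sup.mpr ⟨s, ⟨s.2, ?_⟩, u, ⟨u.2, ?_⟩, (congrArg Subtype.val hsu).symm⟩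
  · show Tendsto (fun n : ℕ => (T ^ n) (s : V)) atTop (𝓝 0)
    simp_rw [← hAn]
    exact (continuous_subtype_val.tendsto' (0 : W) (0 : V) rfl).comp hs
  · show Tendsto (fun n : ℕ => (T⁻¹ ^ n) (u : V)) atTop (𝓝 0)
    simp_rw [← hBn]
    exact (continuous_subtype_val.tendsto' (0 : W) (0 : V) rfl).comp hu

theorem IsHyperbolic.isCompl {T : V ≃L[ℝ] V} (hT : IsHyperbolic T) :
    IsCompl (contractedSubspace T) (contractedSubspace T⁻¹) := by
  refine ⟨disjoint_contractedSubspace_inv T, codisjoint_iff.mpr (eq_top_iff.mpr ?_)⟩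
  simpa using hT.le_sup (W := ⊤) (fun _ _ => trivial)

end Hyperbolic

/-! ### The contracted subgroup and its logarithms -/

section Contracted

variable {G : Type*} [TopologicalSpace G] [Group G] [IsTopologicalGroup G]

/-- The subgroup of elements contracted to `1` by the positive powers of `φ`. -/
def contractedSubgroup (φ : MulAut G) : Subgroup G where
  carrier := {x | Tendsto (fun n : ℕ => (φ ^ n) x) atTop (𝓝 1)}
  one_mem' := by simpa using tendsto_const_nhds
  mul_mem' {x y} hx hy := by
    simpa using Tendsto.mul (show Tendsto (fun n : ℕ => (φ ^ n) x) atTop (𝓝 1) from hx)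
      (show Tendsto (fun n : ℕ => (φ ^ n) y) atTop (𝓝 1) from hy)
  inv_mem' {x} hx := by
    simpa using Tendsto.inv (show Tendsto (fun n : ℕ => (φ ^ n) x) atTop (𝓝 1) from hx)

theorem mem_contractedSubgroup {φ : MulAut G} {x : G} :
    x ∈ contractedSubgroup φ ↔ Tendsto (fun n : ℕ => (φ ^ n) x) atTop (𝓝 1) := Iff.rfl

end Contracted

namespace ExpMap

variable {E : Type*} [NormedAddCommGroup E] [NormedSpace ℝ E]
  {G : Type*} [TopologicalSpace G] [Group G] {X : ExpMap E G}
  {φ : MulAut G} {T : E ≃L[ℝ] E}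

theorem inv_map_exp (hφ : ∀ v, φ (X.exp v) = X.exp (T v)) (v : E) :
    φ⁻¹ (X.exp v) = X.exp (T⁻¹ v) := by
  refine φ.injective ?_
  rw [MulAut.apply_inv_self, hφ, ← continuousLinearEquiv_mul_apply, mul_inv_cancel]
  rfl

theorem pow_map_exp (hφ : ∀ v, φ (X.exp v) = X.exp (T v)) (n : ℕ) (v : E) :
    (φ ^ n) (X.exp v) = X.exp ((T ^ n) v) := by
  induction n with
  | zero => rfl
  | succ n ih => rw [pow_succ', pow_succ', MulAut.mul_apply, ih, hφ]; rfl

/-- `exp` is only known to be injective near 0, so a logarithm of a φ-orbit is a T-orbit only while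
it stays near 0. -/
theorem exists_eq_pow_of_exp_succ (X : ExpMap E G) (T : E ≃L[ℝ] E) : ∃ r > 0, ∀ c : ℕ → E,
    (∀ n, c n ∈ ball (0 : E) r) → (∀ n, X.exp (c (n + 1)) = X.exp (T (c n))) →
      ∀ n, c n = (T ^ n) (c 0) := by
  have h1 : ∀ᶠ v in 𝓝 (0 : E), v ∈ X.chart.source ∧ T v ∈ X.chart.source := by
    have : Tendsto T (𝓝 0) (𝓝 0) := T.continuous.tendsto' _ _ (map_zero T)
    exact (eventually_mem_set.mpr X.source_mem_nhds).and (this.eventually_mem X.source_mem_nhds)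
  obtain ⟨r, hr, hb⟩ := Metric.eventually_nhds_iff_ball.mp h1
  refine ⟨r, hr, fun c hc hs n => ?_⟩
  induction n with
  | zero => rfl
  | succ n ih =>
    rw [X.injOn_exp (hb _ (hc _)).1 (hb _ (hc n)).2 (hs n), pow_succ', continuousLinearEquiv_mul_apply, ← ih]

theorem injOn_exp_contractedSubspace (hφ : ∀ v, φ (X.exp v) = X.exp (T v)) :
    InjOn X.exp (contractedSubspace T) := by
  intro v hv w hw h
  obtain ⟨n, h1, h2⟩ := ((Tendsto.eventually_mem (mem_contractedSubspace.mp hv)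
    X.source_mem_nhds).and (Tendsto.eventually_mem (mem_contractedSubspace.mp hw)
      X.source_mem_nhds)).exists
  exact (T ^ n).injective (X.injOn_exp h1 h2 (by rw [← pow_map_exp hφ, ← pow_map_exp hφ, h]))

variable [IsTopologicalGroup G]

theorem exp_mem_contractedSubgroup (hφ : ∀ v, φ (X.exp v) = X.exp (T v)) {v : E}
    (hv : v ∈ contractedSubspace T) : X.exp v ∈ contractedSubgroup φ := by
  rw [mem_contractedSubgroup]
  simp_rw [pow_map_exp hφ]
  exact X.tendsto_exp.comp hv

/-- From some N on the φ-orbit of x stays in the chart, so its logarithms form a T-orbit tending to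
0. Applying T⁻ᴺ to the first of them gives a logarithm of x. -/
theorem exists_exp_eq_of_mem_contractedSubgroup (hφ : ∀ v, φ (X.exp v) = X.exp (T v)) {x : G}
    (hx : x ∈ contractedSubgroup φ) : ∃ v ∈ contractedSubspace T, X.exp v = x := by
  obtain ⟨r, hr, hc⟩ := X.exists_eq_pow_of_exp_succ T
  have h1 := (X.tendsto_symm.comp (mem_contractedSubgroup.mp hx)).eventually_mem (ball_mem_nhds _ hr)
  have h2 := (mem_contractedSubgroup.mp hx).eventually_mem X.target_mem_nhds
  obtain ⟨N, hN⟩ := eventually_atTop.mp (h1.and h2)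
  let c : ℕ → E := fun k => X.chart.symm ((φ ^ (k + N)) x)
  have hexp : ∀ k, X.exp (c k) = (φ ^ (k + N)) x := fun k => X.exp_symm (hN _ (by omega)).2
  have h3 := hc c (fun k => (hN (k + N) (by omega)).1) fun k => by
    rw [hexp, ← hφ, hexp, ← MulAut.mul_apply, ← pow_succ', Nat.add_right_comm]
  have h4 : c 0 ∈ contractedSubspace T := by
    rw [mem_contractedSubspace]
    refine Tendsto.congr h3 ?_
    exact (tendsto_add_atTop_iff_nat N).mpr (X.tendsto_symm.comp (mem_contractedSubgroup.mp hx))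
  have h5 : ∀ n : ℕ, ((T⁻¹) ^ n) (c 0) ∈ contractedSubspace T := fun n => by
    induction n with
    | zero => exact h4
    | succ n ih =>
      rw [pow_succ', continuousLinearEquiv_mul_apply]; exact inv_map_mem_contractedSubspace ih
  refine ⟨(T⁻¹ ^ N) (c 0), h5 N, ?_⟩
  rw [← pow_map_exp (inv_map_exp hφ), hexp, zero_add, ← MulAut.mul_apply, inv_pow, inv_mul_cancel]
  rfl

variable [FiniteDimensional ℝ E]

/-- The uniform bound C on Tⁿ keeps the whole forward orbit of (a, b) small, so the logarithms of
φⁿ(exp a · exp b) form a T-orbit tending to 0. -/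
theorem exists_symm_exp_mul_exp_mem (hφ : ∀ v, φ (X.exp v) = X.exp (T v)) :
    ∃ δ > 0, ∀ a ∈ contractedSubspace T, ∀ b ∈ contractedSubspace T, ‖a‖ < δ → ‖b‖ < δ →
      X.exp a * X.exp b ∈ X.chart.target ∧
        X.chart.symm (X.exp a * X.exp b) ∈ contractedSubspace T := by
  obtain ⟨r, hr, hc⟩ := X.exists_eq_pow_of_exp_succ T
  obtain ⟨C, hC, hb⟩ := exists_norm_pow_le T
  have hlim : Tendsto (fun p : E × E => X.exp p.1 * X.exp p.2) (𝓝 0) (𝓝 1) := by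
    have hcont : Continuous (fun p : E × E => X.exp p.1 * X.exp p.2) := by
      have := X.continuous_exp; fun_prop
    exact hcont.tendsto' _ _ (by simp [X.exp_zero])
  obtain ⟨δ, hδ, hball⟩ := Metric.eventually_nhds_iff_ball.mp
    ((hlim.eventually_mem X.target_mem_nhds).and
      ((X.tendsto_symm.comp hlim).eventually_mem (ball_mem_nhds _ hr)))
  refine ⟨δ / C, by positivity, fun a ha b hb' hna hnb => ?_⟩
  have hmem : ∀ n : ℕ, ((T ^ n) a, (T ^ n) b) ∈ ball (0 : E × E) δ := fun n => by
    rw [mem_ball_zero_iff, Prod.norm_mk, max_lt_iff]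
    rw [lt_div_iff₀ hC] at hna hnb
    exact ⟨(hb a ha n).trans_lt (by linarith), (hb b hb' n).trans_lt (by linarith)⟩
  let c : ℕ → E := fun n => X.chart.symm (X.exp ((T ^ n) a) * X.exp ((T ^ n) b))
  have hexp : ∀ n, X.exp (c n) = (φ ^ n) (X.exp a * X.exp b) := fun n => by
    rw [X.exp_symm (hball _ (hmem n)).1, map_mul, pow_map_exp hφ, pow_map_exp hφ]
  have h3 := hc c (fun n => (hball _ (hmem n)).2) fun n => by
    rw [hexp, ← hφ, hexp, ← MulAut.mul_apply, ← pow_succ']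
  refine ⟨(hball _ (hmem 0)).1, ?_⟩
  show c 0 ∈ _
  rw [mem_contractedSubspace]
  refine Tendsto.congr h3 ?_
  have h4 : Tendsto (fun n : ℕ => ((T ^ n) a, (T ^ n) b)) atTop (𝓝 0) :=
    (mem_contractedSubspace.mp ha).prodMk_nhds (mem_contractedSubspace.mp hb')
  exact (X.tendsto_symm.comp hlim).comp h4

/-- The contracted subspace carries a topological group structure for which `exp` is a group
homomorphism. -/
theorem exists_group_contractedSubspace (hφ : ∀ v, φ (X.exp v) = X.exp (T v)) :
    ∃ _ : Group (contractedSubspace T), IsTopologicalGroup (contractedSubspace T) ∧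
      ∀ a b : contractedSubspace T, X.exp ((a * b : contractedSubspace T) : E) =
        X.exp (a : E) * X.exp (b : E) := by
  let e : contractedSubspace T ≃ contractedSubgroup φ := Equiv.ofBijective
    (fun a => ⟨X.exp a, exp_mem_contractedSubgroup hφ a.2⟩)
    ⟨fun a b h => Subtype.ext (injOn_exp_contractedSubspace hφ a.2 b.2 (congrArg Subtype.val h)),
      fun x => by
        obtain ⟨v, hv, h⟩ := exists_exp_eq_of_mem_contractedSubgroup hφ x.2
        exact ⟨⟨v, hv⟩, Subtype.ext h⟩⟩
  let inst : Group (contractedSubspace T) := e.group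
  have hmul : ∀ a b : contractedSubspace T, X.exp ((a * b : contractedSubspace T) : E) =
      X.exp (a : E) * X.exp (b : E) := fun a b =>
    congrArg Subtype.val (e.apply_symm_apply (e a * e b))
  have hone : X.exp ((1 : contractedSubspace T) : E) = 1 :=
    congrArg Subtype.val (e.apply_symm_apply 1)
  have hinv : ∀ a : contractedSubspace T, a⁻¹ = -a := fun a => by
    refine inv_eq_of_mul_eq_one_left (e.injective (Subtype.ext ?_))
    show X.exp ((-a * a : contractedSubspace T) : E) = X.exp ((1 : contractedSubspace T) : E)
    rw [hmul, hone, Submodule.coe_neg, X.exp_neg, inv_mul_cancel]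
  refine ⟨inst, ?_, hmul⟩
  obtain ⟨δ, hδ, hδm⟩ := exists_symm_exp_mul_exp_mem hφ
  have hTn : ∀ (n : ℕ) {v : E}, v ∈ contractedSubspace T → (T ^ n) v ∈ contractedSubspace T := by
    intro n v hv
    induction n with
    | zero => exact hv
    | succ n ih => rw [pow_succ', continuousLinearEquiv_mul_apply]; exact map_mem_contractedSubspace ih
  have hTin : ∀ (n : ℕ) {v : E}, v ∈ contractedSubspace T → (T⁻¹ ^ n) v ∈ contractedSubspace T := by
    intro n v hv
    induction n with
    | zero => exact hv
    | succ n ih =>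
      rw [pow_succ', continuousLinearEquiv_mul_apply]; exact inv_map_mem_contractedSubspace ih
  have hcm : ContinuousMul (contractedSubspace T) := by
    refine ⟨continuous_iff_continuousAt.mpr fun ⟨a₀, b₀⟩ => ?_⟩
    have h0 : ball (0 : E) δ ∈ 𝓝 (0 : E) := ball_mem_nhds _ hδ
    obtain ⟨n, hn1, hn2⟩ := ((Tendsto.eventually_mem (mem_contractedSubspace.mp a₀.2) h0).and
      (Tendsto.eventually_mem (mem_contractedSubspace.mp b₀.2) h0)).exists
    -- Near (a₀, b₀) the product is computed by contracting with Tⁿ into the chart, multiplying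
    -- there, and expanding back.
    let F : contractedSubspace T × contractedSubspace T → E := fun p =>
      (T⁻¹ ^ n) (X.chart.symm (X.exp ((T ^ n) (p.1 : E)) * X.exp ((T ^ n) (p.2 : E))))
    have hF : ∀ᶠ p in 𝓝 (a₀, b₀), ((p.1 * p.2 : contractedSubspace T) : E) = F p := by
      have o1 : ∀ᶠ p in 𝓝 (a₀, b₀), (T ^ n) (p.1 : E) ∈ ball (0 : E) δ :=
        (show Continuous fun p : contractedSubspace T × contractedSubspace T => (T ^ n) (p.1 : E) by
          fun_prop).continuousAt.eventually_mem (isOpen_ball.mem_nhds hn1)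
      have o2 : ∀ᶠ p in 𝓝 (a₀, b₀), (T ^ n) (p.2 : E) ∈ ball (0 : E) δ :=
        (show Continuous fun p : contractedSubspace T × contractedSubspace T => (T ^ n) (p.2 : E) by
          fun_prop).continuousAt.eventually_mem (isOpen_ball.mem_nhds hn2)
      filter_upwards [o1, o2] with p h1 h2
      rw [mem_ball_zero_iff] at h1 h2
      obtain ⟨g1, g2⟩ := hδm _ (hTn n p.1.2) _ (hTn n p.2.2) h1 h2
      refine injOn_exp_contractedSubspace hφ (p.1 * p.2).2 (hTin n g2) ?_
      rw [hmul, ← pow_map_exp (inv_map_exp hφ), X.exp_symm g1, map_mul, ← pow_map_exp hφ,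
        ← pow_map_exp hφ, inv_pow]
      simp
    have hFc : ContinuousAt F (a₀, b₀) := by
      rw [mem_ball_zero_iff] at hn1 hn2
      obtain ⟨g1, g2⟩ := hδm _ (hTn n a₀.2) _ (hTn n b₀.2) hn1 hn2
      refine (T⁻¹ ^ n).continuous.continuousAt.comp ?_
      refine ContinuousAt.comp (g := X.chart.symm) (X.chart.continuousAt_symm g1) ?_
      have := X.continuous_exp
      exact (show Continuous fun p : contractedSubspace T × contractedSubspace T =>
        X.exp ((T ^ n) (p.1 : E)) * X.exp ((T ^ n) (p.2 : E)) by fun_prop).continuousAt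
    rw [ContinuousAt, tendsto_subtype_rng]
    have h3 : Tendsto F (𝓝 (a₀, b₀)) (𝓝 ((a₀ * b₀ : contractedSubspace T) : E)) := by
      rw [hF.self_of_nhds]; exact hFc
    exact h3.congr' (hF.mono fun p hp => hp.symm)
  have hci : ContinuousInv (contractedSubspace T) := by
    refine ⟨?_⟩
    have : (fun a : contractedSubspace T => a⁻¹) = fun a => -a := funext hinv
    rw [this]; exact continuous_neg
  exact { }

end ExpMap

/-! ### The product decomposition of G -/

namespace LieExpMap

variable {E : Type*} [NormedAddCommGroup E] [NormedSpace ℝ E] [FiniteDimensional ℝ E]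
  {G : Type*} [TopologicalSpace G] [Group G] [IsTopologicalGroup G] (X : LieExpMap E G)
  {φ : MulAut G} {T : E ≃L[ℝ] E}

theorem sup_map_Ad_eq_top [Group.IsNilpotent G] (hφ : ∀ v, φ (X.exp v) = X.exp (T v))
    (hT : IsHyperbolic T) (g : G) :
    contractedSubspace T ⊔ (contractedSubspace T⁻¹).map (X.Ad g : E →ₗ[ℝ] E) = ⊤ := by
  have h1 : Disjoint (contractedSubspace T) ((contractedSubspace T⁻¹).map (X.Ad g : E →ₗ[ℝ] E)) :=
    X.disjoint_map_Ad (disjoint_contractedSubspace_inv T)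
      (fun k => hT.le_sup fun v hv => X.map_mem_unipotentSeries hφ k hv) g
  refine Submodule.eq_top_of_disjoint _ _ ?_ h1
  have h2 : Module.finrank ℝ ((contractedSubspace T⁻¹).map (X.Ad g : E →ₗ[ℝ] E)) =
      Module.finrank ℝ (contractedSubspace T⁻¹) :=
    LinearEquiv.finrank_map_eq (X.Ad g).toLinearEquiv _
  rw [h2, Submodule.finrank_add_eq_of_isCompl hT.isCompl]

/-- By transversality at g, each double coset S g U is a neighbourhood of g. Double cosets partition
G, so that of 1 is open and closed. -/
theorem exists_exp_mul_exp_eq [Group.IsNilpotent G] [PreconnectedSpace G]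
    (hφ : ∀ v, φ (X.exp v) = X.exp (T v)) (hT : IsHyperbolic T) (g : G) :
    ∃ a ∈ contractedSubspace T, ∃ b ∈ contractedSubspace T⁻¹, X.exp a * X.exp b = g := by
  set S := contractedSubgroup φ
  set U := contractedSubgroup φ⁻¹
  have hnhds : ∀ g : G, ∀ᶠ h in 𝓝 g, ∃ s ∈ S, ∃ u ∈ U, s * g * u = h := by
    intro g
    have h1 := X.nhds_one_le_map_exp_mul_exp _ _ (X.sup_map_Ad_eq_top hφ hT g)
    have h2 : ∀ᶠ h in 𝓝 (1 : G), ∃ s ∈ S, ∃ u ∈ U, s * g * u = h * g := by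
      refine h1 (mem_map.mpr (univ_mem' fun p => ?_))
      obtain ⟨b, hb, hpb⟩ := p.2.2
      refine ⟨X.exp p.1, ExpMap.exp_mem_contractedSubgroup hφ p.1.2, X.exp b,
        ExpMap.exp_mem_contractedSubgroup (ExpMap.inv_map_exp hφ) hb, ?_⟩
      have hpb' : X.Ad g b = (p.2 : E) := hpb
      show _ = X.exp p.1 * X.exp p.2 * g
      rw [← hpb', X.exp_Ad]
      group
    have h3 : Tendsto (fun h => h * g⁻¹) (𝓝 g) (𝓝 1) :=
      (continuous_mul_const g⁻¹).tendsto' _ _ (mul_inv_cancel g)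
    refine (h3.eventually h2).mono fun h hh => ?_
    simpa using hh
  let R : Set G := {h | ∃ s ∈ S, ∃ u ∈ U, s * 1 * u = h}
  have hRo : IsOpen R := by
    rw [isOpen_iff_mem_nhds]
    rintro _ ⟨s, hs, u, hu, rfl⟩
    filter_upwards [hnhds (s * 1 * u)] with h ⟨s', hs', u', hu', hh⟩
    exact ⟨s' * s, mul_mem hs' hs, u * u', mul_mem hu hu', by rw [← hh]; group⟩
  have hRc : IsClosed R := by
    rw [← isOpen_compl_iff, isOpen_iff_mem_nhds]
    intro g hg
    filter_upwards [hnhds g] with h ⟨s', hs', u', hu', hh⟩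
    rintro ⟨s, hs, u, hu, hsu⟩
    refine hg ⟨s'⁻¹ * s, mul_mem (inv_mem hs') hs, u * u'⁻¹, mul_mem hu (inv_mem hu'), ?_⟩
    rw [← hsu] at hh
    calc _ = s'⁻¹ * (s * 1 * u) * u'⁻¹ := by group
      _ = g := by rw [← hh]; group
  have hR : R = univ := IsClopen.eq_univ ⟨hRc, hRo⟩ ⟨1, 1, one_mem _, 1, one_mem _, by simp⟩
  obtain ⟨s, hs, u, hu, hsu⟩ := hR ▸ mem_univ g
  obtain ⟨a, ha, rfl⟩ := ExpMap.exists_exp_eq_of_mem_contractedSubgroup hφ hs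
  obtain ⟨b, hb, rfl⟩ := ExpMap.exists_exp_eq_of_mem_contractedSubgroup (ExpMap.inv_map_exp hφ) hu
  exact ⟨a, ha, b, hb, by simpa using hsu⟩

/-- The product decomposition of a simply connected nilpotent group into the contracted and the
expanded subgroup of a hyperbolic automorphism. -/
theorem isHomeomorph_exp_mul_exp [Group.IsNilpotent G] [SimplyConnectedSpace G]
    [LocallyPathConnectedSpace G]
    (hφ : ∀ v, φ (X.exp v) = X.exp (T v)) (hT : IsHyperbolic T) :
    IsHomeomorph (fun p : contractedSubspace T × contractedSubspace T⁻¹ =>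
      X.exp p.1 * X.exp p.2) := by
  have hφ' := ExpMap.inv_map_exp hφ
  obtain ⟨gS, tS, mS⟩ := ExpMap.exists_group_contractedSubspace hφ
  obtain ⟨gU, tU, mU⟩ := ExpMap.exists_group_contractedSubspace hφ'
  let eS : contractedSubspace T →* G := MonoidHom.mk' (fun a => X.exp a) mS
  let eU : contractedSubspace T⁻¹ →* G := MonoidHom.mk' (fun a => X.exp a) mU
  have hS1 : (1 : contractedSubspace T) = 0 := Subtype.ext
    (ExpMap.injOn_exp_contractedSubspace hφ (Subtype.mem _) (Subtype.mem _)
      ((map_one eS).trans X.exp_zero.symm))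
  have hU1 : (1 : contractedSubspace T⁻¹) = 0 := Subtype.ext
    (ExpMap.injOn_exp_contractedSubspace hφ' (Subtype.mem _) (Subtype.mem _)
      ((map_one eU).trans X.exp_zero.symm))
  have hUi : ∀ b : contractedSubspace T⁻¹, b⁻¹ = -b := fun b => Subtype.ext
    (ExpMap.injOn_exp_contractedSubspace hφ' (Subtype.mem _) (Subtype.mem _)
      ((map_inv eU b).trans (X.exp_neg b).symm))
  -- The inverse makes Φ the orbit map of 1 for (s, u) · g = s g u⁻¹, so its fibres are the left
  -- cosets of the stabiliser D. Inversion on the second factor converts it back to Ψ.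
  let Φ : contractedSubspace T × contractedSubspace T⁻¹ → G := fun p => eS p.1 * (eU p.2)⁻¹
  let Ψ : contractedSubspace T × contractedSubspace T⁻¹ → G := fun p => X.exp p.1 * X.exp p.2
  let ν : contractedSubspace T × contractedSubspace T⁻¹ ≃ₜ
      contractedSubspace T × contractedSubspace T⁻¹ :=
    (Homeomorph.refl _).prodCongr (Homeomorph.inv _)
  have hΦΨ : Φ = Ψ ∘ ν := funext fun p => congrArg (X.exp p.1 * ·) (map_inv eU p.2).symm
  have hΨc : Continuous Ψ := by
    have := X.continuous_exp; fun_prop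
  have hΦc : Continuous Φ := by rw [hΦΨ]; exact hΨc.comp ν.continuous
  have hν1 : ν (1, 1) = (0, 0) := by
    show ((1 : contractedSubspace T), (1 : contractedSubspace T⁻¹)⁻¹) = _
    rw [inv_one, hS1, hU1]
  have hΦ1 : Φ 1 = 1 := by simp [Φ]
  have hopen1 : 𝓝 (1 : G) ≤ map Φ (𝓝 1) := by
    rw [hΦΨ, ← map_map, show (1 : contractedSubspace T × contractedSubspace T⁻¹) = (1, 1) from rfl,
      ν.map_nhds_eq, hν1]
    exact X.nhds_one_le_map_exp_mul_exp _ _ (codisjoint_iff.mp hT.isCompl.codisjoint)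
  have hopen : IsOpenMap Φ := by
    rw [isOpenMap_iff_nhds_le]
    intro p
    have h1 : Φ ∘ (p * ·) = (fun g => eS p.1 * g * (eU p.2)⁻¹) ∘ Φ := funext fun q => by
      simp only [Φ, Function.comp, Prod.fst_mul, Prod.snd_mul, map_mul]; group
    have h2 : map (fun g => eS p.1 * g * (eU p.2)⁻¹) (𝓝 1) = 𝓝 (Φ p) := by
      have h := ((Homeomorph.mulLeft (eS p.1)).trans
        (Homeomorph.mulRight (eU p.2)⁻¹)).map_nhds_eq 1
      rw [show ((Homeomorph.mulLeft (eS p.1)).trans (Homeomorph.mulRight (eU p.2)⁻¹)) 1 = Φ p by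
        simp [Φ]] at h
      exact h
    calc 𝓝 (Φ p) = map (fun g => eS p.1 * g * (eU p.2)⁻¹) (𝓝 1) := h2.symm
      _ ≤ map (fun g => eS p.1 * g * (eU p.2)⁻¹) (map Φ (𝓝 1)) := map_mono hopen1
      _ = map Φ (map (p * ·) (𝓝 1)) := by rw [map_map, map_map, h1]
      _ = map Φ (𝓝 p) := by rw [map_mul_left_nhds_one]
  have hsurj : Function.Surjective Φ := fun g => by
    obtain ⟨a, ha, b, hb, hab⟩ := X.exists_exp_mul_exp_eq hφ hT g
    refine ⟨(⟨a, ha⟩, (⟨b, hb⟩)⁻¹), ?_⟩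
    simp only [Φ, map_inv, inv_inv]
    exact hab
  let D : Subgroup (contractedSubspace T × contractedSubspace T⁻¹) :=
    MonoidHom.eqLocus (eS.comp (MonoidHom.fst _ _)) (eU.comp (MonoidHom.snd _ _))
  have hD : IsDiscrete (D : Set (contractedSubspace T × contractedSubspace T⁻¹)) := by
    obtain ⟨N, hN, hinj⟩ := X.exists_injOn_exp_mul_exp _ _ hT.isCompl
    have hN' : ν ⁻¹' N ∈ 𝓝 (1 : contractedSubspace T × contractedSubspace T⁻¹) := by
      refine ν.continuous.continuousAt ?_
      rw [show ν 1 = (0, 0) from hν1]; exact hN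
    refine ⟨show DiscreteTopology D from discreteTopology_of_isOpen_singleton_one ?_⟩
    rw [isOpen_singleton_iff_nhds_eq_pure]
    refine le_antisymm ?_ (pure_le_nhds _)
    rw [le_pure_iff, nhds_subtype, mem_comap]
    refine ⟨_, hN', fun d hd => ?_⟩
    have h1 : Φ d = 1 := by
      have : eS (d : contractedSubspace T × contractedSubspace T⁻¹).1 = eU d.1.2 := d.2
      simp only [Φ, this, mul_inv_cancel]
    have h2 := hinj hd (show 1 ∈ ν ⁻¹' N from mem_of_mem_nhds hN') (by
      have h3 : Ψ (ν d) = Ψ (ν 1) := by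
        rw [hΦΨ] at h1 hΦ1
        exact h1.trans hΦ1.symm
      exact h3)
    exact Subtype.ext (ν.injective h2)
  have hcov : IsCoveringMap Φ :=
    ((hopen.isQuotientMap hΦc hsurj).isQuotientCoveringMap_of_subgroupOp D hD (by
      intro p q
      have : p⁻¹ * q ∈ D ↔ (eS p.1)⁻¹ * eS q.1 = (eU p.2)⁻¹ * eU q.2 := by
        simp only [D, MonoidHom.eqLocus, ← map_inv, ← map_mul]
        rfl
      rw [this]
      simp only [Φ]
      constructor
      · intro h
        rw [inv_mul_eq_iff_eq_mul, ← mul_assoc, h]; group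
      · intro h
        rw [inv_mul_eq_iff_eq_mul] at h
        rw [h]; group)).isCoveringMap
  -- Simple connectedness lifts the identity of G to a section σ. Uniqueness of lifts on the
  -- connected domain gives σ ∘ Φ = id.
  obtain ⟨σ, ⟨hσ1, hσ⟩, -⟩ := hcov.existsUnique_continuousMap_lifts (ContinuousMap.id G) (1 : G)
    (1 : contractedSubspace T × contractedSubspace T⁻¹) hΦ1
  have hσΦ : σ ∘ Φ = id := by
    refine hcov.eq_of_comp_eq (σ.continuous.comp hΦc) continuous_id ?_ 1 ?_
    · rw [← Function.comp_assoc, hσ]; rfl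
    · simp only [Function.comp, hΦ1, hσ1, id]
  have hΦh : IsHomeomorph Φ := ⟨hΦc, hopen,
    (Function.LeftInverse.injective (g := σ) fun p => congrFun hσΦ p), hsurj⟩
  have hΨΦ : Ψ = Φ ∘ ν.symm := by rw [hΦΨ, Function.comp_assoc, ν.self_comp_symm]; rfl
  show IsHomeomorph Ψ
  rw [hΨΦ]
  exact hΦh.comp ν.symm.isHomeomorph

end LieExpMap

/-! ### Commutators modulo the descending central series -/

section CentralSeries

variable {G : Type*} [Group G] {j : ℕ}

variable (G j) in
/-- The projection from `G` to its quotient by the `(j+1)`-st term of the descending central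
series, in which the `j`-th term becomes central. -/
abbrev centralMk : G →* G ⧸ centralSeries G (j + 1) := QuotientGroup.mk' _

theorem centralMk_eq_one {x : G} : centralMk G j x = 1 ↔ x ∈ centralSeries G (j + 1) :=
  QuotientGroup.eq_one_iff x

theorem centralMk_eq {x y : G} :
    centralMk G j x = centralMk G j y ↔ x⁻¹ * y ∈ centralSeries G (j + 1) :=
  QuotientGroup.eq

theorem centralSeries_succ_le : centralSeries G (j + 1) ≤ centralSeries G j :=
  Subgroup.lowerCentralSeries_antitone _ j.le_succ

theorem commutator_mem_centralSeries {x : G} (hx : x ∈ centralSeries G j) (g : G) :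
    ⁅x, g⁆ ∈ centralSeries G (j + 1) :=
  Subgroup.commutator_mem_commutator hx (Subgroup.mem_top g)

theorem commute_centralMk {x : G} (hx : x ∈ centralSeries G j) (q : G ⧸ centralSeries G (j + 1)) :
    Commute (centralMk G j x) q := by
  obtain ⟨g, rfl⟩ := QuotientGroup.mk'_surjective _ q
  rw [← commutatorElement_eq_one_iff_commute, ← map_commutatorElement, centralMk_eq_one]
  exact commutator_mem_centralSeries hx g

theorem mem_centralSeries_of_centralMk_eq {x y : G} (h : centralMk G j x = centralMk G j y)
    (hx : x ∈ centralSeries G j) : y ∈ centralSeries G j := by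
  simpa using mul_mem hx (centralSeries_succ_le (centralMk_eq.mp h))

/-- Commutators with x in C_j are central modulo C_{j+2}. This and the next two lemmas make the
commutator a bilinear pairing of C_j/C_{j+1} and G into C_{j+1}/C_{j+2}. -/
theorem centralMk_commutator_mul_right {x : G} (hx : x ∈ centralSeries G j) (g h : G) :
    centralMk G (j + 1) ⁅x, g * h⁆ = centralMk G (j + 1) ⁅x, g⁆ * centralMk G (j + 1) ⁅x, h⁆ := by
  have h1 : ⁅x, g * h⁆ = ⁅x, g⁆ * (g * ⁅x, h⁆ * g⁻¹) := by simp only [commutatorElement_def]; group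
  rw [h1, map_mul, map_mul, map_mul, ← (commute_centralMk (commutator_mem_centralSeries hx h) _).eq,
    mul_assoc (centralMk G (j + 1) ⁅x, h⁆), ← map_mul, mul_inv_cancel, map_one, mul_one]

theorem centralMk_commutator_mul_left {x y : G} (hy : y ∈ centralSeries G j) (g : G) :
    centralMk G (j + 1) ⁅x * y, g⁆ = centralMk G (j + 1) ⁅x, g⁆ * centralMk G (j + 1) ⁅y, g⁆ := by
  have h1 : ⁅x * y, g⁆ = x * ⁅y, g⁆ * x⁻¹ * ⁅x, g⁆ := by simp only [commutatorElement_def]; group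
  have hc := commute_centralMk (commutator_mem_centralSeries hy g)
  rw [h1, map_mul, map_mul, map_mul, ← (hc _).eq, mul_assoc (centralMk G (j + 1) ⁅y, g⁆),
    ← map_mul, mul_inv_cancel, map_one, mul_one, (hc _).eq]

theorem centralMk_commutator_congr {x y : G} (h : centralMk G j x = centralMk G j y) (g : G) :
    centralMk G (j + 1) ⁅x, g⁆ = centralMk G (j + 1) ⁅y, g⁆ := by
  have h1 : x⁻¹ * y ∈ centralSeries G (j + 1) := centralMk_eq.mp h
  have h2 := centralMk_commutator_mul_left (x := x) (centralSeries_succ_le h1) g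
  rw [mul_inv_cancel_left, centralMk_eq_one.mpr (commutator_mem_centralSeries h1 g), mul_one] at h2
  exact h2.symm

theorem map_mem_centralSeries (φ : MulAut G) {x : G} (hx : x ∈ centralSeries G j) :
    φ x ∈ centralSeries G j := by
  have h : (centralSeries G j).map φ.toMonoidHom = centralSeries G j :=
    Subgroup.characteristic_iff_map_eq.mp inferInstance φ
  rw [← h]
  exact Subgroup.mem_map_of_mem _ hx

end CentralSeries

/-! ### Tangent spaces of the central series -/

namespace ExpMap

variable {E : Type*} [NormedAddCommGroup E] [NormedSpace ℝ E]
  {G : Type*} [TopologicalSpace G] [Group G] [IsTopologicalGroup G] {X : ExpMap E G} {j : ℕ}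

theorem isClosed_centralMk_eq (hN : IsClosed (centralSeries G (j + 1) : Set G)) (g : G) :
    IsClosed {x : G | centralMk G j g = centralMk G j x} := by
  simp_rw [centralMk_eq]
  exact hN.preimage (continuous_const_mul g⁻¹)

theorem centralMk_exp_add_of_pow (hN : IsClosed (centralSeries G (j + 1) : Set G)) {v w : E} {g : G}
    (h : ∀ n : ℕ, n ≠ 0 →
      centralMk G j (X.exp ((n : ℝ)⁻¹ • v) * X.exp ((n : ℝ)⁻¹ • w)) ^ n = centralMk G j g) :
    centralMk G j (X.exp (v + w)) = centralMk G j g := by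
  refine (X.exp_add_mem_of_pow_mem (isClosed_centralMk_eq hN g) fun n hn => ?_).symm
  rw [mem_ofPred_eq, map_pow, h n hn]

/-- exp(v/n) is central modulo C_{j+1}, so there the Trotter powers equal exp v · exp w for every n.
-/
theorem centralMk_exp_add (hN : IsClosed (centralSeries G (j + 1) : Set G)) {v : E}
    (hv : ∀ t : ℝ, X.exp (t • v) ∈ centralSeries G j) (w : E) :
    centralMk G j (X.exp (v + w)) = centralMk G j (X.exp v) * centralMk G j (X.exp w) := by
  rw [← map_mul]
  refine centralMk_exp_add_of_pow hN fun n hn => ?_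
  rw [map_mul, (commute_centralMk (hv _) _).mul_pow, ← map_pow, ← map_pow,
    X.exp_inv_nat_smul_pow hn, X.exp_inv_nat_smul_pow hn, map_mul]

variable (X) in
/-- The Lie algebra of the `j`-th term of the descending central series. -/
def centralTangent (hN : IsClosed (centralSeries G (j + 1) : Set G)) : Submodule ℝ E where
  carrier := {v | ∀ t : ℝ, X.exp (t • v) ∈ centralSeries G j}
  zero_mem' t := by rw [smul_zero, X.exp_zero]; exact one_mem _
  add_mem' {v w} hv hw t := by
    have h := centralMk_exp_add hN (X := X) (v := t • v) (fun s => by rw [smul_smul]; exact hv _)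
      (t • w)
    rw [smul_add]
    rw [← map_mul] at h
    exact mem_centralSeries_of_centralMk_eq h.symm (mul_mem (hv t) (hw t))
  smul_mem' c v hv t := by rw [smul_smul]; exact hv _

variable {hN : IsClosed (centralSeries G (j + 1) : Set G)}

theorem exp_mem_centralSeries {v : E} (hv : v ∈ X.centralTangent hN) :
    X.exp v ∈ centralSeries G j := by
  simpa using hv 1

theorem map_mem_centralTangent {φ : MulAut G} {T : E ≃L[ℝ] E}
    (hφ : ∀ v, φ (X.exp v) = X.exp (T v)) {v : E} (hv : v ∈ X.centralTangent hN) :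
    T v ∈ X.centralTangent hN := fun t => by
  rw [← map_smul, ← hφ]; exact map_mem_centralSeries φ (hv t)

/-- If `exp a` agrees modulo the next term of the central series with `exp v` for a tangent vector
`v`, and roots of elements of the contracted subgroup lying in the next term stay there,
then `a` is a tangent vector. -/
theorem mem_centralTangent_of_centralMk_eq {φ : MulAut G} {T : E ≃L[ℝ] E}
    (hφ : ∀ v, φ (X.exp v) = X.exp (T v))
    (hroot : ∀ ζ ∈ contractedSubspace T, X.exp ζ ∈ centralSeries G (j + 1) →
      ∀ t : ℝ, X.exp (t • ζ) ∈ centralSeries G (j + 1))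
    {a v : E} (ha : a ∈ contractedSubspace T) (hv : v ∈ contractedSubspace T)
    (hvt : v ∈ X.centralTangent hN)
    (h : centralMk G j (X.exp a) = centralMk G j (X.exp v)) : a ∈ X.centralTangent hN := by
  let α : E → Multiplicative ℝ →* G := fun u => MonoidHom.mk' (fun t => X.exp (t.toAdd • u))
    fun s t => X.map_add_smul _ _ _
  let D : Subgroup (Multiplicative ℝ) := MonoidHom.eqLocus
    ((centralMk G j).comp (α a)) ((centralMk G j).comp (α v))
  have hD : ∀ t : ℝ, Multiplicative.ofAdd t ∈ D ↔
      centralMk G j (X.exp (t • a)) = centralMk G j (X.exp (t • v)) := fun t => Iff.rfl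
  have hinv : ∀ n : ℕ, n ≠ 0 → Multiplicative.ofAdd ((n : ℝ)⁻¹) ∈ D := by
    intro n hn
    rw [hD]
    have hx := exp_mem_contractedSubgroup hφ (Submodule.smul_mem _ (n : ℝ)⁻¹ ha)
    have hy := exp_mem_contractedSubgroup hφ (Submodule.smul_mem _ (n : ℝ)⁻¹ hv)
    obtain ⟨ζ, hζ, he⟩ := exists_exp_eq_of_mem_contractedSubgroup hφ (mul_mem (inv_mem hx) hy)
    -- Since exp(v/n) is central modulo C_{j+1}, the n-th power of exp(a/n)⁻¹ exp(v/n) = exp ζ is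
    -- exp(a)⁻¹ exp v, which is trivial there; `hroot` then puts exp ζ itself into C_{j+1}. So exp(t
    -- a) and exp(t v) agree for t = 1/n, hence for rational and, by closedness, real t.
    have h1 : X.exp ((n : ℝ) • ζ) ∈ centralSeries G (j + 1) := by
      rw [X.exp_nsmul, he, ← centralMk_eq_one, map_pow, map_mul,
        ((commute_centralMk (hvt _) _).symm).mul_pow, map_inv, inv_pow, ← map_pow, ← map_pow,
        X.exp_inv_nat_smul_pow hn, X.exp_inv_nat_smul_pow hn, h, inv_mul_cancel]
    have h2 := hroot _ (Submodule.smul_mem _ _ hζ) h1 (n : ℝ)⁻¹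
    rw [smul_smul, inv_mul_cancel₀ (by exact_mod_cast hn), one_smul, he] at h2
    exact centralMk_eq.mpr h2
  have hrat : ∀ q : ℚ, Multiplicative.ofAdd (q : ℝ) ∈ D := fun q => by
    have := D.zpow_mem (hinv q.den q.den_nz) q.num
    rwa [← ofAdd_zsmul, zsmul_eq_mul, ← div_eq_mul_inv, ← Rat.cast_def] at this
  have hclosed : IsClosed {t : ℝ | Multiplicative.ofAdd t ∈ D} := by
    simp_rw [hD, centralMk_eq]
    refine hN.preimage ?_
    have := X.continuous_exp
    fun_prop
  intro t
  have ht : Multiplicative.ofAdd t ∈ D := by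
    have h1 : closure (range ((↑) : ℚ → ℝ)) ⊆ {t : ℝ | Multiplicative.ofAdd t ∈ D} :=
      closure_minimal (by rintro _ ⟨q, rfl⟩; exact hrat q) hclosed
    rw [Rat.denseRange_cast.closure_range] at h1
    exact h1 (mem_univ t)
  exact mem_centralSeries_of_centralMk_eq ((hD t).mp ht).symm (hvt t)

end ExpMap

namespace LieExpMap

variable {E : Type*} [NormedAddCommGroup E] [NormedSpace ℝ E]
  {G : Type*} [TopologicalSpace G] [Group G] [IsTopologicalGroup G] {X : LieExpMap E G} {j : ℕ}

/-- The Trotter factors for Ad x v and -v multiply to ⁅x, exp(v/n)⁆, whose n-th power is ⁅x, exp v⁆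
modulo C_{j+2} by bilinearity. -/
theorem centralMk_exp_Ad_sub (hN : IsClosed (centralSeries G (j + 1 + 1) : Set G)) {x : G}
    (hx : x ∈ centralSeries G j) (v : E) :
    centralMk G (j + 1) (X.exp (X.Ad x v - v)) = centralMk G (j + 1) ⁅x, X.exp v⁆ := by
  let β : G →* G ⧸ centralSeries G (j + 1 + 1) :=
    MonoidHom.mk' (fun g => centralMk G (j + 1) ⁅x, g⁆) (centralMk_commutator_mul_right hx)
  rw [sub_eq_add_neg]
  refine ExpMap.centralMk_exp_add_of_pow hN fun n hn => ?_
  have h1 : X.exp ((n : ℝ)⁻¹ • X.Ad x v) * X.exp ((n : ℝ)⁻¹ • -v) =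
      ⁅x, X.exp ((n : ℝ)⁻¹ • v)⁆ := by
    rw [X.exp_smul_Ad, smul_neg, X.exp_neg, commutatorElement_def]
  rw [h1]
  show β _ ^ n = β _
  rw [← map_pow, X.exp_inv_nat_smul_pow hn]

theorem Ad_sub_mem_centralTangent {hN : IsClosed (centralSeries G (j + 1 + 1) : Set G)} {x : G}
    (hx : x ∈ centralSeries G j) (v : E) : X.Ad x v - v ∈ X.centralTangent hN := fun t => by
  rw [smul_sub, ← map_smul]
  exact mem_centralSeries_of_centralMk_eq (centralMk_exp_Ad_sub hN hx (t • v)).symm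
    (commutator_mem_centralSeries hx _)

theorem centralMk_exp_sub_Ad (hN : IsClosed (centralSeries G (j + 1 + 1) : Set G)) {v : E}
    (hv : ∀ t : ℝ, X.exp (t • v) ∈ centralSeries G j) (g : G) :
    centralMk G (j + 1) (X.exp (v - X.Ad g v)) = centralMk G (j + 1) ⁅X.exp v, g⁆ := by
  rw [sub_eq_add_neg]
  refine ExpMap.centralMk_exp_add_of_pow hN fun n hn => ?_
  have h1 : X.exp ((n : ℝ)⁻¹ • v) * X.exp ((n : ℝ)⁻¹ • -X.Ad g v) =
      ⁅X.exp ((n : ℝ)⁻¹ • v), g⁆ := by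
    rw [smul_neg, X.exp_neg, X.exp_smul_Ad, commutatorElement_def]; group
  have h2 : ∀ m : ℕ, centralMk G (j + 1) ⁅X.exp ((n : ℝ)⁻¹ • v), g⁆ ^ m =
      centralMk G (j + 1) ⁅X.exp ((n : ℝ)⁻¹ • v) ^ m, g⁆ := fun m => by
    induction m with
    | zero => rw [pow_zero, pow_zero, commutatorElement_one_left, map_one]
    | succ m ih => rw [pow_succ, pow_succ, centralMk_commutator_mul_left (hv _), ih]
  rw [h1, h2, X.exp_inv_nat_smul_pow hn]

theorem sub_Ad_mem_centralTangent {hN : IsClosed (centralSeries G (j + 1 + 1) : Set G)} {v : E}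
    (hv : ∀ t : ℝ, X.exp (t • v) ∈ centralSeries G j) (g : G) :
    v - X.Ad g v ∈ X.centralTangent hN := fun t => by
  rw [smul_sub, ← map_smul]
  have hv' : ∀ s : ℝ, X.exp (s • t • v) ∈ centralSeries G j := fun s => by
    rw [smul_smul]; exact hv _
  exact mem_centralSeries_of_centralMk_eq (centralMk_exp_sub_Ad hN hv' g).symm
    (commutator_mem_centralSeries (hv t) _)

/-- The subgroup of elements that agree modulo the next term of the central series with the
exponential of an element of `L`. -/
def expSubgroup (hN : IsClosed (centralSeries G (j + 1) : Set G)) (L : Submodule ℝ E)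
    (hL : L ≤ X.centralTangent hN) : Subgroup G where
  carrier := {g | ∃ v ∈ L, centralMk G j (X.exp v) = centralMk G j g}
  one_mem' := ⟨0, L.zero_mem, by rw [X.exp_zero]⟩
  mul_mem' := by
    rintro x y ⟨v, hv, h⟩ ⟨w, hw, h'⟩
    exact ⟨v + w, L.add_mem hv hw, by rw [ExpMap.centralMk_exp_add hN (hL hv), h, h', map_mul]⟩
  inv_mem' := by
    rintro x ⟨v, hv, h⟩
    exact ⟨-v, L.neg_mem hv, by rw [X.exp_neg, map_inv, h, map_inv]⟩

/-- `[C_j, G]` is generated by commutators with exponentials. -/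
theorem centralSeries_le_expSubgroup {hN : IsClosed (centralSeries G (j + 1 + 1) : Set G)}
    {L : Submodule ℝ E} (hL : L ≤ X.centralTangent hN)
    (hG : ∀ g, ∃ a b, X.exp a * X.exp b = g)
    (h : ∀ x ∈ centralSeries G j, ∀ v, ∃ w ∈ L,
      centralMk G (j + 1) (X.exp w) = centralMk G (j + 1) ⁅x, X.exp v⁆) :
    centralSeries G (j + 1) ≤ expSubgroup hN L hL := by
  refine (Subgroup.commutator_le).mpr fun x hx g _ => ?_
  obtain ⟨a, b, rfl⟩ := hG g
  obtain ⟨u, hu, h1⟩ := h x hx a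
  obtain ⟨w, hw, h2⟩ := h x hx b
  exact ⟨u + w, L.add_mem hu hw, by
    rw [ExpMap.centralMk_exp_add hN (hL hu), h1, h2, centralMk_commutator_mul_right hx]⟩

theorem exists_centralMk_exp_eq (hN : IsClosed (centralSeries G (j + 1) : Set G))
    (hG : ∀ g, ∃ a b, X.exp a * X.exp b = g) {g : G} (hg : g ∈ centralSeries G j) :
    ∃ v ∈ X.centralTangent hN, centralMk G j (X.exp v) = centralMk G j g := by
  cases j with
  | zero =>
    have hmem : ∀ v, v ∈ X.centralTangent hN := fun v t => Subgroup.mem_top _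
    obtain ⟨a, b, rfl⟩ := hG g
    exact ⟨a + b, hmem _, by rw [ExpMap.centralMk_exp_add hN (hmem a), map_mul]⟩
  | succ j =>
    exact centralSeries_le_expSubgroup le_rfl hG (fun x hx v =>
      ⟨_, Ad_sub_mem_centralTangent hx v, centralMk_exp_Ad_sub hN hx v⟩) hg

variable [FiniteDimensional ℝ E] {φ : MulAut G} {T : E ≃L[ℝ] E}

/-- Modulo C_{j+1}, exp a · exp b is exp s · exp u with s and u tangent to C_j. Then exp(s)⁻¹ exp a
and exp b exp(u)⁻¹ multiply into C_{j+1}, so by the hypothesis for C_{j+1} each lies there. Thus exp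
a and exp b agree with exp s and exp u modulo C_{j+1}, which lets a and b inherit tangency. -/
theorem centralSeries_split_of_succ (hN : IsClosed (centralSeries G (j + 1) : Set G))
    (hφ : ∀ v, φ (X.exp v) = X.exp (T v)) (hT : IsHyperbolic T)
    (hG : ∀ g, ∃ a b, X.exp a * X.exp b = g)
    (hsplit : ∀ a ∈ contractedSubspace T, ∀ b ∈ contractedSubspace T⁻¹,
      X.exp a * X.exp b ∈ centralSeries G (j + 1) →
        (∀ t : ℝ, X.exp (t • a) ∈ centralSeries G (j + 1)) ∧
          ∀ t : ℝ, X.exp (t • b) ∈ centralSeries G (j + 1))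
    {a b : E} (ha : a ∈ contractedSubspace T) (hb : b ∈ contractedSubspace T⁻¹)
    (hab : X.exp a * X.exp b ∈ centralSeries G j) :
    a ∈ X.centralTangent hN ∧ b ∈ X.centralTangent hN := by
  have hφ' := ExpMap.inv_map_exp hφ
  obtain ⟨v, hv, hvg⟩ := exists_centralMk_exp_eq hN hG hab
  obtain ⟨s, ⟨hs, hsS⟩, u, ⟨hu, huU⟩, rfl⟩ := Submodule.mem_sup.mp
    (hT.le_sup (fun v hv => ExpMap.map_mem_centralTangent hφ hv) hv)
  rw [ExpMap.centralMk_exp_add hN hs, map_mul] at hvg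
  obtain ⟨a', ha', hea⟩ := ExpMap.exists_exp_eq_of_mem_contractedSubgroup hφ
    (mul_mem (inv_mem (ExpMap.exp_mem_contractedSubgroup hφ hsS))
      (ExpMap.exp_mem_contractedSubgroup hφ ha))
  obtain ⟨b', hb', heb⟩ := ExpMap.exists_exp_eq_of_mem_contractedSubgroup hφ'
    (mul_mem (ExpMap.exp_mem_contractedSubgroup hφ' hb)
      (inv_mem (ExpMap.exp_mem_contractedSubgroup hφ' huU)))
  have h1 : X.exp a' * X.exp b' ∈ centralSeries G (j + 1) := by
    rw [hea, heb, ← centralMk_eq_one]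
    simp only [map_mul, map_inv]
    rw [mul_assoc, ← mul_assoc (centralMk G j (X.exp a)), ← hvg]
    group
  obtain ⟨h2, h3⟩ := hsplit _ ha' _ hb' h1
  have h2' := h2 1
  have h3' := h3 1
  rw [one_smul, hea, ← centralMk_eq] at h2'
  rw [one_smul, heb, ← centralMk_eq_one, map_mul, map_inv, mul_inv_eq_one] at h3'
  constructor
  · refine ExpMap.mem_centralTangent_of_centralMk_eq hφ (fun ζ hζ h => ?_) ha hsS hs h2'.symm
    exact (hsplit ζ hζ 0 (zero_mem _) (by rwa [X.exp_zero, mul_one])).1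
  · refine ExpMap.mem_centralTangent_of_centralMk_eq hφ' (fun ζ hζ h => ?_) hb huU hu h3'
    exact (hsplit 0 (zero_mem _) ζ hζ (by rwa [X.exp_zero, one_mul])).2

/-- The terms of the descending central series are closed and split into their contracted and
expanded parts. -/
theorem isClosed_centralSeries_and_split [Group.IsNilpotent G] [T1Space G]
    (hφ : ∀ v, φ (X.exp v) = X.exp (T v)) (hT : IsHyperbolic T)
    (hΨ : IsHomeomorph (fun p : contractedSubspace T × contractedSubspace T⁻¹ =>
      X.exp p.1 * X.exp p.2)) (j : ℕ) :
    IsClosed (centralSeries G j : Set G) ∧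
      ∀ a ∈ contractedSubspace T, ∀ b ∈ contractedSubspace T⁻¹,
        X.exp a * X.exp b ∈ centralSeries G j →
          (∀ t : ℝ, X.exp (t • a) ∈ centralSeries G j) ∧
            ∀ t : ℝ, X.exp (t • b) ∈ centralSeries G j := by
  obtain ⟨c, hc⟩ := Subgroup.nilpotent_iff_lowerCentralSeries.mp ‹Group.IsNilpotent G›
  have hbot : ∀ k, c ≤ k → centralSeries G k = ⊥ := fun k hk =>
    le_bot_iff.mp (hc ▸ Subgroup.lowerCentralSeries_antitone _ hk)
  have hG : ∀ g, ∃ a b, X.exp a * X.exp b = g := fun g => by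
    obtain ⟨p, hp⟩ := hΨ.surjective g
    exact ⟨_, _, hp⟩
  suffices h : ∀ k j, c ≤ j + k → IsClosed (centralSeries G j : Set G) ∧
      ∀ a ∈ contractedSubspace T, ∀ b ∈ contractedSubspace T⁻¹,
        X.exp a * X.exp b ∈ centralSeries G j →
          (∀ t : ℝ, X.exp (t • a) ∈ centralSeries G j) ∧
            ∀ t : ℝ, X.exp (t • b) ∈ centralSeries G j from h c j (by omega)
  intro k
  induction k with
  | zero =>
    intro j hj
    rw [hbot j (by omega)]
    refine ⟨by simp, fun a ha b hb hab => ?_⟩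
    have h1 := hΨ.injective (a₁ := (⟨a, ha⟩, ⟨b, hb⟩)) (a₂ := (0, 0)) (by
      simpa [X.exp_zero] using hab)
    obtain ⟨h2, h3⟩ := Prod.mk.inj h1
    rw [show a = 0 from congrArg Subtype.val h2, show b = 0 from congrArg Subtype.val h3]
    simp [X.exp_zero]
  | succ k ih =>
    intro j hj
    obtain ⟨hN, hs⟩ := ih (j + 1) (by omega)
    have hsplit := fun a ha b hb hab =>
      centralSeries_split_of_succ (X := X) (a := a) (b := b) hN hφ hT hG hs ha hb hab
    refine ⟨?_, hsplit⟩
    let e := hΨ.homeomorph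
    have hV : IsClosed (X.centralTangent hN : Set E) := Submodule.closed_of_finiteDimensional _
    -- In product coordinates C_j is cut out by linear conditions, hence closed.
    have hset : (centralSeries G j : Set G) = e.symm ⁻¹' {p | (p.1 : E) ∈ X.centralTangent hN ∧
        (p.2 : E) ∈ X.centralTangent hN} := by
      ext g
      have hg : X.exp (e.symm g).1 * X.exp (e.symm g).2 = g := e.apply_symm_apply g
      constructor
      · intro h
        refine hsplit _ (Subtype.mem _) _ (Subtype.mem _) ?_
        rw [hg]; exact h
      · rintro ⟨h1, h2⟩
        rw [← hg]
        exact mul_mem (ExpMap.exp_mem_centralSeries h1) (ExpMap.exp_mem_centralSeries h2)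
    rw [hset]
    refine IsClosed.preimage e.symm.continuous ?_
    exact (hV.preimage (continuous_subtype_val.comp continuous_fst)).inter
      (hV.preimage (continuous_subtype_val.comp continuous_snd))

end LieExpMap

/-! ### Bounded remainders and spans of subgroups -/

section Linear

variable {E : Type*} [NormedAddCommGroup E] [NormedSpace ℝ E] [FiniteDimensional ℝ E]

/-- Dividing by n makes the bounded error a/n vanish in the limit, and L is closed. -/
theorem map_mem_of_bounded_remainder (D : E →ₗ[ℝ] E) (L : Submodule ℝ E) {R : ℝ} {w : E}
    (h : ∀ n : ℕ, ∃ a, ‖a‖ ≤ R ∧ D ((n : ℝ) • w - a) ∈ L) : D w ∈ L := by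
  choose a ha hL using h
  have h1 : Tendsto (fun n : ℕ => (n : ℝ)⁻¹ • a n) atTop (𝓝 0) := by
    refine squeeze_zero_norm (a := fun n : ℕ => (n : ℝ)⁻¹ * R) (fun n => ?_) ?_
    · rw [norm_smul, norm_inv, Real.norm_natCast]
      exact mul_le_mul_of_nonneg_left (ha n) (by positivity)
    · simpa using (tendsto_inv_atTop_nhds_zero_nat (𝕜 := ℝ)).mul_const R
  have h2 : Tendsto (fun n : ℕ => D (w - (n : ℝ)⁻¹ • a n)) atTop (𝓝 (D w)) := by
    have h := h1.const_sub w
    rw [sub_zero] at h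
    exact (D.continuous_of_finiteDimensional.tendsto w).comp h
  refine (Submodule.closed_of_finiteDimensional L).mem_of_tendsto h2
    ((eventually_ne_atTop 0).mono fun n hn => ?_)
  have hn' : (n : ℝ) ≠ 0 := by exact_mod_cast hn
  have h3 : w - (n : ℝ)⁻¹ • a n = (n : ℝ)⁻¹ • ((n : ℝ) • w - a n) := by
    rw [smul_sub, smul_smul, inv_mul_cancel₀ hn', one_smul]
  rw [h3, map_smul]
  exact L.smul_mem _ (hL n)

/-- Round the coordinates down in a basis of the span chosen inside Λ. -/
theorem exists_norm_sub_le_of_mem_span (Λ : AddSubgroup E) :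
    ∃ R, ∀ v ∈ Submodule.span ℝ (Λ : Set E), ∃ l ∈ Λ, ‖v - l‖ ≤ R := by
  obtain ⟨b, hb, hspan, hli⟩ := exists_linearIndependent ℝ (Λ : Set E)
  have hfin : b.Finite := hli.setFinite
  lift b to Finset E using hfin
  refine ⟨∑ x ∈ b, ‖x‖, fun v hv => ?_⟩
  rw [← hspan] at hv
  obtain ⟨c, -, rfl⟩ := Submodule.mem_span_finset.mp hv
  refine ⟨∑ x ∈ b, ⌊c x⌋ • x, sum_mem fun x hx => Λ.zsmul_mem (hb hx) _, ?_⟩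
  rw [← Finset.sum_sub_distrib]
  refine (norm_sum_le _ _).trans (Finset.sum_le_sum fun x _ => ?_)
  rw [← Int.cast_smul_eq_zsmul ℝ, ← sub_smul, norm_smul, Int.self_sub_floor, Real.norm_eq_abs,
    Int.abs_fract]
  exact mul_le_of_le_one_left (norm_nonneg x) (Int.fract_lt_one _).le

end Linear

/-! ### Lattice vectors and density in the quotients -/

namespace LieExpMap

variable {E : Type*} [NormedAddCommGroup E] [NormedSpace ℝ E]
  {G : Type*} [TopologicalSpace G] [Group G] [IsTopologicalGroup G] {X : LieExpMap E G} {j : ℕ}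

variable (X) in
/-- The tangent vectors of the `j`-th term of the central series whose exponential is congruent to
an element of `Γ` modulo the next term. -/
def latticeTangent (hN : IsClosed (centralSeries G (j + 1) : Set G)) (Γ : Subgroup G) :
    AddSubgroup E where
  carrier := {v | v ∈ X.centralTangent hN ∧
    ∃ γ ∈ Γ ⊓ centralSeries G j, centralMk G j (X.exp v) = centralMk G j γ}
  zero_mem' := ⟨zero_mem _, 1, one_mem _, by rw [X.exp_zero]⟩
  add_mem' := by
    rintro v w ⟨hv, γ, hγ, h⟩ ⟨hw, γ', hγ', h'⟩
    exact ⟨add_mem hv hw, γ * γ', mul_mem hγ hγ', by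
      rw [ExpMap.centralMk_exp_add hN hv, h, h', map_mul]⟩
  neg_mem' := by
    rintro v ⟨hv, γ, hγ, h⟩
    exact ⟨neg_mem hv, γ⁻¹, inv_mem hγ, by rw [X.exp_neg, map_inv, h, map_inv]⟩

theorem centralMk_exp_sub {hN : IsClosed (centralSeries G (j + 1) : Set G)} {v : E}
    (hv : v ∈ X.centralTangent hN) (w : E) :
    centralMk G j (X.exp (v - w)) = centralMk G j (X.exp v) * (centralMk G j (X.exp w))⁻¹ := by
  rw [sub_eq_add_neg, ExpMap.centralMk_exp_add hN hv, X.exp_neg, map_inv]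

variable {φ : MulAut G} {T : E ≃L[ℝ] E} {Γ : Subgroup G}

/-- The images in Γ \ G of the growing balls in product coordinates are open and cover, so by
compactness one of them suffices. -/
theorem exists_bounded_representative
    (hΨ : IsHomeomorph (fun p : contractedSubspace T × contractedSubspace T⁻¹ =>
      X.exp p.1 * X.exp p.2)) (hΓ : CompactSpace (Quotient (QuotientGroup.rightRel Γ))) :
    ∃ R : ℝ, ∀ g, ∃ γ ∈ Γ, ∃ a b : E, ‖a‖ ≤ R ∧ ‖b‖ ≤ R ∧ γ * (X.exp a * X.exp b) = g := by
  let mk : G → Quotient (QuotientGroup.rightRel Γ) := Quotient.mk _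
  let O : ℕ → Set (Quotient (QuotientGroup.rightRel Γ)) := fun n =>
    mk '' ((fun p : contractedSubspace T × contractedSubspace T⁻¹ => X.exp p.1 * X.exp p.2) ''
      ball 0 n)
  have hO : ∀ n, IsOpen (O n) := fun n =>
    isOpenMap_quotient_mk'_mul (Γ := Γ) (T := G) _ (hΨ.isOpenMap _ isOpen_ball)
  have hmono : Monotone O := fun m n hmn =>
    image_mono (image_mono (ball_subset_ball (by exact_mod_cast hmn)))
  have hcov : (univ : Set (Quotient (QuotientGroup.rightRel Γ))) ⊆ ⋃ n, O n := by
    intro q _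
    obtain ⟨g, rfl⟩ := Quotient.exists_rep q
    obtain ⟨p, hp⟩ := hΨ.surjective g
    obtain ⟨n, hn⟩ := exists_nat_gt ‖p‖
    exact mem_iUnion.mpr ⟨n, g, ⟨p, by rwa [mem_ball_zero_iff], hp⟩, rfl⟩
  obtain ⟨n, hn⟩ := isCompact_univ.elim_directed_cover O hO hcov hmono.directed_le
  refine ⟨n, fun g => ?_⟩
  obtain ⟨_, ⟨p, hp, rfl⟩, hg⟩ := hn (mem_univ (mk g))
  have hrel := QuotientGroup.rightRel_apply.mp (Quotient.exact hg)
  rw [mem_ball_zero_iff] at hp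
  exact ⟨_, hrel, p.1, p.2, (norm_fst_le p).trans hp.le, (norm_snd_le p).trans hp.le,
    inv_mul_cancel_right g _⟩

variable [FiniteDimensional ℝ E]

section

variable (hC : ∀ j, IsClosed (centralSeries G j : Set G))

/-- The index is shifted: `centralTangent (hC (j + 1))` belongs to C_j. Modulo C_{j+1}, exp(s + u)
is exp s · exp u, to which the splitting of C_{j+1} applies. -/
theorem mem_centralTangent_succ (hφ : ∀ v, φ (X.exp v) = X.exp (T v)) (hT : IsHyperbolic T)
    (hsplit : ∀ j, ∀ a ∈ contractedSubspace T, ∀ b ∈ contractedSubspace T⁻¹,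
        X.exp a * X.exp b ∈ centralSeries G j →
          (∀ t : ℝ, X.exp (t • a) ∈ centralSeries G j) ∧
            ∀ t : ℝ, X.exp (t • b) ∈ centralSeries G j)
    {v : E} (hv : v ∈ X.centralTangent (hC (j + 1))) (h : X.exp v ∈ centralSeries G (j + 1)) :
    v ∈ X.centralTangent (hC (j + 1 + 1)) := by
  obtain ⟨s, ⟨hs, hsS⟩, u, ⟨hu, huU⟩, rfl⟩ := Submodule.mem_sup.mp
    (hT.le_sup (fun v hv => ExpMap.map_mem_centralTangent hφ hv) hv)
  rw [← centralMk_eq_one, ExpMap.centralMk_exp_add (hC (j + 1)) hs, ← map_mul,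
    centralMk_eq_one] at h
  obtain ⟨h1, h2⟩ := hsplit _ _ hsS _ huU h
  exact add_mem (S := Submodule ℝ E) h1 h2

/-- For j = 0, n • w is a lattice vector up to bounded error. The inductive step carries this
through the commutator pairing, replacing one entry by Γ at a time. -/
theorem centralTangent_le_span_latticeTangent (hφ : ∀ v, φ (X.exp v) = X.exp (T v))
    (hT : IsHyperbolic T)
    (hsplit : ∀ j, ∀ a ∈ contractedSubspace T, ∀ b ∈ contractedSubspace T⁻¹,
        X.exp a * X.exp b ∈ centralSeries G j →
          (∀ t : ℝ, X.exp (t • a) ∈ centralSeries G j) ∧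
            ∀ t : ℝ, X.exp (t • b) ∈ centralSeries G j)
    (hG : ∀ g, ∃ a b, X.exp a * X.exp b = g) {R : ℝ}
    (hR : ∀ g, ∃ γ ∈ Γ, ∃ a b : E, ‖a‖ ≤ R ∧ ‖b‖ ≤ R ∧ γ * (X.exp a * X.exp b) = g) (j : ℕ) :
    X.centralTangent (hC (j + 1)) ≤
      Submodule.span ℝ (X.latticeTangent (hC (j + 1)) Γ : Set E) := by
  have hR2 : ∀ {a b : E}, ‖a‖ ≤ R → ‖b‖ ≤ R → ‖a + b‖ ≤ R + R := fun ha hb =>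
    (norm_add_le _ _).trans (add_le_add ha hb)
  induction j with
  | zero =>
    have hmem : ∀ v, v ∈ X.centralTangent (hC (0 + 1)) := fun v t => Subgroup.mem_top _
    intro w _
    refine map_mem_of_bounded_remainder LinearMap.id _ (R := R + R) fun n => ?_
    obtain ⟨γ, hγ, a, b, ha, hb, hab⟩ := hR (X.exp ((n : ℝ) • w))
    refine ⟨a + b, hR2 ha hb, Submodule.subset_span ⟨hmem _, γ, ⟨hγ, Subgroup.mem_top _⟩, ?_⟩⟩
    rw [LinearMap.id_apply, centralMk_exp_sub (hmem _), ExpMap.centralMk_exp_add _ (hmem a), ← hab,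
      map_mul, map_mul, mul_inv_cancel_right]
    exact hC _
  | succ j ih =>
    set L := Submodule.span ℝ (X.latticeTangent (hC (j + 1 + 1)) Γ : Set E) with hLdef
    have hL : L ≤ X.centralTangent (hC (j + 1 + 1)) := Submodule.span_le.mpr fun v hv => hv.1
    -- The difference v - u is itself a lattice vector, with γ = 1.
    have hcongr : ∀ u ∈ L, ∀ v ∈ X.centralTangent (hC (j + 1 + 1)),
        centralMk G (j + 1) (X.exp u) = centralMk G (j + 1) (X.exp v) → v ∈ L := by
      intro u hu v hv h
      have h1 : X.exp (v - u) ∈ centralSeries G (j + 1 + 1) := by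
        rw [← centralMk_eq_one, centralMk_exp_sub hv, h, mul_inv_cancel]
      have h2 := mem_centralTangent_succ hC hφ hT hsplit (sub_mem hv (hL hu)) h1
      have h3 : v - u ∈ L := Submodule.subset_span ⟨sub_mem hv (hL hu), 1, one_mem _, by
        rw [map_one, centralMk_eq_one]; exact h1⟩
      simpa using L.add_mem h3 hu
    -- With exp(n w) = γ' exp a exp b, applying Ad γ - 1 to n w - (a + b) gives a vector whose
    -- exponential is ⁅γ, γ'⁆ modulo C_{j+2}.
    have h1 : ∀ γ ∈ Γ ⊓ centralSeries G j, ∀ w, X.Ad γ w - w ∈ L := by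
      intro γ hγ w
      refine map_mem_of_bounded_remainder ((X.Ad γ : E →ₗ[ℝ] E) - LinearMap.id) L
        (R := R + R) fun n => ?_
      obtain ⟨γ', hγ', a, b, ha, hb, hab⟩ := hR (X.exp ((n : ℝ) • w))
      refine ⟨a + b, hR2 ha hb, Submodule.subset_span ?_⟩
      have hmem : ∀ v, X.Ad γ v - v ∈ X.centralTangent (hC (j + 1 + 1)) := fun v =>
        Ad_sub_mem_centralTangent hγ.2 v
      have hD : ((X.Ad γ : E →ₗ[ℝ] E) - LinearMap.id : E →ₗ[ℝ] E) ((n : ℝ) • w - (a + b)) =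
          (X.Ad γ ((n : ℝ) • w) - (n : ℝ) • w) - ((X.Ad γ a - a) + (X.Ad γ b - b)) := by
        simp only [LinearMap.sub_apply, LinearMap.id_apply, map_sub, map_add]
        simp only [LinearEquiv.coe_coe, ContinuousLinearEquiv.coe_toLinearEquiv]
      rw [hD]
      refine ⟨sub_mem (hmem _) (add_mem (hmem _) (hmem _)), ⁅γ, γ'⁆,
        ⟨?_, commutator_mem_centralSeries hγ.2 _⟩, ?_⟩
      · exact Γ.mul_mem (Γ.mul_mem (Γ.mul_mem hγ.1 hγ') (Γ.inv_mem hγ.1)) (Γ.inv_mem hγ')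
      · rw [centralMk_exp_sub (hmem _), ExpMap.centralMk_exp_add (hC _) (hmem a),
          centralMk_exp_Ad_sub (hC _) hγ.2, centralMk_exp_Ad_sub (hC _) hγ.2,
          centralMk_exp_Ad_sub (hC _) hγ.2, ← hab, centralMk_commutator_mul_right hγ.2,
          centralMk_commutator_mul_right hγ.2, mul_inv_cancel_right]
    -- The condition is linear in v, so by `ih` lattice vectors v suffice. For exp v congruent to γ,
    -- v - Ad(exp w) v and Ad γ w - w both represent ⁅γ, exp w⁆.
    have h2 : ∀ w, ∀ v ∈ X.centralTangent (hC (j + 1)), v - X.Ad (X.exp w) v ∈ L := by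
      intro w v hv
      have hle : Submodule.span ℝ (X.latticeTangent (hC (j + 1)) Γ : Set E) ≤
          L.comap (LinearMap.id - (X.Ad (X.exp w) : E →ₗ[ℝ] E)) := by
        refine Submodule.span_le.mpr ?_
        rintro v ⟨hv, γ, hγ, h⟩
        refine hcongr _ (h1 γ hγ w) _ (sub_Ad_mem_centralTangent hv _) ?_
        rw [centralMk_exp_Ad_sub (hC _) hγ.2, ← centralMk_commutator_congr h]
        exact (centralMk_exp_sub_Ad (hC _) hv _).symm
      exact hle (ih hv)
    intro v hv
    obtain ⟨u, hu, h⟩ := centralSeries_le_expSubgroup hL hG (fun x hx w => by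
      obtain ⟨v₀, hv₀, h⟩ := exists_centralMk_exp_eq (hC (j + 1)) hG hx
      exact ⟨_, h2 w v₀ hv₀, by
        rw [centralMk_exp_sub_Ad (hC _) hv₀, centralMk_commutator_congr h]⟩)
      (ExpMap.exp_mem_centralSeries hv)
    exact hcongr u hu v hv h

end

/-- The contracted subgroup of a hyperbolic automorphism preserving a cocompact subgroup `Γ` has
dense image in the quotients `Δ_j`. -/
theorem dense_image_contractedSubgroup [Group.IsNilpotent G] [T1Space G]
    (hφ : ∀ v, φ (X.exp v) = X.exp (T v)) (hT : IsHyperbolic T)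
    (hΨ : IsHomeomorph (fun p : contractedSubspace T × contractedSubspace T⁻¹ =>
      X.exp p.1 * X.exp p.2)) (hΓ : CompactSpace (Quotient (QuotientGroup.rightRel Γ)))
    (hφΓ : ∀ γ ∈ Γ, φ⁻¹ γ ∈ Γ) (j : ℕ) :
    Dense ((fun x : centralSeries G j => (QuotientGroup.mk x : Delta Γ j)) ''
      {x | (x : G) ∈ contractedSubgroup φ}) := by
  have hC := fun j => (isClosed_centralSeries_and_split hφ hT hΨ j).1
  have hsplit := fun j => (isClosed_centralSeries_and_split hφ hT hΨ j).2
  have hG : ∀ g, ∃ a b, X.exp a * X.exp b = g := fun g => by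
    obtain ⟨p, hp⟩ := hΨ.surjective g
    exact ⟨_, _, hp⟩
  obtain ⟨R₀, hR₀⟩ := exists_bounded_representative hΨ hΓ
  obtain ⟨R, hR⟩ := exists_norm_sub_le_of_mem_span (X.latticeTangent (hC (j + 1)) Γ)
  let e : E →L[ℝ] contractedSubspace T × contractedSubspace T⁻¹ :=
    (Submodule.prodEquivOfIsCompl _ _ hT.isCompl).symm.toLinearMap.toContinuousLinearMap
  have hφ' := ExpMap.inv_map_exp hφ
  have hφn : ∀ n : ℕ, ∀ γ ∈ Γ, (φ⁻¹ ^ n) γ ∈ Γ := fun n γ hγ => by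
    induction n with
    | zero => exact hγ
    | succ n ih => rw [pow_succ']; exact hφΓ _ ih
  rintro ⟨x, hx⟩
  -- φⁿ x is decomposed as lattice vector plus s + u with u bounded independently of n, then
  -- everything is pulled back by φ⁻ⁿ, which preserves Γ and C_j.
  have key : ∀ n : ℕ, ∃ u ∈ contractedSubspace T⁻¹, ‖u‖ ≤ ‖e‖ * R ∧
      ∃ s ∈ contractedSubspace T, ∃ γ ∈ Γ ⊓ centralSeries G j,
      u ∈ X.centralTangent (hC (j + 1)) ∧ s ∈ X.centralTangent (hC (j + 1)) ∧
      centralMk G j x = centralMk G j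
        (X.exp ((T⁻¹ ^ n) u) * X.exp ((T⁻¹ ^ n) s) * γ) := by
    intro n
    obtain ⟨v, hv, hvx⟩ := exists_centralMk_exp_eq (hC (j + 1)) hG
      (map_mem_centralSeries (φ ^ n) hx)
    obtain ⟨l, ⟨hl, γ, hγ, hlγ⟩, hle⟩ := hR v
      (centralTangent_le_span_latticeTangent hC hφ hT hsplit hG hR₀ j hv)
    obtain ⟨s, ⟨hs, hsS⟩, u, ⟨hu, huU⟩, hsu⟩ := Submodule.mem_sup.mp
      (hT.le_sup (fun v hv => ExpMap.map_mem_centralTangent hφ hv) (sub_mem hv hl))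
    refine ⟨u, huU, ?_, s, hsS, (φ⁻¹ ^ n) γ, ⟨hφn n _ hγ.1, map_mem_centralSeries _ hγ.2⟩, hu, hs,
      ?_⟩
    · have h1 : e (v - l) = (⟨s, hsS⟩, ⟨u, huU⟩) := by
        rw [← hsu]
        exact (LinearEquiv.symm_apply_eq _).mpr rfl
      have h2 : ‖u‖ ≤ ‖e (v - l)‖ := by
        rw [h1]
        exact norm_snd_le ((⟨s, hsS⟩, ⟨u, huU⟩) : contractedSubspace T × contractedSubspace T⁻¹)
      exact h2.trans ((e.le_opNorm _).trans (mul_le_mul_of_nonneg_left hle (norm_nonneg e)))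
    · have h1 : centralMk G j ((φ ^ n) x) = centralMk G j (X.exp u * X.exp s * γ) := by
        rw [← hvx, map_mul, map_mul, ← ExpMap.centralMk_exp_add (hC (j + 1)) hu, add_comm u, hsu,
          ← hlγ, ← ExpMap.centralMk_exp_add (hC (j + 1)) (sub_mem hv hl), sub_add_cancel]
      rw [centralMk_eq] at h1 ⊢
      have h2 := map_mem_centralSeries (φ⁻¹ ^ n) h1
      simp only [map_mul, map_inv, ExpMap.pow_map_exp hφ'] at h2
      rwa [← MulAut.mul_apply, inv_pow φ, inv_mul_cancel, MulAut.one_apply, ← inv_pow] at h2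
  choose u hu hun s hs γ hγ hut hst hx' using key
  have hlim := tendsto_pow_apply_of_bounded T⁻¹ hu hun
  have hTin : ∀ (n : ℕ) {v : E}, v ∈ contractedSubspace T → (T⁻¹ ^ n) v ∈ contractedSubspace T := by
    intro n v hv
    induction n with
    | zero => exact hv
    | succ n ih =>
      rw [pow_succ', continuousLinearEquiv_mul_apply]; exact inv_map_mem_contractedSubspace ih
  have hTit : ∀ (n : ℕ) {v : E}, v ∈ X.centralTangent (hC (j + 1)) →
      (T⁻¹ ^ n) v ∈ X.centralTangent (hC (j + 1)) := by
    intro n v hv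
    induction n with
    | zero => exact hv
    | succ n ih =>
      rw [pow_succ', continuousLinearEquiv_mul_apply]; exact ExpMap.map_mem_centralTangent hφ' ih
  -- y n tends to x because T⁻ⁿ contracts the bounded u n, and in Δ_j it has the class of exp(T⁻ⁿ s
  -- n), an element of the contracted subgroup.
  let y : ℕ → centralSeries G j := fun n =>
    ⟨(X.exp ((T⁻¹ ^ n) (u n)))⁻¹ * x, mul_mem (inv_mem
      (ExpMap.exp_mem_centralSeries (hTit n (hut n)))) hx⟩
  have hy : Tendsto y atTop (𝓝 ⟨x, hx⟩) := by
    rw [tendsto_subtype_rng]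
    have h := (X.tendsto_exp.comp hlim).inv.mul_const x
    rw [inv_one, one_mul] at h
    exact h
  refine mem_closure_of_tendsto ((QuotientGroup.continuous_mk.tendsto _).comp hy)
    (Eventually.of_forall fun n => ?_)
  refine ⟨⟨X.exp ((T⁻¹ ^ n) (s n)), ExpMap.exp_mem_centralSeries (hTit n (hst n))⟩,
    ExpMap.exp_mem_contractedSubgroup hφ (hTin n (hs n)), ?_⟩
  refine QuotientGroup.eq.mpr ?_
  rw [Subgroup.mem_subgroupOf]
  have h1 := centralMk_eq.mp (hx' n).symm
  rw [show ∀ p : centralSeries G j, ((p⁻¹ * y n : centralSeries G j) : G) = (p : G)⁻¹ * y n from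
    fun p => rfl]
  have h2 : (X.exp ((T⁻¹ ^ n) (s n)))⁻¹ * (y n : G) = γ n *
      ((X.exp ((T⁻¹ ^ n) (u n)) * X.exp ((T⁻¹ ^ n) (s n)) * γ n)⁻¹ * x) := by
    simp only [y]; group
  rw [h2]
  exact mul_mem (Subgroup.mem_sup_right (hγ n)) (Subgroup.mem_sup_left h1)

end LieExpMap

/-! ### Identification of the stable and unstable subgroups, and conclusion -/

section

variable {V : Type*} [NormedAddCommGroup V] [NormedSpace ℝ V]

theorem vanishingSubspace_atTop (T : V ≃L[ℝ] V) :
    vanishingSubspace T atTop = contractedSubspace T := by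
  ext v
  show Tendsto (fun n : ℤ => (T ^ n) v) atTop (𝓝 0) ↔ Tendsto (fun n : ℕ => (T ^ n) v) atTop (𝓝 0)
  rw [← Nat.map_cast_int_atTop, tendsto_map'_iff]
  simp only [Function.comp_def, zpow_natCast]

theorem vanishingSubspace_atBot (T : V ≃L[ℝ] V) :
    vanishingSubspace T atBot = contractedSubspace T⁻¹ := by
  rw [← vanishingSubspace_atTop]
  ext v
  show Tendsto (fun n : ℤ => (T ^ n) v) atBot (𝓝 0) ↔
    Tendsto (fun n : ℤ => (T⁻¹ ^ n) v) atTop (𝓝 0)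
  simp only [inv_zpow']
  rw [← Filter.map_neg_atTop, tendsto_map'_iff]
  rfl

theorem IsHyperbolic.inv {T : V ≃L[ℝ] V} (hT : IsHyperbolic T) : IsHyperbolic T⁻¹ := by
  intro z hz h
  have hz0 : z ≠ 0 := fun h0 => by simp [h0] at hz
  obtain ⟨x, hx⟩ := h.exists_hasEigenvector
  refine hT z⁻¹ (by rw [norm_inv, hz, inv_one])
    (Module.End.hasEigenvalue_of_hasEigenvector (x := x) ?_)
  refine Module.End.hasEigenvector_iff.mpr ⟨Module.End.mem_eigenspace_iff.mpr ?_, hx.2⟩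
  have h1 := Module.End.mem_eigenspace_iff.mp hx.1
  have h2 : ∀ y, LinearMap.baseChange ℂ (T.toLinearEquiv.toLinearMap : Module.End ℝ V)
      (LinearMap.baseChange ℂ (T⁻¹.toLinearEquiv.toLinearMap : Module.End ℝ V) y) = y := by
    intro y
    rw [← LinearMap.comp_apply, ← LinearMap.baseChange_comp]
    have h3 : (T.toLinearEquiv.toLinearMap : Module.End ℝ V).comp T⁻¹.toLinearEquiv.toLinearMap =
        LinearMap.id := LinearMap.ext fun v => T.apply_symm_apply v
    rw [h3, LinearMap.baseChange_id, LinearMap.id_apply]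
  have h3 := h2 x
  rw [h1, map_smul] at h3
  rw [← h3, smul_smul, inv_mul_cancel₀ hz0, one_smul, h3]

end

namespace LieExpMap

variable {E : Type*} [NormedAddCommGroup E] [NormedSpace ℝ E] [FiniteDimensional ℝ E]
  {G : Type*} [TopologicalSpace G] [Group G] [IsTopologicalGroup G] {X : LieExpMap E G}
  {φ : MulAut G} {T : E ≃L[ℝ] E} {Γ : Subgroup G}

theorem isAcceptable_contractedSubgroup [Group.IsNilpotent G] [T1Space G] [SimplyConnectedSpace G]
    [LocallyPathConnectedSpace G]
    (hφ : ∀ v, φ (X.exp v) = X.exp (T v)) (hT : IsHyperbolic T)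
    (hΓ : CompactSpace (Quotient (QuotientGroup.rightRel Γ)))
    (hφΓ : ∀ γ ∈ Γ, φ⁻¹ γ ∈ Γ) : IsAcceptable Γ (contractedSubgroup φ) := by
  have hΨ := X.isHomeomorph_exp_mul_exp hφ hT
  have himage : (contractedSubgroup φ : Set G) = X.exp '' contractedSubspace T := by
    ext g
    constructor
    · intro hg
      exact ExpMap.exists_exp_eq_of_mem_contractedSubgroup hφ hg
    · rintro ⟨v, hv, rfl⟩
      exact ExpMap.exp_mem_contractedSubgroup hφ hv
  refine ⟨?_, ?_, dense_image_contractedSubgroup hφ hT hΨ hΓ hφΓ⟩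
  · have hset : (contractedSubgroup φ : Set G) =
        (fun p : contractedSubspace T × contractedSubspace T⁻¹ => X.exp p.1 * X.exp p.2) ''
          {p | p.2 = 0} := by
      rw [himage]
      ext g
      constructor
      · rintro ⟨v, hv, rfl⟩
        exact ⟨(⟨v, hv⟩, 0), rfl, by simp [X.exp_zero]⟩
      · rintro ⟨⟨v, w⟩, hw, rfl⟩
        obtain rfl : w = 0 := hw
        exact ⟨v, v.2, by simp [X.exp_zero]⟩
    rw [hset]
    exact hΨ.isClosedMap _ (isClosed_eq continuous_snd continuous_const)
  · rw [himage]
    exact ((contractedSubspace T).convex.isConnected ⟨0, zero_mem _⟩).image _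
      X.continuous_exp.continuousOn

end LieExpMap

section LieGroup

variable {E : Type*} [NormedAddCommGroup E] [NormedSpace ℝ E]
  {G : Type*} [TopologicalSpace G] [ChartedSpace E G] [Group G]

variable (E G) in
/-- A Lie group has an exponential map, which gives its one-parameter subgroups. -/
theorem exists_lieExpMap [LieGroup 𝓘(ℝ, E) ∞ G] [CompleteSpace E] : ∃ X : LieExpMap E G,
    (∀ v : E, IsOneParameterSubgroup (E := E) (fun t : ℝ => X.exp (t • v)) v) ∧
    ∀ (γ : ℝ → G) (v : E), IsOneParameterSubgroup (E := E) γ v → ∀ t, γ t = X.exp (t • v) := by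
  obtain ⟨X, h1, h2⟩ := exists_expMap (E := E) (G := G)
  refine ⟨{ X with
    Ad := fun g => ((LieAut.conj (E := E) g).lieMap : E ≃L[ℝ] E)
    exp_Ad := fun g v => ?_ }, h1, h2⟩
  have h : (LieAut.conj (E := E) g).toMulEquiv (X.exp ((1 : ℝ) • v)) =
      X.exp ((1 : ℝ) • ((LieAut.conj (E := E) g).lieMap : E ≃L[ℝ] E) v) :=
    h2 _ _ ((h1 v).comp_lieAut (LieAut.conj g)) 1
  rw [one_smul, one_smul] at h
  exact h.symm

/-- The exponentials of contracted vectors already form a group, namely all elements contracted by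
φ, so passing to the generated subgroup adds nothing. -/
theorem integralSubgroup_contractedSubspace [IsTopologicalGroup G] {X : ExpMap E G}
    (h1 : ∀ v : E, IsOneParameterSubgroup (E := E) (fun t : ℝ => X.exp (t • v)) v)
    (h2 : ∀ (γ : ℝ → G) (v : E), IsOneParameterSubgroup (E := E) γ v → ∀ t, γ t = X.exp (t • v))
    {φ : MulAut G} {T : E ≃L[ℝ] E} (hφ : ∀ v, φ (X.exp v) = X.exp (T v)) :
    integralSubgroup (E := E) (G := G) (contractedSubspace (V := E) T) = contractedSubgroup φ := by
  refine le_antisymm ((Subgroup.closure_le _).mpr ?_) fun g hg => Subgroup.subset_closure ?_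
  · rintro g ⟨v, hv, γ, hγ, rfl⟩
    have h := ExpMap.exp_mem_contractedSubgroup hφ hv
    rw [← one_smul ℝ v] at h
    rw [h2 γ v hγ 1]
    exact h
  · obtain ⟨v, hv, rfl⟩ := ExpMap.exists_exp_eq_of_mem_contractedSubgroup hφ hg
    exact ⟨v, hv, _, h1 v, congrArg X.exp (one_smul ℝ v)⟩

end LieGroup

end Nilmanifold

theorem proposition3p8
    {E : Type*} [NormedAddCommGroup E] [NormedSpace ℝ E] [FiniteDimensional ℝ E]
    {G : Type*} [TopologicalSpace G] [ChartedSpace E G] [Group G] [LieGroup 𝓘(ℝ, E) ∞ G]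
    [T2Space G] [SecondCountableTopology G] [SimplyConnectedSpace G] [Group.IsNilpotent G]
    (Γ : Subgroup G) (hΓ : Nilmanifold.IsCocompactLattice Γ)
    (f : Nilmanifold.LieAut E G) (hf : Nilmanifold.IsAlgebraicAnosov Γ f) :
    Nilmanifold.IsAcceptable Γ (Nilmanifold.stableSubgroup f) ∧
      Nilmanifold.IsAcceptable Γ (Nilmanifold.unstableSubgroup f) := by
  have : IsTopologicalGroup G := topologicalGroup_of_lieGroup 𝓘(ℝ, E) ∞
  have : LocallyPathConnectedSpace G := ChartedSpace.locallyPathConnectedSpace E G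
  have : CompleteSpace E := FiniteDimensional.complete ℝ E
  obtain ⟨X, h1, h2⟩ := Nilmanifold.exists_lieExpMap E G
  let T : E ≃L[ℝ] E := f.lieMap
  let φ : MulAut G := f.toMulEquiv
  have hφ : ∀ v, φ (X.exp v) = X.exp (T v) := fun v => by
    have h : φ (X.exp ((1 : ℝ) • v)) = X.exp ((1 : ℝ) • T v) := h2 _ _ ((h1 v).comp_lieAut f) 1
    rw [one_smul, one_smul] at h
    exact h
  have hφ' := Nilmanifold.ExpMap.inv_map_exp hφ
  have hT : Nilmanifold.IsHyperbolic T := hf.not_hasEigenvalue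
  have hφΓ : ∀ γ ∈ Γ, φ γ ∈ Γ := fun γ hγ => by
    rw [← hf.map_eq]; exact Subgroup.mem_map_of_mem _ hγ
  have hφΓ' : ∀ γ ∈ Γ, φ⁻¹ γ ∈ Γ := fun γ hγ => by
    rw [← hf.map_eq] at hγ
    obtain ⟨γ', hγ', rfl⟩ := hγ
    exact (φ.symm_apply_apply γ').symm ▸ hγ'
  have hs : Nilmanifold.stableSubgroup f = Nilmanifold.contractedSubgroup φ := by
    rw [← Nilmanifold.integralSubgroup_contractedSubspace h1 h2 hφ,
      ← Nilmanifold.vanishingSubspace_atTop T]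
    rfl
  have hu : Nilmanifold.unstableSubgroup f = Nilmanifold.contractedSubgroup φ⁻¹ := by
    rw [← Nilmanifold.integralSubgroup_contractedSubspace h1 h2 hφ',
      ← Nilmanifold.vanishingSubspace_atBot T]
    rfl
  rw [hs, hu]
  refine ⟨Nilmanifold.LieExpMap.isAcceptable_contractedSubgroup hφ hT hΓ.cocompact hφΓ', ?_⟩
  -- The unstable case is the stable case of φ⁻¹, whose hypothesis on Γ concerns (φ⁻¹)⁻¹ = φ.
  exact Nilmanifold.LieExpMap.isAcceptable_contractedSubgroup hφ' hT.inv hΓ.cocompact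
    (by rwa [inv_inv])
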